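/- **Notation.** For $\rho>0$ put $T_\rho=\{z\in\mathbb C : \operatorname{dist}(z,\mathbb R_{\ge 0})<\rho\}$ and $S(\rho)=\{\hbar : \operatorname{Re}(1/\hbar)>1/\rho\}$ (a Borel disc). For a holomorphic function $f$ on $U\times S(\rho)$ and a formal series $\hat f=\sum_k f_k(z)\hbar^k$ with coefficients holomorphic on $U$, write $f\simeq\hat f$ uniformly on $U$ if there are $\delta\in(0,\rho]$ and $C,M>0$ with $|f(z,\hbar)-\sum_{k<n}f_k(z)\hbar^k|\le CM^n n!\,|\hbar|^n$ for all $n\ge0$, $z\in U$, $\hbar\in S(\delta)$ (uniform Gevrey asymptotics along the closed arc $[-\frac\pi2,\frac\pi2]$). The formal Borel transform of $\hat f$ is $\sum_k \frac1{k!}f_{k+1}(z)\xi^k$. A *Borel continuation* of $\hat f$ to $U\times T_\epsilon$ is a holomorphic function $\varphi$ on $U\times T_\epsilon$ with $|\varphi(z,\xi)|\le Ke^{L|\xi|}$ for some constants $K,L>0$, which for all $z \in U$ and all $\xi$ near $0$ (uniformly in $z$) is the sum of the formal Borel transform of $\hat f$. The Laplace transform is $\mathcal L[\varphi](z,\hbar)=\int_0^\infty\varphi(z,\xi)e^{-\xi/\hbar}\,d\xi$.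 **Lemma.** Let $r,d>0$, and let $A_0,A_1,A_2$ be holomorphic functions on $T_r\times S(d)$ with $A_i\simeq\hat A_i=\sum_k a_{i,k}(z)\hbar^k$ uniformly on $T_r$. Consider the Riccati equation $$\hbar\,\partial_zF=F+\hbar\,(A_2F^2+A_1F+A_0).\qquad(*)$$ The formal equation obtained by replacing each $A_i$ by $\hat A_i$ has a unique formal solution $\hat F=\sum_k F_k(z)\hbar^k$ with coefficients holomorphic on $T_r$; moreover $F_0=0$ and $F_1=-a_{0,0}$. For every $r_0\in(0,r)$ there are $d_0\in(0,d]$, a holomorphic solution $F$ of $(*)$ on $T_{r_0}\times S(d_0)$ with $F\simeq\hat F$ uniformly on $T_{r_0}$, and a function $\varphi(z,\xi)$, such that $F$ is the only holomorphic solution on $T_{r_0}\times S(d_0)$ with this asymptotic expansion, and the following hold. 1. There are $C,M>0$ with $|F_k(z)|\le CM^kk!$ for all $k\ge 0$ and $z\in T_{r_0}$, and the formal Borel transform of $\hat F$ converges uniformly on $T_{r_0}\times\{|\xi|<\rho\}$ for some $\rho>0$. 2. For $z\in T_{r_0}$ and $\xi>0$, $\varphi$ is the Borel transform of $F$: for every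 $\delta\in(0,d_0)$, $$\varphi(z,\xi)=\lim_{T\to\infty}\frac1{2\pi i}\int F(z,\hbar)\,e^{\xi/\hbar}\,\frac{d\hbar}{\hbar^2},$$ where the integral is over the path $\hbar=(1/\delta+it)^{-1}$, from $t=T$ to $t=-T$, and the limit is uniform for $z\in T_{r_0}$ and $\xi$ in any compact subset of $(0,\infty)$. For some $\epsilon\in(0,r-r_0)$ the series $\hat A_0,\hat A_1,\hat A_2$ have Borel continuations to $T_r\times T_\epsilon$. For every $\epsilon\in(0,r-r_0)$ such that $\hat A_0,\hat A_1,\hat A_2$ have Borel continuations $\alpha_0,\alpha_1,\alpha_2$ to $T_r\times T_\epsilon$, $\varphi$ is a Borel continuation of $\hat F$ to $T_{r_0}\times T_\epsilon$, and there $\varphi=\sum_{n\ge0}\varphi_n$, where, with $a_i=a_{i,0}$, $(\beta*\gamma)(z,\xi)=\int_0^\xi\beta(z,\xi-y)\gamma(z,y)\,dy$ and $I[\beta](z,\xi)=-\int_0^\xi\beta(z+\xi-u,u)\,du$ (integrals along line segments), $\varphi_0(z,\xi)=-a_0(z+\xi)$, $\varphi_1=I[\alpha_0+a_1\varphi_0]$,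 and for $n\ge2$ $$\varphi_n=I\Big[a_1\varphi_{n-1}+\alpha_1*\varphi_{n-2}+\sum_{i+j=n-2}a_2\,\varphi_i*\varphi_j+\sum_{i+j=n-3}\alpha_2*\varphi_i*\varphi_j\Big].$$ 3. The integral $\mathcal L[\varphi]$ converges absolutely at each point and uniformly on $T_{r_0}\times S(d_0)$, and $F=\mathcal L[\varphi]$ there. 4. $F$ is the uniform Borel resummation of $\hat F$ on $T_{r_0}\times S(d_0)$: $\hat F$ is uniformly Gevrey on $T_{r_0}$, has a Borel continuation to $T_{r_0}\times T_\epsilon$ for some $\epsilon>0$, and $F$ equals $F_0$ plus the (uniformly convergent) Laplace transform of this continuation. 5. If for some $\omega\in\mathbb C$ each $A_i$ is periodic in $z$ with period $\omega$ (that is, $A_i(z+\omega,\hbar)=A_i(z,\hbar)$ whenever $z,z+\omega\in T_r$), then so is $F$ (whenever $z,z+\omega\in T_{r_0}$). -/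

import Mathlib

open Set Filter Topology MeasureTheory

noncomputable section

/-- The nonnegative real axis, as a subset of the complex plane. -/
def posRealAxis : Set ℂ := (fun x : ℝ => (x : ℂ)) '' Ici 0

/-- The points at distance less than `r` from the nonnegative real axis. In the `z`-plane this is
the horizontal halfstrip of radius `r`, in the Borel plane it is the tubular neighbourhood of
thickness `r`. -/
def tube (r : ℝ) : Set ℂ := {z | Metric.infDist z posRealAxis < r}

/-- The Borel disc of diameter `d`, bisected by the positive real direction. -/
def borelDisc (d : ℝ) : Set ℂ := {h | 1 / d < (1 / h).re}

/-- The function of two variables `f` is (jointly) holomorphic on `U × V`. -/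
def HolomorphicOnProd (f : ℂ → ℂ → ℂ) (U V : Set ℂ) : Prop :=
  DifferentiableOn ℂ (fun p : ℂ × ℂ => f p.1 p.2) (U ×ˢ V)

/-- A sequence `c` of functions stands for the formal power series `∑ c k (z) ħ ^ k`; this says that
its coefficients are holomorphic on `U`. -/
def HolomorphicCoeffs (U : Set ℂ) (c : ℕ → ℂ → ℂ) : Prop :=
  ∀ k, DifferentiableOn ℂ (c k) U

/-- The formal power series `∑ c k (z) ħ ^ k` at a fixed point `z`. -/
def seriesAt (c : ℕ → ℂ → ℂ) (z : ℂ) : PowerSeries ℂ := PowerSeries.mk fun k => c k z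

/-- `f ≃ ∑ c k (z) ħ ^ k` as `ħ → 0` along the closed arc `[-π/2, π/2]`, uniformly for `z ∈ U`, in
the Gevrey sense, for a function `f` on `U × borelDisc d`: the Gevrey bounds hold, with constants
that depend neither on `z` nor on the direction, for all `ħ` in some Borel disc. -/
def UniformGevreyAsymptotics (U : Set ℂ) (d : ℝ) (f : ℂ → ℂ → ℂ) (c : ℕ → ℂ → ℂ) : Prop :=
  HolomorphicCoeffs U c ∧
    ∃ δ : ℝ, 0 < δ ∧ δ ≤ d ∧ ∃ C M : ℝ, 0 < C ∧ 0 < M ∧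
      ∀ n : ℕ, ∀ z ∈ U, ∀ h ∈ borelDisc δ,
        ‖f z h - ∑ k ∈ Finset.range n, c k z * h ^ k‖ ≤ C * M ^ n * (n.factorial : ℝ) * ‖h‖ ^ n

/-- `∑ c k (z) ħ ^ k` is a uniformly Gevrey series on `U`. -/
def UniformGevreySeries (U : Set ℂ) (c : ℕ → ℂ → ℂ) : Prop :=
  HolomorphicCoeffs U c ∧
    ∃ C M : ℝ, 0 < C ∧ 0 < M ∧ ∀ k : ℕ, ∀ z ∈ U, ‖c k z‖ ≤ C * M ^ k * (k.factorial : ℝ)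

/-- `F` satisfies the Riccati equation `ħ ∂_z F = F + ħ (A₂ F² + A₁ F + A₀)` on `U × S`. -/
def SolvesRiccati (A : Fin 3 → ℂ → ℂ → ℂ) (U S : Set ℂ) (F : ℂ → ℂ → ℂ) : Prop :=
  ∀ z ∈ U, ∀ h ∈ S,
    h * deriv (fun w => F w h) z =
      F z h + h * (A 2 z h * F z h ^ 2 + A 1 z h * F z h + A 0 z h)

/-- `∑ c k (z) ħ ^ k` is a formal solution on `U` (with holomorphic coefficients) of the Riccati
equation whose coefficients are the formal series `∑ a i k (z) ħ ^ k`. -/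
def IsFormalSolution (a : Fin 3 → ℕ → ℂ → ℂ) (U : Set ℂ) (c : ℕ → ℂ → ℂ) : Prop :=
  HolomorphicCoeffs U c ∧
    ∀ z ∈ U,
      PowerSeries.X * seriesAt (fun k => deriv (c k)) z =
        seriesAt c z + PowerSeries.X *
          (seriesAt (a 2) z * seriesAt c z ^ 2 + seriesAt (a 1) z * seriesAt c z + seriesAt (a 0) z)

/-- The coefficients of the formal Borel transform of `∑ c k (z) ħ ^ k`. -/
def formalBorel (c : ℕ → ℂ → ℂ) (k : ℕ) (z : ℂ) : ℂ := c (k + 1) z / (k.factorial : ℂ)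

/-- The power series `∑ b k (z) ξ ^ k` has holomorphic coefficients and is uniformly convergent on
`U`: its partial sums converge uniformly on `U` times some disc around `0`. -/
def UniformlyConvergentSeries (U : Set ℂ) (b : ℕ → ℂ → ℂ) : Prop :=
  HolomorphicCoeffs U b ∧
    ∃ ρ : ℝ, 0 < ρ ∧
      TendstoUniformlyOn (fun (N : ℕ) (p : ℂ × ℂ) => ∑ k ∈ Finset.range N, b k p.1 * p.2 ^ k)
        (fun p => ∑' k, b k p.1 * p.2 ^ k) atTop (U ×ˢ Metric.ball 0 ρ)

/-- `φ` is an analytic continuation, to `U × tube ε`, of the formal Borel transform of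
`∑ c k (z) ħ ^ k`, with uniformly at most exponential growth. -/
def IsBorelContinuation (U : Set ℂ) (ε : ℝ) (c : ℕ → ℂ → ℂ) (φ : ℂ → ℂ → ℂ) : Prop :=
  HolomorphicOnProd φ U (tube ε) ∧
    (∃ K L : ℝ, 0 < K ∧ 0 < L ∧
      ∀ z ∈ U, ∀ ξ ∈ tube ε, ‖φ z ξ‖ ≤ K * Real.exp (L * ‖ξ‖)) ∧
    ∃ ρ : ℝ, 0 < ρ ∧ ∀ z ∈ U, ∀ ξ ∈ tube ε, ‖ξ‖ < ρ →
      HasSum (fun k => formalBorel c k z * ξ ^ k) (φ z ξ)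

/-- Parameterisation of the boundary of the Borel disc of diameter `δ`. -/
def borelPath (δ t : ℝ) : ℂ := ((1 / δ : ℝ) + (t : ℂ) * Complex.I)⁻¹

/-- The integral of `f (z, ħ) e ^ (ξ / ħ) dħ / ħ²`, divided by `2πi`, over the part `|t| ≤ T` of the
boundary of the Borel disc of diameter `δ`, traversed anticlockwise (from `t = T` to `t = -T`).
The velocity of `t ↦ ħ(t) = borelPath δ t` is `-i ħ(t)²`. -/
def borelIntegral (f : ℂ → ℂ → ℂ) (δ T : ℝ) (z ξ : ℂ) : ℂ :=
  (2 * (Real.pi : ℂ) * Complex.I)⁻¹ *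
    ∫ t in T..(-T), f z (borelPath δ t) * Complex.exp (ξ / borelPath δ t) / borelPath δ t ^ 2 *
      (-Complex.I * borelPath δ t ^ 2)

/-- On the positive real axis, `φ` is the analytic Borel transform of the function `f` on
`U × borelDisc d`: for every `δ < d` the principal values of the Borel integrals over the boundary
of the Borel disc of diameter `δ` converge to `φ`, uniformly in `z ∈ U` and locally uniformly in
`ξ > 0`. -/
def IsBorelTransform (U : Set ℂ) (d : ℝ) (f φ : ℂ → ℂ → ℂ) : Prop :=
  ∀ δ : ℝ, 0 < δ → δ < d → ∀ K : Set ℝ, IsCompact K → K ⊆ Ioi 0 →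
    TendstoUniformlyOn (fun (T : ℝ) (p : ℂ × ℝ) => borelIntegral f δ T p.1 (p.2 : ℂ))
      (fun p => φ p.1 (p.2 : ℂ)) atTop (U ×ˢ K)

/-- The Laplace transform in the positive real direction. -/
def laplace (φ : ℂ → ℂ → ℂ) (z h : ℂ) : ℂ :=
  ∫ ξ in Ioi (0 : ℝ), φ z (ξ : ℂ) * Complex.exp (-(ξ : ℂ) / h)

/-- The Laplace integral of `φ` converges (absolutely), uniformly on `U × S`. -/
def LaplaceUniformlyConvergent (U S : Set ℂ) (φ : ℂ → ℂ → ℂ) : Prop :=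
  (∀ z ∈ U, ∀ h ∈ S,
    IntegrableOn (fun ξ : ℝ => φ z (ξ : ℂ) * Complex.exp (-(ξ : ℂ) / h)) (Ioi 0)) ∧
  TendstoUniformlyOn
    (fun (T : ℝ) (p : ℂ × ℂ) =>
      ∫ ξ in (0 : ℝ)..T, φ p.1 (ξ : ℂ) * Complex.exp (-(ξ : ℂ) / p.2))
    (fun p => laplace φ p.1 p.2) atTop (U ×ˢ S)

/-- On `U × S`, the function `F` is the uniform Borel resummation, in the positive real direction,
of the uniformly Gevrey series `∑ c k (z) ħ ^ k`: the leading term plus the Laplace transform of the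
analytic continuation of the formal Borel transform. -/
def IsUniformBorelResummation (U S : Set ℂ) (c : ℕ → ℂ → ℂ) (F : ℂ → ℂ → ℂ) : Prop :=
  UniformGevreySeries U c ∧
    ∃ ε : ℝ, 0 < ε ∧ ∃ φ : ℂ → ℂ → ℂ, IsBorelContinuation U ε c φ ∧
      LaplaceUniformlyConvergent U S φ ∧
      ∀ z ∈ U, ∀ h ∈ S, F z h = c 0 z + laplace φ z h

/-- The function `f` on `U × S` is periodic in `z` with period `ω`, so far as `U` allows. -/
def PeriodicInZ (U S : Set ℂ) (ω : ℂ) (f : ℂ → ℂ → ℂ) : Prop :=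
  ∀ z ∈ U, z + ω ∈ U → ∀ h ∈ S, f (z + ω) h = f z h

/-- Convolution in the second variable,
the integral of `φ (z, ξ - y) ψ (z, y) dy` over the segment from `0` to `ξ`. -/
def borelConv (φ ψ : ℂ → ℂ → ℂ) (z ξ : ℂ) : ℂ :=
  ξ * ∫ t in (0 : ℝ)..1, φ z (ξ - t * ξ) * ψ z (t * ξ)

/-- Minus the integral of `β (z + ξ - u, u) du` over the segment from `0` to `ξ`. -/
def charIntegral (β : ℂ → ℂ → ℂ) (z ξ : ℂ) : ℂ :=
  -(ξ * ∫ t in (0 : ℝ)..1, β (z + ξ - t * ξ) (t * ξ))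

/-- The terms of the series of successive approximations to the solution of
`∂_z φ - ∂_ξ φ = α₀ + a₁ φ + α₁ * φ + a₂ φ * φ + α₂ * φ * φ`, `φ (z, 0) = -a₀ (z)`. -/
def succApprox (a : Fin 3 → ℂ → ℂ) (α : Fin 3 → ℂ → ℂ → ℂ) : ℕ → ℂ → ℂ → ℂ
  | 0 => fun z ξ => -a 0 (z + ξ)
  | 1 => charIntegral fun z ξ => α 0 z ξ + a 1 z * (-a 0 (z + ξ))
  | n + 2 => charIntegral fun z ξ =>
      a 1 z * succApprox a α (n + 1) z ξ
        + borelConv (α 1) (succApprox a α n) z ξ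
        + ∑ i : Fin (n + 1),
            a 2 z * borelConv (succApprox a α i.1) (succApprox a α (n - i.1)) z ξ
        + ∑ i : Fin n,
            borelConv (α 2) (borelConv (succApprox a α i.1) (succApprox a α (n - 1 - i.1))) z ξ
termination_by n => n
decreasing_by
  all_goals omega

end

/-! Divide the equation by `ħ` and write `s = 1/ħ`. If `F` is the Laplace transform of `φ`, then `s
F` is the Laplace transform of `∂_ξ φ` plus `φ(z, 0)`, and products become convolutions. With `A_i =
a_i + L[α_i]` the Riccati equation turns into `∂_z φ - ∂_ξ φ = α₀ + a₁ φ + α₁ * φ + a₂ φ * φ + α₂ *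
φ * φ`, with `φ(z, 0) = -a₀(z)`. Its characteristics are the lines `z + ξ = const`, so integrating
along them gives a fixed-point equation, whose iterates are `succApprox`.

The representation `A_i = a_i + L[α_i]` is Nevanlinna's theorem (`exists_isBorelContinuation`). The
inverse Laplace integral of a remainder of order `n + 3` yields the `n`-th derivative of the Borel
transform on the half-line, bounded by `C M ^ n n! e ^ (c x)`. Its Taylor series at real centres
therefore have a common radius and glue to a function on a tube. Applied to a function with zero
asymptotic series, this also gives Watson's lemma, hence uniqueness of `F` and its periodicity.

The iteration converges because `|ξ| ^ n / n! e ^ (L |ξ|)` is preserved with exact constants: a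
convolution takes orders `i` and `j` to `i + j + 1`, and a characteristic integral raises the order
by one. The constants satisfy the Catalan recursion, so the `n`-th iterate is at most `K Q ^ n |ξ| ^
n / n! e ^ (L |ξ|)`, and the sum is entire in character: it exists on the whole tube and grows at
most like `e ^ ((L + Q) |ξ|)` (`IsBorelData.exists_norm_bounds`, `IsBorelData.approxSum_eq`).

Going back, the Laplace transform of the sum solves the equation (`IsBorelData.solvesRiccati`), and
integration by parts with Cauchy's estimates gives it Gevrey asymptotics
(`uniformGevreyAsymptotics_laplace`). Its asymptotic series solves the formal equation, which
determines its coefficients recursively, so it is `Fhat`; hence `φ` continues the formal Borel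
transform (`approxSum_spec`). The Borel integral formula is Laplace inversion
(`isBorelTransform_laplace`), where only the term `φ(z, 0) / s` converges conditionally. -/

/-! ### Holomorphic parameter integrals -/

/-- Cauchy's estimate for the Fréchet derivative. -/
lemma norm_fderiv_le_of_differentiableOn_ball {f : ℂ × ℂ → ℂ} {p : ℂ × ℂ} {R C : ℝ} (hR : 0 < R)
    (hf : DifferentiableOn ℂ f (Metric.ball p R)) (hC : ∀ q ∈ Metric.ball p R, ‖f q‖ ≤ C)
    {q : ℂ × ℂ} (hq : q ∈ Metric.ball p (R / 2)) : ‖fderiv ℂ f q‖ ≤ 4 * C / R := by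
  have hC0 : 0 ≤ C := (norm_nonneg _).trans (hC p (Metric.mem_ball_self hR))
  have hqR : q ∈ Metric.ball p R := Metric.ball_subset_ball (by linarith) hq
  refine ContinuousLinearMap.opNorm_le_bound _ (by positivity) fun v => ?_
  rcases eq_or_ne v 0 with rfl | hv
  · simp
  have hv' : 0 < ‖v‖ := norm_pos_iff.2 hv
  have hmem : ∀ w ∈ Metric.ball (0 : ℂ) (R / 2 / ‖v‖), q + w • v ∈ Metric.ball p R := by
    intro w hw
    rw [mem_ball_zero_iff, lt_div_iff₀ hv'] at hw
    rw [Metric.mem_ball, dist_eq_norm] at hq ⊢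
    calc ‖q + w • v - p‖ = ‖(q - p) + w • v‖ := by congr 1; abel
      _ ≤ ‖q - p‖ + ‖w‖ * ‖v‖ := (norm_add_le _ _).trans (by rw [norm_smul])
      _ < R := by linarith
  have hline : HasDerivAt (fun w : ℂ => f (q + w • v)) (fderiv ℂ f q v) 0 := by
    have h1 : HasFDerivAt f (fderiv ℂ f q) (q + (0 : ℂ) • v) := by
      simpa using (hf.differentiableAt (Metric.isOpen_ball.mem_nhds hqR)).hasFDerivAt
    have h2 : HasDerivAt (fun w : ℂ => q + w • v) v 0 := by
      simpa using ((hasDerivAt_id (0 : ℂ)).smul_const v).const_add q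
    exact h1.comp_hasDerivAt (0 : ℂ) h2
  -- On the complex line through `q` in direction `v`, the disc of radius `R / 2 / ‖v‖` stays in the
  -- ball. Cauchy's estimate on half that radius gives `4 C ‖v‖ / R`.
  have hρ : 0 < R / 4 / ‖v‖ := by positivity
  have hsub : R / 4 / ‖v‖ < R / 2 / ‖v‖ := by gcongr; linarith
  have hd : DifferentiableOn ℂ (fun w : ℂ => f (q + w • v)) (Metric.ball 0 (R / 2 / ‖v‖)) :=
    hf.comp (by fun_prop) hmem
  have := Complex.norm_deriv_le_of_forall_mem_sphere_norm_le (c := 0) (C := C) hρ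
    (DifferentiableOn.diffContOnCl (hd.mono (by
      rw [closure_ball _ hρ.ne']; exact Metric.closedBall_subset_ball hsub)))
    (fun w hw => hC _ (hmem w (by
      rw [mem_sphere_zero_iff_norm] at hw; rw [mem_ball_zero_iff, hw]; exact hsub)))
  rw [hline.deriv] at this
  refine this.trans (le_of_eq ?_)
  field_simp

/-- For holomorphic integrands a majorant of the functions suffices: Cauchy's estimate turns it into
the majorant `4 b / R` of the derivatives on the half ball. Measurability of the derivative is
inherited from the integrand through difference quotients. -/
lemma hasFDerivAt_integral_of_holomorphic {X : Type*} [MeasurableSpace X] {μ : Measure X}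
    {G : ℂ × ℂ → X → ℂ} {p : ℂ × ℂ} {R : ℝ} (hR : 0 < R) {b : X → ℝ}
    (hm : ∀ q ∈ Metric.ball p R, AEStronglyMeasurable (G q) μ)
    (hd : ∀ᵐ t ∂μ, DifferentiableOn ℂ (fun q => G q t) (Metric.ball p R))
    (hb : ∀ᵐ t ∂μ, ∀ q ∈ Metric.ball p R, ‖G q t‖ ≤ b t) (hbi : Integrable b μ) :
    Integrable (fun t => fderiv ℂ (fun q => G q t) p) μ ∧
    HasFDerivAt (fun q => ∫ t, G q t ∂μ) (∫ t, fderiv ℂ (fun q => G q t) p ∂μ) p := by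
  have hp := Metric.mem_ball_self (x := p) hR
  have hdir : ∀ v : ℂ × ℂ, ‖v‖ < R →
      AEStronglyMeasurable (fun t => fderiv ℂ (fun q => G q t) p v) μ := by
    intro v hv
    have hin : ∀ n : ℕ, p + ((n : ℂ) + 1)⁻¹ • v ∈ Metric.ball p R := by
      intro n
      rw [Metric.mem_ball, dist_eq_norm, add_sub_cancel_left, norm_smul, norm_inv]
      have : (1 : ℝ) ≤ ‖(n : ℂ) + 1‖ := by
        rw [show (n : ℂ) + 1 = ((n + 1 : ℕ) : ℂ) by push_cast; ring, Complex.norm_natCast]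
        exact_mod_cast Nat.succ_le_succ (Nat.zero_le n)
      calc ‖(n : ℂ) + 1‖⁻¹ * ‖v‖ ≤ 1 * ‖v‖ := by gcongr; exact inv_le_one_of_one_le₀ this
        _ < R := by simpa
    refine aestronglyMeasurable_of_tendsto_ae atTop
      (f := fun (n : ℕ) t => ((n : ℂ) + 1) • (G (p + ((n : ℂ) + 1)⁻¹ • v) t - G p t))
      (fun n => by
        simp_rw [smul_eq_mul]
        exact ((hm _ (hin n)).sub (hm _ hp)).const_mul _) ?_
    filter_upwards [hd] with t ht
    refine ((ht.differentiableAt (Metric.isOpen_ball.mem_nhds hp)).hasFDerivAt).lim v ?_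
    have : Tendsto (fun n : ℕ => ((n + 1 : ℕ) : ℝ)) atTop atTop :=
      tendsto_natCast_atTop_atTop.comp (tendsto_add_atTop_nat 1)
    refine this.congr fun n => ?_
    rw [show (n : ℂ) + 1 = ((n + 1 : ℕ) : ℂ) by push_cast; ring, Complex.norm_natCast]
  have hF' : AEStronglyMeasurable (fun t => fderiv ℂ (fun q => G q t) p) μ := by
    -- A linear map on `ℂ × ℂ` is recovered from its values on the two axes. The axis vectors are
    -- scaled to length `R / 2`, within reach of `hdir`, and the factor `2 / R` undoes this.
    have e : (fun t => fderiv ℂ (fun q => G q t) p) = fun t =>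
        (((2 / R : ℝ) : ℂ) * fderiv ℂ (fun q => G q t) p (((R / 2 : ℝ) : ℂ), 0)) •
          ContinuousLinearMap.fst ℂ ℂ ℂ +
        (((2 / R : ℝ) : ℂ) * fderiv ℂ (fun q => G q t) p (0, ((R / 2 : ℝ) : ℂ))) •
          ContinuousLinearMap.snd ℂ ℂ ℂ := by
      have hRR : ((2 / R : ℝ) : ℂ) * ((R / 2 : ℝ) : ℂ) = 1 := by
        rw [← Complex.ofReal_mul]; norm_cast; field_simp
      ext t
      · simp only [ContinuousLinearMap.coe_comp, Function.comp_apply,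
          ContinuousLinearMap.inl_apply, add_apply,
          smul_apply, ContinuousLinearMap.coe_fst',
          ContinuousLinearMap.coe_snd', smul_eq_mul, mul_one, mul_zero, add_zero]
        rw [← smul_eq_mul, ← map_smul]
        simp only [Prod.smul_mk, smul_eq_mul, mul_zero, hRR]
      · simp only [ContinuousLinearMap.coe_comp, Function.comp_apply,
          ContinuousLinearMap.inr_apply, add_apply,
          smul_apply, ContinuousLinearMap.coe_fst',
          ContinuousLinearMap.coe_snd', smul_eq_mul, mul_one, mul_zero, zero_add]
        rw [← smul_eq_mul, ← map_smul]
        simp only [Prod.smul_mk, smul_eq_mul, mul_zero, hRR]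
    have hn : ‖((R / 2 : ℝ) : ℂ)‖ < R := by
      rw [Complex.norm_real, Real.norm_of_nonneg (by positivity)]; linarith
    rw [e]
    refine AEStronglyMeasurable.add (AEStronglyMeasurable.smul_const
      ((hdir _ ?_).const_mul _) _) (AEStronglyMeasurable.smul_const ((hdir _ ?_).const_mul _) _)
    · simpa [Prod.norm_def, hR] using hn
    · simpa [Prod.norm_def, hR] using hn
  have hbd : ∀ᵐ t ∂μ, ∀ q ∈ Metric.ball p (R / 2),
      ‖fderiv ℂ (fun q => G q t) q‖ ≤ 4 * b t / R := by
    filter_upwards [hd, hb] with t h1 h2 q hq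
    exact norm_fderiv_le_of_differentiableOn_ball hR h1 h2 hq
  have hbi' : Integrable (fun t => 4 * b t / R) μ := (hbi.const_mul 4).div_const R
  have hhalf := Metric.ball_mem_nhds p (half_pos hR)
  refine ⟨hbi'.mono' hF' ?_, hasFDerivAt_integral_of_dominated_of_fderiv_le
    (F' := fun q t => fderiv ℂ (fun q => G q t) q) hhalf ?_ ?_ hF' hbd hbi' ?_⟩
  · filter_upwards [hbd] with t ht using ht p (Metric.mem_ball_self (half_pos hR))
  · filter_upwards [Metric.ball_mem_nhds p hR] with q hq using hm q hq
  · refine hbi.mono' (hm p hp) ?_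
    filter_upwards [hb] with t ht using ht p hp
  · filter_upwards [hd] with t ht q hq
    exact (ht.differentiableAt (Metric.isOpen_ball.mem_nhds
      (Metric.ball_subset_ball (by linarith) hq))).hasFDerivAt

lemma differentiableOn_integral_of_holomorphic {X : Type*} [MeasurableSpace X] {μ : Measure X}
    {G : ℂ × ℂ → X → ℂ} {W : Set (ℂ × ℂ)} (hW : IsOpen W)
    (hm : ∀ q ∈ W, AEStronglyMeasurable (G q) μ)
    (hd : ∀ᵐ t ∂μ, DifferentiableOn ℂ (fun q => G q t) W)
    (hb : ∀ p ∈ W, ∃ R > 0, ∃ b : X → ℝ, Integrable b μ ∧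
      ∀ᵐ t ∂μ, ∀ q ∈ Metric.ball p R, q ∈ W → ‖G q t‖ ≤ b t) :
    DifferentiableOn ℂ (fun q => ∫ t, G q t ∂μ) W := by
  intro p hp
  obtain ⟨R, hR, b, hbi, hbb⟩ := hb p hp
  obtain ⟨R', hR', hsub⟩ := Metric.isOpen_iff.1 hW p hp
  have h0 : 0 < min R R' := lt_min hR hR'
  have hsubW : Metric.ball p (min R R') ⊆ W :=
    (Metric.ball_subset_ball (min_le_right _ _)).trans hsub
  refine (hasFDerivAt_integral_of_holomorphic h0 (fun q hq => hm q (hsubW hq)) ?_ ?_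
    hbi).2.differentiableAt.differentiableWithinAt
  · filter_upwards [hd] with t ht using ht.mono hsubW
  · filter_upwards [hbb] with t ht q hq
    exact ht q (Metric.ball_subset_ball (min_le_left _ _) hq) (hsubW hq)

/-- The integral over `[0, 1]` of a jointly continuous function that is holomorphic in the
parameters is holomorphic. -/
lemma differentiableOn_intervalIntegral_of_holomorphic {G : ℂ × ℂ → ℝ → ℂ} {W : Set (ℂ × ℂ)}
    (hW : IsOpen W)
    (hc : ContinuousOn (fun x : (ℂ × ℂ) × ℝ => G x.1 x.2) (W ×ˢ Icc 0 1))
    (hd : ∀ t ∈ Icc (0 : ℝ) 1, DifferentiableOn ℂ (fun q => G q t) W) :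
    DifferentiableOn ℂ (fun q => ∫ t in (0 : ℝ)..1, G q t) W := by
  simp_rw [intervalIntegral.integral_of_le (zero_le_one' ℝ)]
  refine differentiableOn_integral_of_holomorphic hW ?_ ?_ ?_
  · intro q hq
    have : ContinuousOn (G q) (Icc 0 1) :=
      hc.comp (f := fun t : ℝ => (q, t)) (by fun_prop) fun t ht => ⟨hq, ht⟩
    exact (this.mono Ioc_subset_Icc_self).aestronglyMeasurable measurableSet_Ioc
  · exact (ae_restrict_iff' measurableSet_Ioc).2
      (Eventually.of_forall fun t ht => hd t (Ioc_subset_Icc_self ht))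
  · intro p hp
    obtain ⟨R, hR, hsub⟩ := Metric.nhds_basis_closedBall.mem_iff.1 (hW.mem_nhds hp)
    have hK : IsCompact (Metric.closedBall p R ×ˢ Icc (0 : ℝ) 1) :=
      (isCompact_closedBall p R).prod isCompact_Icc
    obtain ⟨C, hC⟩ := hK.exists_bound_of_continuousOn
      (hc.mono (prod_mono hsub le_rfl))
    refine ⟨R, hR, fun _ => C, by simp, ?_⟩
    refine (ae_restrict_iff' measurableSet_Ioc).2 (Eventually.of_forall fun t ht q hq _ => ?_)
    exact hC (q, t) ⟨Metric.ball_subset_closedBall hq, Ioc_subset_Icc_self ht⟩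

/-- A series of holomorphic functions that is locally dominated by a convergent series has a
holomorphic sum. -/
lemma differentiableOn_tsum_of_holomorphic {g : ℕ → ℂ × ℂ → ℂ} {W : Set (ℂ × ℂ)} (hW : IsOpen W)
    (hd : ∀ n, DifferentiableOn ℂ (g n) W)
    (hb : ∀ p ∈ W, ∃ R > 0, ∃ b : ℕ → ℝ, Summable b ∧
      ∀ n, ∀ q ∈ Metric.ball p R, q ∈ W → ‖g n q‖ ≤ b n) :
    DifferentiableOn ℂ (fun q => ∑' n, g n q) W := by
  -- The series is an integral against counting measure.
  have key : DifferentiableOn ℂ (fun q => ∫ n, g n q ∂Measure.count) W := by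
    refine differentiableOn_integral_of_holomorphic (G := fun q n => g n q) hW ?_ ?_ ?_
    · exact fun q _ => (Measurable.of_discrete).aestronglyMeasurable
    · exact Eventually.of_forall hd
    · intro p hp
      obtain ⟨R, hR, b, hb1, hb2⟩ := hb p hp
      exact ⟨R, hR, b, integrable_count_iff.2 hb1.norm, Eventually.of_forall hb2⟩
  refine key.congr fun q hq => ?_
  obtain ⟨R, hR, b, hb1, hb2⟩ := hb q hq
  have : Integrable (fun n => g n q) (Measure.count : Measure ℕ) := by
    refine integrable_count_iff.2 ?_
    exact Summable.of_nonneg_of_le (fun _ => norm_nonneg _)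
      (fun n => hb2 n q (Metric.mem_ball_self hR) hq) hb1
  rw [integral_countable this]
  simp

/-! ### Tubes and Borel discs -/

lemma posRealAxis_nonempty : posRealAxis.Nonempty := ⟨0, 0, by simp⟩

lemma tube_eq_thickening (r : ℝ) : tube r = Metric.thickening r posRealAxis := by
  ext z
  rw [Metric.mem_thickening_iff_infDist_lt posRealAxis_nonempty]
  rfl

lemma isOpen_tube (r : ℝ) : IsOpen (tube r) := by
  rw [tube_eq_thickening]; exact Metric.isOpen_thickening

lemma mem_tube_iff {r : ℝ} {z : ℂ} : z ∈ tube r ↔ ∃ x : ℝ, 0 ≤ x ∧ ‖z - x‖ < r := by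
  rw [tube_eq_thickening, Metric.mem_thickening_iff]
  simp [posRealAxis, dist_eq_norm]

lemma convex_tube (r : ℝ) : Convex ℝ (tube r) := by
  rw [tube_eq_thickening]
  refine Convex.thickening ?_ r
  have : posRealAxis = Complex.ofRealCLM.toLinearMap '' Ici 0 := rfl
  rw [this]
  exact (convex_Ici 0).linear_image _

lemma tube_mono {r r' : ℝ} (h : r ≤ r') : tube r ⊆ tube r' := fun _ hz => lt_of_lt_of_le hz h

lemma ofReal_mem_tube {r x : ℝ} (hr : 0 < r) (hx : 0 ≤ x) : (x : ℂ) ∈ tube r :=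
  mem_tube_iff.2 ⟨x, hx, by simpa⟩

lemma zero_mem_tube {r : ℝ} (hr : 0 < r) : (0 : ℂ) ∈ tube r := by
  simpa using ofReal_mem_tube hr le_rfl

lemma ball_zero_subset_tube (r : ℝ) : Metric.ball 0 r ⊆ tube r := fun z hz =>
  mem_tube_iff.2 ⟨0, le_rfl, by simpa using hz⟩

lemma add_mem_tube {r r' : ℝ} {z w : ℂ} (hz : z ∈ tube r) (hw : w ∈ tube r') :
    z + w ∈ tube (r + r') := by
  obtain ⟨x, hx, h1⟩ := mem_tube_iff.1 hz
  obtain ⟨y, hy, h2⟩ := mem_tube_iff.1 hw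
  refine mem_tube_iff.2 ⟨x + y, add_nonneg hx hy, ?_⟩
  calc ‖z + w - ((x + y : ℝ) : ℂ)‖ = ‖(z - x) + (w - y)‖ := by push_cast; congr 1; ring
    _ < r + r' := (norm_add_le _ _).trans_lt (add_lt_add h1 h2)

lemma ne_zero_of_mem_borelDisc {d : ℝ} (hd : 0 < d) {h : ℂ} (hh : h ∈ borelDisc d) : h ≠ 0 := by
  rintro rfl
  have : 1 / d < 0 := by simpa [borelDisc] using hh
  have : 0 < 1 / d := by positivity
  linarith

lemma mem_borelDisc_iff {d : ℝ} {h : ℂ} : h ∈ borelDisc d ↔ 1 / d < (h⁻¹).re := by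
  simp [borelDisc]

lemma inv_mem_borelDisc_iff {d : ℝ} {s : ℂ} : s⁻¹ ∈ borelDisc d ↔ 1 / d < s.re := by
  rw [mem_borelDisc_iff, inv_inv]

lemma borelDisc_mono {d d' : ℝ} (hd : 0 < d) (h : d ≤ d') : borelDisc d ⊆ borelDisc d' :=
  fun _ hh => lt_of_le_of_lt (one_div_le_one_div_of_le hd h) hh

lemma isOpen_re_gt (σ : ℝ) : IsOpen {s : ℂ | σ < s.re} :=
  isOpen_lt continuous_const Complex.continuous_re

lemma isOpen_borelDisc {d : ℝ} (hd : 0 < d) : IsOpen (borelDisc d) := by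
  rw [isOpen_iff_mem_nhds]
  intro h hh
  have : ContinuousAt (fun h : ℂ => h⁻¹) h := continuousAt_inv₀ (ne_zero_of_mem_borelDisc hd hh)
  filter_upwards [this.preimage_mem_nhds ((isOpen_re_gt (1 / d)).mem_nhds
    (mem_borelDisc_iff.1 hh))] with w hw
  exact mem_borelDisc_iff.2 hw

lemma ofReal_mem_borelDisc {d x : ℝ} (hx : 0 < x) (hxd : x < d) : (x : ℂ) ∈ borelDisc d := by
  rw [mem_borelDisc_iff, ← Complex.ofReal_inv, Complex.ofReal_re, ← one_div]
  exact one_div_lt_one_div_of_lt hx hxd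

/-- Holomorphic functions on a Borel disc that agree on a smaller one agree. -/
lemma eqOn_borelDisc_of_eqOn {d δ : ℝ} (hδ : 0 < δ) (hd : δ ≤ d) {f g : ℂ → ℂ}
    (hf : DifferentiableOn ℂ f (borelDisc d)) (hg : DifferentiableOn ℂ g (borelDisc d))
    (h : EqOn f g (borelDisc δ)) : EqOn f g (borelDisc d) := by
  have h0 : 0 < 1 / d := by have := hδ.trans_le hd; positivity
  have hne : ∀ s ∈ {s : ℂ | 1 / d < s.re}, s ≠ 0 := by
    rintro s hs rfl
    simp only [mem_ofPred_eq, Complex.zero_re] at hs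
    linarith
  -- In the coordinate `s = 1 / ħ` the Borel disc is a half-plane, which is convex, so the identity
  -- theorem applies.
  have hinv : DifferentiableOn ℂ (fun s : ℂ => s⁻¹) {s : ℂ | 1 / d < s.re} :=
    fun s hs => (differentiableAt_inv (hne s hs)).differentiableWithinAt
  have hmaps : MapsTo (fun s : ℂ => s⁻¹) {s : ℂ | 1 / d < s.re} (borelDisc d) :=
    fun s hs => inv_mem_borelDisc_iff.2 hs
  have hF := (hf.comp hinv hmaps).analyticOnNhd (isOpen_re_gt _)
  have hG := (hg.comp hinv hmaps).analyticOnNhd (isOpen_re_gt _)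
  have hconv : IsPreconnected {s : ℂ | 1 / d < s.re} :=
    (convex_halfSpace_re_gt (1 / d)).isPreconnected
  have hle : 1 / d ≤ 1 / δ := one_div_le_one_div_of_le hδ hd
  have hmem : ((1 / δ + 1 : ℝ) : ℂ) ∈ {s : ℂ | 1 / δ < s.re} := by
    simp only [mem_ofPred_eq, Complex.ofReal_re]; linarith
  have key := hF.eqOn_of_preconnected_of_eventuallyEq hG hconv
    (show ((1 / δ + 1 : ℝ) : ℂ) ∈ _ from lt_of_le_of_lt hle hmem)
    (by
      filter_upwards [(isOpen_re_gt (1 / δ)).mem_nhds hmem] with s hs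
      exact h (inv_mem_borelDisc_iff.2 hs))
  intro w hw
  have := key (show w⁻¹ ∈ {s : ℂ | 1 / d < s.re} from mem_borelDisc_iff.1 hw)
  simpa using this

lemma HolomorphicOnProd.right {f : ℂ → ℂ → ℂ} {U V : Set ℂ} (hf : HolomorphicOnProd f U V) {z : ℂ}
    (hz : z ∈ U) : DifferentiableOn ℂ (f z) V :=
  DifferentiableOn.comp (g := fun p : ℂ × ℂ => f p.1 p.2) (f := fun w => (z, w)) hf
    (by fun_prop) (fun _ hw => ⟨hz, hw⟩)

lemma HolomorphicOnProd.left {f : ℂ → ℂ → ℂ} {U V : Set ℂ} (hf : HolomorphicOnProd f U V) {w : ℂ}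
    (hw : w ∈ V) : DifferentiableOn ℂ (fun z => f z w) U :=
  DifferentiableOn.comp (g := fun p : ℂ × ℂ => f p.1 p.2) (f := fun z => (z, w)) hf
    (by fun_prop) (fun _ hz => ⟨hz, hw⟩)

lemma HolomorphicOnProd.mono {f : ℂ → ℂ → ℂ} {U V U' V' : Set ℂ} (hf : HolomorphicOnProd f U V)
    (hU : U' ⊆ U) (hV : V' ⊆ V) : HolomorphicOnProd f U' V' :=
  DifferentiableOn.mono hf (prod_mono hU hV)

lemma IsBorelContinuation.mono {U U' : Set ℂ} {ε ε' : ℝ} {c : ℕ → ℂ → ℂ} {φ : ℂ → ℂ → ℂ}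
    (h : IsBorelContinuation U ε c φ) (hU : U' ⊆ U) (hε : ε' ≤ ε) :
    IsBorelContinuation U' ε' c φ := by
  obtain ⟨h1, ⟨K, L, hK, hL, hb⟩, ρ, hρ, hs⟩ := h
  exact ⟨h1.mono hU (tube_mono hε),
    ⟨K, L, hK, hL, fun z hz ξ hξ => hb z (hU hz) ξ (tube_mono hε hξ)⟩,
    ρ, hρ, fun z hz ξ hξ => hs z (hU hz) ξ (tube_mono hε hξ)⟩

lemma IsBorelContinuation.congr {U : Set ℂ} {ε : ℝ} {c : ℕ → ℂ → ℂ} {φ ψ : ℂ → ℂ → ℂ}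
    (h : IsBorelContinuation U ε c φ) (he : ∀ z ∈ U, ∀ ξ ∈ tube ε, ψ z ξ = φ z ξ) :
    IsBorelContinuation U ε c ψ := by
  obtain ⟨h1, ⟨K, L, hK, hL, hb⟩, ρ, hρ, hs⟩ := h
  refine ⟨DifferentiableOn.congr h1 fun p hp => he _ hp.1 _ hp.2,
    ⟨K, L, hK, hL, fun z hz ξ hξ => by rw [he z hz ξ hξ]; exact hb z hz ξ hξ⟩,
    ρ, hρ, fun z hz ξ hξ hn => by rw [he z hz ξ hξ]; exact hs z hz ξ hξ hn⟩

/-- Borel continuations are unique. -/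
lemma IsBorelContinuation.eq_of_mem {U : Set ℂ} {ε ε' : ℝ} (hε : 0 < ε) (hε' : 0 < ε')
    {c c' : ℕ → ℂ → ℂ} {φ ψ : ℂ → ℂ → ℂ} (h : IsBorelContinuation U ε c φ)
    (h' : IsBorelContinuation U ε' c' ψ) {z ξ : ℂ} (hz : z ∈ U)
    (hc : ∀ k, c' (k + 1) z = c (k + 1) z) (hξ : ξ ∈ tube ε)
    (hξ' : ξ ∈ tube ε') : φ z ξ = ψ z ξ := by
  wlog hle : ε ≤ ε' generalizing ε ε' c c' φ ψ
  · exact (this hε' hε h' h (fun k => (hc k).symm) hξ' hξ (le_of_not_ge hle)).symm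
  have hψ := h'.mono le_rfl hle
  obtain ⟨h1, -, ρ, hρ, hs⟩ := h
  obtain ⟨h2, -, ρ', hρ', hs'⟩ := hψ
  refine ((h1.right hz).analyticOnNhd (isOpen_tube ε)).eqOn_of_preconnected_of_eventuallyEq
    ((h2.right hz).analyticOnNhd (isOpen_tube ε)) (convex_tube ε).isPreconnected
    (zero_mem_tube hε) ?_ hξ
  filter_upwards [(isOpen_tube ε).mem_nhds (zero_mem_tube hε),
    Metric.ball_mem_nhds (0 : ℂ) (lt_min hρ hρ')] with w hw hb
  rw [mem_ball_zero_iff, lt_min_iff] at hb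
  refine (hs z hz w hw hb.1).unique ?_
  convert hs' z hz w hw hb.2 using 3 with k
  rw [formalBorel, formalBorel, hc]

open scoped FourierTransform

/-! ### Integrals over vertical lines -/

/-- The vertical line `Re s = c`, parametrised so that the inverse Laplace integral
`(2πi)⁻¹ ∫ g (s) ds` becomes `∫ g (verticalLine c v) dv`. -/
noncomputable def verticalLine (c v : ℝ) : ℂ := (c : ℂ) + ((2 * Real.pi * v : ℝ) : ℂ) * Complex.I

@[simp] lemma verticalLine_re (c v : ℝ) : (verticalLine c v).re = c := by simp [verticalLine]

@[fun_prop] lemma continuous_verticalLine (c : ℝ) : Continuous (verticalLine c) := by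
  unfold verticalLine; fun_prop

/-- Turns quadratic decay in `s` into the integrable majorant `(1 + v ^ 2)⁻¹`, whose integral is
`π`, independently of the line. -/
lemma one_add_sq_le_norm_verticalLine_sq {c : ℝ} (hc : 1 ≤ c) (v : ℝ) :
    1 + v ^ 2 ≤ ‖verticalLine c v‖ ^ 2 := by
  rw [verticalLine, Complex.sq_norm, Complex.normSq_add_mul_I]
  have h1 : 1 ≤ c ^ 2 := one_le_pow₀ hc
  have h2 : 1 ≤ (2 * Real.pi) ^ 2 := one_le_pow₀ (by nlinarith [Real.pi_gt_three])
  rw [mul_pow]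
  nlinarith [mul_le_mul_of_nonneg_right h2 (sq_nonneg v)]

lemma norm_le_inv_one_add_sq {c : ℝ} (hc : 1 ≤ c) {C v : ℝ} (hC : 0 ≤ C) {w : ℂ}
    (hw : ‖w‖ ≤ C / ‖verticalLine c v‖ ^ 2) : ‖w‖ ≤ C * (1 + v ^ 2)⁻¹ := by
  refine hw.trans ?_
  rw [div_eq_mul_inv]
  gcongr
  exact one_add_sq_le_norm_verticalLine_sq hc v

lemma integrable_verticalLine {c : ℝ} (hc : 1 ≤ c) {q : ℂ → ℂ} {C : ℝ} (hC : 0 ≤ C)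
    (hq : Continuous fun v => q (verticalLine c v))
    (hb : ∀ v, ‖q (verticalLine c v)‖ ≤ C / ‖verticalLine c v‖ ^ 2) :
    Integrable fun v => q (verticalLine c v) :=
  (integrable_inv_one_add_sq.const_mul C).mono' hq.aestronglyMeasurable
    (Eventually.of_forall fun v => norm_le_inv_one_add_sq hc hC (hb v))

lemma norm_integral_verticalLine_le {c : ℝ} (hc : 1 ≤ c) {q : ℂ → ℂ} {C : ℝ} (hC : 0 ≤ C)
    (hb : ∀ v, ‖q (verticalLine c v)‖ ≤ C / ‖verticalLine c v‖ ^ 2) :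
    ‖∫ v, q (verticalLine c v)‖ ≤ C * Real.pi := by
  refine (norm_integral_le_of_norm_le (integrable_inv_one_add_sq.const_mul C)
    (Eventually.of_forall fun v => norm_le_inv_one_add_sq hc hC (hb v))).trans (le_of_eq ?_)
  rw [integral_const_mul, integral_univ_inv_one_add_sq]

lemma continuous_comp_verticalLine {q : ℂ → ℂ} {σ c : ℝ} (hσ : σ < c)
    (hq : ContinuousOn q {s : ℂ | σ < s.re}) : Continuous fun v => q (verticalLine c v) :=
  hq.comp_continuous (continuous_verticalLine c) fun v => by
    simpa using hσ

/-- The integral over a vertical line of a holomorphic function that decays quadratically does not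
depend on the line. -/
lemma integral_verticalLine_eq {q : ℂ → ℂ} {σ c c' C : ℝ} (hσ : σ < c) (hc : 1 ≤ c) (hcc : c ≤ c')
    (hC : 0 ≤ C) (hq : DifferentiableOn ℂ q {s : ℂ | σ < s.re})
    (hb : ∀ s : ℂ, c ≤ s.re → s.re ≤ c' → ‖q s‖ ≤ C / ‖s‖ ^ 2) :
    ∫ v, q (verticalLine c v) = ∫ v, q (verticalLine c' v) := by
  -- Cauchy's theorem on the rectangle between the two lines, of height `2 T`. The vertical sides
  -- tend to `2π` times the line integrals, as the ordinate is `y = 2πv`; the horizontal ones are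
  -- `O(T ^ (-2))`.
  have hscale : ∀ b : ℝ, c ≤ b → b ≤ c' →
      Tendsto (fun T : ℝ => ∫ y in (-T)..T, q ((b : ℂ) + (y : ℂ) * Complex.I)) atTop
        (𝓝 (((2 * Real.pi : ℝ) : ℂ) * ∫ v, q (verticalLine b v))) := by
    intro b hb1 hb2
    have hint := integrable_verticalLine (hc.trans hb1) hC
      (continuous_comp_verticalLine (hσ.trans_le hb1) hq.continuousOn)
      (fun v => hb _ (by simpa) (by simpa))
    have h2pi : (2 * Real.pi : ℝ) ≠ 0 := by positivity
    have hint' : Integrable fun y : ℝ => q ((b : ℂ) + (y : ℂ) * Complex.I) := by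
      have := (integrable_comp_mul_left_iff (fun y : ℝ => q ((b : ℂ) + (y : ℂ) * Complex.I))
        h2pi).1
      exact this hint
    have he : ((2 * Real.pi : ℝ) : ℂ) * ∫ v, q (verticalLine b v) =
        ∫ y : ℝ, q ((b : ℂ) + (y : ℂ) * Complex.I) := by
      have := Measure.integral_comp_mul_left (fun y : ℝ => q ((b : ℂ) + (y : ℂ) * Complex.I))
        (2 * Real.pi)
      simp only [verticalLine]
      rw [this, abs_of_pos (by positivity), Complex.real_smul, ← mul_assoc, ← Complex.ofReal_mul,
        mul_inv_cancel₀ h2pi, Complex.ofReal_one, one_mul]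
    rw [he]
    exact intervalIntegral_tendsto_integral hint' tendsto_neg_atTop_atBot tendsto_id
  have hhor : ∀ τ : ℝ, τ = 1 ∨ τ = -1 →
      Tendsto (fun T : ℝ => ∫ x in c..c', q ((x : ℂ) + ((τ * T : ℝ) : ℂ) * Complex.I)) atTop
        (𝓝 0) := by
    intro τ hτ
    have hlim : Tendsto (fun T : ℝ => C / T ^ 2 * |c' - c|) atTop (𝓝 0) := by
      have : Tendsto (fun T : ℝ => C / T ^ 2) atTop (𝓝 0) :=
        tendsto_const_nhds.div_atTop (tendsto_pow_atTop two_ne_zero)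
      simpa using this.mul_const |c' - c|
    refine squeeze_zero_norm' ?_ hlim
    filter_upwards [eventually_gt_atTop 0] with T hT
    refine intervalIntegral.norm_integral_le_of_norm_le_const fun x hx => ?_
    rw [uIoc_of_le hcc] at hx
    refine (hb _ (by simpa using hx.1.le) (by simpa using hx.2)).trans ?_
    have : T ^ 2 ≤ ‖(x : ℂ) + ((τ * T : ℝ) : ℂ) * Complex.I‖ ^ 2 := by
      rw [Complex.sq_norm, Complex.normSq_add_mul_I]
      rcases hτ with rfl | rfl <;> nlinarith [sq_nonneg x]
    gcongr
  have hrect : ∀ T : ℝ, ((∫ x in c..c', q ((x : ℂ) + ((-1 * T : ℝ) : ℂ) * Complex.I)) -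
      (∫ x in c..c', q ((x : ℂ) + ((1 * T : ℝ) : ℂ) * Complex.I))) +
      Complex.I * (∫ y in (-T)..T, q ((c' : ℂ) + (y : ℂ) * Complex.I)) -
      Complex.I * (∫ y in (-T)..T, q ((c : ℂ) + (y : ℂ) * Complex.I)) = 0 := by
    intro T
    have := Complex.integral_boundary_rect_eq_zero_of_differentiableOn q
      ((c : ℂ) + ((-1 * T : ℝ) : ℂ) * Complex.I) ((c' : ℂ) + ((1 * T : ℝ) : ℂ) * Complex.I)
      (hq.mono fun s hs => by
        have h1 := hs.1
        simp only [mem_preimage] at h1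
        simp only [Complex.add_re, Complex.ofReal_re, Complex.re_ofReal_mul, Complex.I_re,
          mul_zero, add_zero, uIcc_of_le hcc] at h1
        exact lt_of_lt_of_le hσ h1.1)
    simpa using this
  have hlim := (((hhor (-1) (Or.inr rfl)).sub (hhor 1 (Or.inl rfl))).add
    ((hscale c' hcc le_rfl).const_mul Complex.I)).sub ((hscale c le_rfl hcc).const_mul Complex.I)
  have := tendsto_nhds_unique (hlim.congr hrect) tendsto_const_nhds
  have h2pi : ((2 * Real.pi : ℝ) : ℂ) ≠ 0 := by
    rw [Ne, Complex.ofReal_eq_zero]; positivity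
  have h3 : Complex.I * ((2 * Real.pi : ℝ) : ℂ) * ((∫ v, q (verticalLine c' v)) -
      ∫ v, q (verticalLine c v)) = 0 := by
    linear_combination this
  rcases mul_eq_zero.1 h3 with h | h
  · exact absurd h (mul_ne_zero Complex.I_ne_zero h2pi)
  · exact (sub_eq_zero.1 h).symm

/-- The integral over a vertical line of a function that is holomorphic and decays cubically to the
right of the line vanishes. -/
lemma integral_verticalLine_eq_zero {q : ℂ → ℂ} {σ c C : ℝ} (hσ : σ < c) (hc : 1 ≤ c) (hC : 0 ≤ C)
    (hq : DifferentiableOn ℂ q {s : ℂ | σ < s.re})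
    (hb : ∀ s : ℂ, c ≤ s.re → ‖q s‖ ≤ C / ‖s‖ ^ 3) : ∫ v, q (verticalLine c v) = 0 := by
  -- One of the three powers is traded for a factor `1 / c'`. Moving the line to `Re s = c'` then
  -- bounds the integral by `C π / c'`, which tends to zero.
  have hb' : ∀ c' : ℝ, c ≤ c' → ∀ s : ℂ, c' ≤ s.re → ‖q s‖ ≤ (C / c') / ‖s‖ ^ 2 := by
    intro c' hc' s hs
    have h0 : 0 < c' := by linarith
    refine (hb s (hc'.trans hs)).trans ?_
    rw [div_div]
    have : c' ≤ ‖s‖ := hs.trans (Complex.re_le_norm s)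
    rw [pow_succ' ‖s‖ 2]
    have h1 : 0 < ‖s‖ := h0.trans_le this
    gcongr
  have hle : ∀ c' : ℝ, c ≤ c' → ‖∫ v, q (verticalLine c v)‖ ≤ C / c' * Real.pi := by
    intro c' hc'
    have h0 : 0 < c' := by linarith
    rw [integral_verticalLine_eq (C := C / c) hσ hc hc' (by positivity) hq
      (fun s hs _ => hb' c le_rfl s hs)]
    exact norm_integral_verticalLine_le (hc.trans hc') (by positivity)
      (fun v => hb' c' hc' _ (by simp))
  have hlim : Tendsto (fun c' : ℝ => C / c' * Real.pi) atTop (𝓝 0) := by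
    simpa using (tendsto_const_nhds.div_atTop tendsto_id).mul_const Real.pi
  have := ge_of_tendsto hlim (by
    filter_upwards [eventually_ge_atTop c] with c' hc' using hle c' hc')
  exact norm_le_zero_iff.1 this

/-! ### Laplace inversion -/

lemma exp_verticalLine_mul (c v x : ℝ) : Complex.exp (verticalLine c v * x) =
    Complex.exp ((c : ℂ) * x) * Complex.exp (((2 * Real.pi * (v * x) : ℝ) : ℂ) * Complex.I) := by
  rw [← Complex.exp_add, verticalLine]; congr 1; push_cast; ring

lemma norm_exp_verticalLine_mul (c v x : ℝ) :
    ‖Complex.exp (verticalLine c v * x)‖ = Real.exp (c * x) := by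
  simp [Complex.norm_exp]

/-- Inversion of the Laplace transform of a continuous function. -/
lemma integral_verticalLine_eq_of_laplace_eq {ψ : ℝ → ℂ} {c : ℝ} (hψ : Continuous ψ)
    (h0 : ∀ x ≤ 0, ψ x = 0)
    (hi : Integrable fun x : ℝ => ψ x * Complex.exp (-((c : ℂ) * x))) {g : ℂ → ℂ}
    (hg : ∀ v, ∫ x in Ioi (0 : ℝ), ψ x * Complex.exp (-(verticalLine c v * x)) =
      g (verticalLine c v))
    (hgi : Integrable fun v => g (verticalLine c v)) (x : ℝ) :
    ∫ v, g (verticalLine c v) * Complex.exp (verticalLine c v * x) = ψ x := by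
  set f : ℝ → ℂ := fun x => ψ x * Complex.exp (-((c : ℂ) * x)) with hf
  have hfc : Continuous f := by rw [hf]; fun_prop
  -- The factor `2π` in `verticalLine` matches the normalisation of `𝓕`: the Fourier transform of
  -- `ψ(x) e ^ (-c x)` at `v` is the Laplace transform of `ψ` at `verticalLine c v`.
  have hF : 𝓕 f = fun v => g (verticalLine c v) := by
    ext v
    rw [Real.fourier_real_eq_integral_exp_smul, ← hg v,
      ← setIntegral_eq_integral_of_forall_compl_eq_zero (s := Ioi 0) (fun y hy => by
        simp [hf, h0 y (not_lt.1 hy)])]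
    refine setIntegral_congr_fun measurableSet_Ioi fun y _ => ?_
    simp only [hf, smul_eq_mul]
    rw [mul_left_comm, ← Complex.exp_add, verticalLine]
    congr 2
    push_cast; ring
  have hinv := congrFun (hfc.fourierInv_fourier_eq hi (by rw [hF]; exact hgi)) x
  rw [Real.fourierInv_eq', hF] at hinv
  have : ∀ v, g (verticalLine c v) * Complex.exp (verticalLine c v * x) =
      Complex.exp ((c : ℂ) * x) *
        (Complex.exp (((2 * Real.pi * inner ℝ v x : ℝ) : ℂ) * Complex.I) •
          g (verticalLine c v)) := by
    intro v
    rw [exp_verticalLine_mul, smul_eq_mul]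
    simp only [RCLike.inner_apply, conj_trivial]
    rw [mul_comm x v]
    ring
  simp_rw [this]
  rw [integral_const_mul, hinv, hf]
  simp only
  rw [mul_left_comm, ← Complex.exp_add]
  simp

/-- A function with cubic decay to the right of a vertical line is the Laplace transform of its
inverse Laplace transform. -/
lemma laplace_integral_verticalLine {g : ℂ → ℂ} {σ c C : ℝ} (hσ : σ < c) (hc : 1 ≤ c)
    (hC : 0 ≤ C) (hq : DifferentiableOn ℂ g {s : ℂ | σ < s.re})
    (hb : ∀ s : ℂ, c ≤ s.re → ‖g s‖ ≤ C / ‖s‖ ^ 3) {ψ : ℝ → ℂ}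
    (hψ : ∀ x : ℝ, ψ x = ∫ v, g (verticalLine c v) * Complex.exp (verticalLine c v * x)) :
    Continuous ψ ∧ (∀ x, ‖ψ x‖ ≤ C * Real.pi * Real.exp (c * x)) ∧ (∀ x ≤ 0, ψ x = 0) ∧
      ∀ s : ℂ, c < s.re → ∫ x in Ioi (0 : ℝ), ψ x * Complex.exp (-(s * x)) = g s := by
  have hb2 : ∀ s : ℂ, c ≤ s.re → ‖g s‖ ≤ C / ‖s‖ ^ 2 := by
    intro s hs
    refine (hb s hs).trans ?_
    have h1 : 1 ≤ ‖s‖ := hc.trans (hs.trans (Complex.re_le_norm s))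
    have : ‖s‖ ^ 2 ≤ ‖s‖ ^ 3 := pow_le_pow_right₀ h1 (by norm_num)
    gcongr
  have hgc : ∀ c', c ≤ c' → Continuous fun v => g (verticalLine c' v) := fun c' h =>
    continuous_comp_verticalLine (hσ.trans_le h) hq.continuousOn
  have hgi : ∀ c', c ≤ c' → Integrable fun v => g (verticalLine c' v) := fun c' h =>
    integrable_verticalLine (hc.trans h) hC (hgc c' h) fun v => hb2 _ (by simpa)
  have hexpd : ∀ x : ℝ, DifferentiableOn ℂ (fun s => g s * Complex.exp (s * x))
      {s : ℂ | σ < s.re} := fun x => hq.mul (by fun_prop)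
  have hcont : Continuous ψ := by
    have : ψ = fun x : ℝ => Complex.exp ((c : ℂ) * x) * ∫ v, g (verticalLine c v) *
        Complex.exp (((2 * Real.pi * (v * x) : ℝ) : ℂ) * Complex.I) := by
      ext x
      rw [hψ, ← integral_const_mul]
      simp_rw [exp_verticalLine_mul]
      congr 1; ext v; ring
    rw [this]
    refine Continuous.mul (by fun_prop) ?_
    refine continuous_of_dominated (bound := fun v => ‖g (verticalLine c v)‖) ?_ ?_
      (hgi c le_rfl).norm ?_
    · intro x
      have := hgc c le_rfl
      exact Continuous.aestronglyMeasurable (this.mul (by fun_prop))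
    · intro x
      refine Eventually.of_forall fun v => ?_
      rw [norm_mul, Complex.norm_exp_ofReal_mul_I, mul_one]
    · exact Eventually.of_forall fun v => by fun_prop
  have hbound : ∀ x, ‖ψ x‖ ≤ C * Real.pi * Real.exp (c * x) := by
    intro x
    rw [hψ]
    refine (norm_integral_verticalLine_le (q := fun s => g s * Complex.exp (s * x))
      (C := C * Real.exp (c * x)) hc (by positivity) fun v => ?_).trans (le_of_eq (by ring))
    rw [norm_mul, norm_exp_verticalLine_mul, mul_div_right_comm]
    gcongr
    exact hb2 _ (by simp)
  -- For `x ≤ 0` the exponential is at most `1` to the right of the line, so the integrand keeps its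
  -- cubic decay.
  have hzero : ∀ x ≤ 0, ψ x = 0 := by
    intro x hx
    rw [hψ]
    refine integral_verticalLine_eq_zero (q := fun s => g s * Complex.exp (s * x)) hσ hc hC
      (hexpd x) fun s hs => ?_
    rw [norm_mul, Complex.norm_exp]
    have : Real.exp (s * x).re ≤ 1 := by
      rw [Real.exp_le_one_iff, Complex.re_mul_ofReal]
      exact mul_nonpos_of_nonneg_of_nonpos (by linarith) hx
    calc ‖g s‖ * Real.exp (s * x).re ≤ ‖g s‖ * 1 := by gcongr
      _ ≤ C / ‖s‖ ^ 3 := by rw [mul_one]; exact hb s hs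
  refine ⟨hcont, hbound, hzero, fun s hs => ?_⟩
  -- The line is moved so that it passes through `s`. On it `ψ(x) e ^ (-c' x)` is an inverse Fourier
  -- transform, integrable because `c' > c`, and Fourier inversion recovers `g`.
  set c' := s.re with hc'
  have hshift : ∀ x : ℝ, ψ x = ∫ v, g (verticalLine c' v) *
      Complex.exp (verticalLine c' v * x) := by
    intro x
    rw [hψ]
    refine integral_verticalLine_eq (q := fun s => g s * Complex.exp (s * x))
      (C := C * Real.exp (c' * |x|)) hσ hc hs.le (by positivity) (hexpd x) fun w hw1 hw2 => ?_
    rw [norm_mul, Complex.norm_exp, mul_div_right_comm, Complex.re_mul_ofReal]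
    have hw0 : 0 ≤ c' := by linarith
    have hle : w.re * x ≤ c' * |x| :=
      (mul_le_mul_of_nonneg_left (le_abs_self x) (by linarith)).trans (by gcongr)
    gcongr
    exact hb2 w hw1
  set h : ℝ → ℂ := fun v => g (verticalLine c' v) with hh
  have hFinv : 𝓕⁻ h = fun x : ℝ => ψ x * Complex.exp (-((c' : ℂ) * x)) := by
    ext x
    rw [Real.fourierInv_eq', hshift, ← integral_mul_const]
    congr 1
    ext v
    rw [exp_verticalLine_mul, smul_eq_mul]
    simp only [RCLike.inner_apply, conj_trivial, hh]
    have : Complex.exp ((c' : ℂ) * x) * Complex.exp (-((c' : ℂ) * x)) = 1 := by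
      rw [← Complex.exp_add, add_neg_cancel, Complex.exp_zero]
    rw [mul_comm v x]
    linear_combination (-g (verticalLine c' v) *
      Complex.exp (((2 * Real.pi * (x * v) : ℝ) : ℂ) * Complex.I)) * this
  have hint : Integrable (𝓕⁻ h) := by
    rw [hFinv, ← integrableOn_iff_integrable_of_support_subset (s := Ioi 0)]
    · refine Integrable.mono' ((exp_neg_integrableOn_Ioi 0 (sub_pos.2 hs)).const_mul
        (C * Real.pi)) (Continuous.aestronglyMeasurable (by fun_prop)) ?_
      refine Eventually.of_forall fun x => ?_
      rw [norm_mul, Complex.norm_exp]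
      calc ‖ψ x‖ * Real.exp (-((c' : ℂ) * x)).re ≤ C * Real.pi * Real.exp (c * x) *
            Real.exp (-((c' : ℂ) * x)).re := by gcongr; exact hbound x
        _ = C * Real.pi * Real.exp (-(c' - c) * x) := by
          rw [mul_assoc, ← Real.exp_add]
          congr 2
          simp; ring
    · intro x hx
      by_contra hx'
      exact hx (by simp [hzero x (not_lt.1 hx')])
  have hint' : Integrable (𝓕 h) := by
    have : 𝓕 h = fun x => 𝓕⁻ h (-x) := by
      ext x; rw [Real.fourierInv_eq_fourier_neg, neg_neg]
    rw [this]
    exact hint.comp_neg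
  have hsv : s = verticalLine c' (s.im / (2 * Real.pi)) := by
    rw [verticalLine, mul_div_cancel₀ _ (by positivity : (2 * Real.pi : ℝ) ≠ 0), hc',
      Complex.re_add_im]
  have hfin := congrFun ((hgc c' hs.le).fourier_fourierInv_eq (hgi c' hs.le) hint')
    (s.im / (2 * Real.pi))
  rw [← hsv] at hfin
  rw [← hfin]
  change _ = 𝓕 (𝓕⁻ h) _
  rw [hFinv, Real.fourier_real_eq_integral_exp_smul]
  conv_rhs => rw [
    ← setIntegral_eq_integral_of_forall_compl_eq_zero (s := Ioi 0) (fun y hy => by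
        simp [hzero y (not_lt.1 hy)])]
  refine setIntegral_congr_fun measurableSet_Ioi fun y _ => ?_
  simp only [smul_eq_mul]
  rw [mul_left_comm, ← Complex.exp_add]
  congr 2
  conv_lhs => rw [hsv, verticalLine]
  push_cast; ring

lemma integrableOn_mul_exp_neg_mul {c : ℝ} (hc : 0 < c) :
    IntegrableOn (fun x : ℝ => x * Real.exp (-c * x)) (Ioi 0) := by
  have := integrableOn_rpow_mul_exp_neg_mul_rpow (s := 1) (p := 1) (by norm_num) one_pos hc
  simpa using this

lemma laplace_id {s : ℂ} (hs : 0 < s.re) :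
    ∫ x in Ioi (0 : ℝ), (x : ℂ) * Complex.exp (-(s * x)) = (s ^ 2)⁻¹ := by
  have hs0 : s ≠ 0 := by rintro rfl; simp at hs
  have hd : ∀ x : ℝ, HasDerivAt (fun x : ℝ => -((x : ℂ) / s + (s ^ 2)⁻¹) * Complex.exp (-(s * x)))
      ((x : ℂ) * Complex.exp (-(s * x))) x := by
    intro x
    have h1 : HasDerivAt (fun x : ℝ => (x : ℂ)) 1 x := Complex.ofRealCLM.hasDerivAt
    have h2 := ((h1.div_const s).add_const (s ^ 2)⁻¹).neg.mul ((h1.const_mul s).neg.cexp)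
    refine h2.congr_deriv ?_
    simp only [Pi.neg_apply]
    field_simp
    ring
  have hn : ∀ x : ℝ, ‖Complex.exp (-(s * x))‖ = Real.exp (-s.re * x) := fun x => by
    simp [Complex.norm_exp]
  have hi : IntegrableOn (fun x : ℝ => (x : ℂ) * Complex.exp (-(s * x))) (Ioi 0) := by
    refine Integrable.mono' (integrableOn_mul_exp_neg_mul hs)
      (Continuous.aestronglyMeasurable (by fun_prop)) ?_
    refine (ae_restrict_iff' measurableSet_Ioi).2 (Eventually.of_forall fun x hx => ?_)
    rw [norm_mul, hn, Complex.norm_real, Real.norm_of_nonneg (le_of_lt hx)]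
  have hlim : Tendsto (fun x : ℝ => -((x : ℂ) / s + (s ^ 2)⁻¹) * Complex.exp (-(s * x))) atTop
      (𝓝 0) := by
    have hr : Tendsto (fun x : ℝ => (x ^ 1 * Real.exp (-s.re * x)) * ‖s‖⁻¹ +
        ‖(s ^ 2)⁻¹‖ * (x ^ 0 * Real.exp (-s.re * x))) atTop (𝓝 0) := by
      have e : ∀ n : ℕ, Tendsto (fun x : ℝ => x ^ n * Real.exp (-s.re * x)) atTop (𝓝 0) := by
        intro n
        have := tendsto_rpow_mul_exp_neg_mul_atTop_nhds_zero n s.re hs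
        simpa using this
      generalize ‖(s ^ 2)⁻¹‖ = w
      simpa using ((e 1).mul_const ‖s‖⁻¹).add ((e 0).const_mul w)
    refine squeeze_zero_norm' ?_ hr
    filter_upwards [eventually_ge_atTop 0] with x hx
    rw [norm_mul, hn, norm_neg]
    calc _ ≤ (‖(x : ℂ) / s‖ + ‖(s ^ 2)⁻¹‖) * Real.exp (-s.re * x) := by
          gcongr; exact norm_add_le _ _
      _ = _ := by
          rw [norm_div, Complex.norm_real, Real.norm_of_nonneg hx]; ring
  rw [integral_Ioi_of_hasDerivAt_of_tendsto' (fun x _ => hd x) hi hlim]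
  simp

/-- The inverse Laplace transform of `s⁻²`. -/
lemma integral_verticalLine_inv_sq {c : ℝ} (hc : 1 ≤ c) {x : ℝ} (hx : 0 ≤ x) :
    ∫ v, (verticalLine c v ^ 2)⁻¹ * Complex.exp (verticalLine c v * x) = x := by
  have hc0 : 0 < c := by linarith
  have hne : ∀ v, verticalLine c v ≠ 0 := fun v h => by
    have := congrArg Complex.re h
    simp at this; linarith
  -- The ramp `max x 0` extends `x` by zero continuously, as the inversion lemma requires.
  have := integral_verticalLine_eq_of_laplace_eq (ψ := fun x => ((max x 0 : ℝ) : ℂ)) (c := c)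
    (g := fun s => (s ^ 2)⁻¹) (by fun_prop) (fun x hx => by simp [hx]) ?_ ?_ ?_ x
  · simpa [hx] using this
  · rw [← integrableOn_iff_integrable_of_support_subset (s := Ioi 0)]
    · refine Integrable.mono' (integrableOn_mul_exp_neg_mul hc0)
        (Continuous.aestronglyMeasurable (by fun_prop)) ?_
      refine (ae_restrict_iff' measurableSet_Ioi).2 (Eventually.of_forall fun y hy => ?_)
      rw [norm_mul, Complex.norm_real, max_eq_left (le_of_lt hy), Real.norm_of_nonneg (le_of_lt hy),
        Complex.norm_exp]
      simp
    · intro y hy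
      by_contra hy'
      exact hy (by simp [not_lt.1 (show ¬ (0 < y) from hy')])
  · intro v
    rw [← laplace_id (s := verticalLine c v) (by simpa)]
    refine setIntegral_congr_fun measurableSet_Ioi fun y hy => ?_
    simp only [max_eq_left (le_of_lt (show 0 < y from hy))]
  · refine integrable_verticalLine (C := 1) (q := fun s => (s ^ 2)⁻¹) hc zero_le_one ?_ ?_
    · have := fun v => pow_ne_zero 2 (hne v)
      fun_prop (disch := assumption)
    · intro v; simp

/-! ### Analytic continuation to a tube by Taylor expansion along the real axis -/

section TaylorTube

variable {U : Set ℂ} {B : ℕ → ℂ → ℝ → ℂ} {C M c : ℝ}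

/-- The Gevrey bound guarantees radius of convergence at least `1 / M`. Half of it is used, so the
terms are dominated by a geometric series of ratio `1 / 2`, uniformly in the centre up to `e ^ (c
x)`. -/
lemma norm_taylor_term_le {ε : ℝ} {b ξ : ℂ} {x : ℝ} {n : ℕ} (hC : 0 ≤ C) (hM : 0 < M)
    (hb : ‖b‖ ≤ C * M ^ n * n.factorial * Real.exp (c * x)) (hε : ε = 1 / (2 * M))
    (hξ : ‖ξ - x‖ < ε) :
    ‖b / n.factorial * (ξ - x) ^ n‖ ≤ C * Real.exp (c * x) * (1 / 2) ^ n := by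
  have hf : (0 : ℝ) < n.factorial := by exact_mod_cast n.factorial_pos
  rw [norm_mul, norm_div, norm_pow, Complex.norm_natCast]
  calc ‖b‖ / n.factorial * ‖ξ - x‖ ^ n
      ≤ (C * M ^ n * n.factorial * Real.exp (c * x)) / n.factorial * ε ^ n := by gcongr
    _ = C * Real.exp (c * x) * (M * ε) ^ n := by rw [mul_pow]; field_simp
    _ = C * Real.exp (c * x) * (1 / 2) ^ n := by
        congr 2; rw [hε]; field_simp

/-- Differentiating a Taylor polynomial with respect to its centre telescopes, and only the top term
survives. -/
lemma hasDerivAt_taylor_sum {b : ℕ → ℝ → ℂ} {x : ℝ}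
    (hb : ∀ n, HasDerivAt (b n) (b (n + 1) x) x) (ξ : ℂ) (N : ℕ) :
    HasDerivAt (fun y : ℝ => ∑ n ∈ Finset.range (N + 1), b n y / n.factorial * (ξ - y) ^ n)
      (b (N + 1) x / N.factorial * (ξ - x) ^ N) x := by
  induction N with
  | zero => simpa using hb 0
  | succ N ih =>
    have h1 : HasDerivAt (fun y : ℝ => (y : ℂ)) 1 x := Complex.ofRealCLM.hasDerivAt
    have h2 := ih.add (((hb (N + 1)).div_const ((N + 1).factorial : ℂ)).mul
      ((h1.const_sub ξ).pow (N + 1)))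
    have e : (fun y : ℝ => ∑ n ∈ Finset.range (N + 1 + 1), b n y / n.factorial * (ξ - y) ^ n) =
        (fun y : ℝ => ∑ n ∈ Finset.range (N + 1), b n y / n.factorial * (ξ - y) ^ n) +
          (fun y => b (N + 1) y / (N + 1).factorial) * fun y : ℝ => (ξ - (y : ℂ)) ^ (N + 1) := by
      ext y; rw [Finset.sum_range_succ]; rfl
    rw [e]
    refine h2.congr_deriv ?_
    have hf : (N.factorial : ℂ) ≠ 0 := by exact_mod_cast N.factorial_ne_zero
    have hN : ((N : ℂ) + 1) ≠ 0 := by exact_mod_cast N.succ_ne_zero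
    rw [Nat.factorial_succ]
    push_cast
    simp only [Pi.pow_apply]
    field_simp
    ring

/-- The Taylor series of a real function with Gevrey bounds on its derivatives do not depend on the
centre. -/
lemma tsum_taylor_eq {b : ℕ → ℝ → ℂ} (hC : 0 ≤ C) (hM : 0 < M) (hc : 0 ≤ c)
    (hd : ∀ n, ∀ x : ℝ, 0 ≤ x → HasDerivAt (b n) (b (n + 1) x) x)
    (hb : ∀ n, ∀ x : ℝ, 0 ≤ x → ‖b n x‖ ≤ C * M ^ n * n.factorial * Real.exp (c * x)) {ε : ℝ}
    (hε : ε = 1 / (2 * M)) {x y : ℝ} (hx : 0 ≤ x) (hy : 0 ≤ y) {ξ : ℂ} (hxξ : ‖ξ - x‖ < ε)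
    (hyξ : ‖ξ - y‖ < ε) :
    ∑' n : ℕ, b n x / n.factorial * (ξ - x) ^ n = ∑' n : ℕ, b n y / n.factorial * (ξ - y) ^ n := by
  have hs : ∀ x : ℝ, 0 ≤ x → ‖ξ - x‖ < ε → Tendsto (fun N : ℕ => ∑ n ∈ Finset.range (N + 1),
      b n x / n.factorial * (ξ - x) ^ n) atTop (𝓝 (∑' n : ℕ, b n x / n.factorial * (ξ - x) ^ n)) := by
    intro x hx hxξ
    have hsum : Summable fun n : ℕ => b n x / n.factorial * (ξ - x) ^ n :=
      Summable.of_norm_bounded (summable_geometric_two.mul_left _)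
        fun n => norm_taylor_term_le hC hM (hb n x hx) hε hxξ
    exact hsum.hasSum.tendsto_sum_nat.comp (tendsto_add_atTop_nat 1)
  have hconv : Convex ℝ (Ici (0 : ℝ) ∩ (fun t : ℝ => (t : ℂ)) ⁻¹' Metric.ball ξ ε) :=
    (convex_Ici 0).inter ((convex_ball ξ ε).linear_preimage Complex.ofRealCLM.toLinearMap)
  have hmem : ∀ t : ℝ, 0 ≤ t → ‖ξ - t‖ < ε →
      t ∈ Ici (0 : ℝ) ∩ (fun t : ℝ => (t : ℂ)) ⁻¹' Metric.ball ξ ε := fun t h1 h2 =>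
    ⟨h1, by rwa [mem_preimage, Metric.mem_ball', dist_eq_norm]⟩
  -- Mean value inequality in the centre, which stays nonnegative and within `ε` of `ξ` by
  -- convexity. The surviving top term is of size `(N + 1) 2 ^ (-N)`.
  have key : ∀ N : ℕ, ‖(∑ n ∈ Finset.range (N + 1), b n y / n.factorial * (ξ - y) ^ n) -
      ∑ n ∈ Finset.range (N + 1), b n x / n.factorial * (ξ - x) ^ n‖ ≤
      (C * M * Real.exp (c * (‖ξ‖ + ε))) * (((N : ℝ) + 1) * (1 / 2) ^ N) * ‖y - x‖ := by
    intro N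
    refine hconv.norm_image_sub_le_of_norm_hasDerivWithin_le
      (f := fun y : ℝ => ∑ n ∈ Finset.range (N + 1), b n y / n.factorial * (ξ - y) ^ n)
      (fun t ht => (hasDerivAt_taylor_sum (fun n => hd n t ht.1) ξ N).hasDerivWithinAt)
      (fun t ht => ?_) (hmem x hx hxξ) (hmem y hy hyξ)
    have ht0 : 0 ≤ t := ht.1
    have htξ : ‖ξ - t‖ < ε := by
      have := ht.2; rwa [mem_preimage, Metric.mem_ball', dist_eq_norm] at this
    have hf : (0 : ℝ) < N.factorial := by exact_mod_cast N.factorial_pos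
    have htle : t ≤ ‖ξ‖ + ε := by
      have h1 : ‖(t : ℂ)‖ ≤ ‖ξ‖ + ‖ξ - t‖ := by
        calc ‖(t : ℂ)‖ = ‖ξ - (ξ - t)‖ := by congr 1; ring
          _ ≤ _ := norm_sub_le _ _
      rw [Complex.norm_real, Real.norm_of_nonneg ht0] at h1
      linarith
    rw [norm_mul, norm_div, norm_pow, Complex.norm_natCast]
    calc ‖b (N + 1) t‖ / N.factorial * ‖ξ - t‖ ^ N
        ≤ (C * M ^ (N + 1) * (N + 1).factorial * Real.exp (c * (‖ξ‖ + ε))) / N.factorial *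
            ε ^ N := by
          have := (hb (N + 1) t ht0).trans (mul_le_mul_of_nonneg_left (Real.exp_le_exp.2
            (mul_le_mul_of_nonneg_left htle hc)) (by positivity))
          gcongr
      _ = (C * M * Real.exp (c * (‖ξ‖ + ε))) * (((N : ℝ) + 1) * (M * ε) ^ N) := by
          rw [Nat.factorial_succ, mul_pow]; push_cast; field_simp; ring
      _ = _ := by
          congr 3; rw [hε]; field_simp
  have hlim : Tendsto (fun N : ℕ => (C * M * Real.exp (c * (‖ξ‖ + ε))) *
      (((N : ℝ) + 1) * (1 / 2) ^ N) * ‖y - x‖) atTop (𝓝 0) := by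
    have h1 : Tendsto (fun N : ℕ => (N : ℝ) * (1 / 2 : ℝ) ^ N) atTop (𝓝 0) :=
      tendsto_self_mul_const_pow_of_lt_one (by norm_num) (by norm_num)
    have h2 : Tendsto (fun N : ℕ => (1 / 2 : ℝ) ^ N) atTop (𝓝 0) :=
      tendsto_pow_atTop_nhds_zero_of_lt_one (by norm_num) (by norm_num)
    have h3 : Tendsto (fun N : ℕ => ((N : ℝ) + 1) * (1 / 2) ^ N) atTop (𝓝 0) := by
      simpa [add_mul] using h1.add h2
    simpa using (h3.const_mul (C * M * Real.exp (c * (‖ξ‖ + ε)))).mul_const ‖y - x‖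
  have := squeeze_zero_norm key hlim
  have h2 := (hs y hy hyξ).sub (hs x hx hxξ)
  exact (sub_eq_zero.1 (tendsto_nhds_unique h2 this)).symm

/-- The continuation at `ξ` is the Taylor series about some real centre `X ξ` within `ε = 1 / (2 M)`
of `ξ`. Since the sum does not depend on the centre, the centre may be frozen near any given point,
where the series is visibly holomorphic. The exponential bound survives because `X ξ ≤ ‖ξ‖ + ε`. -/
lemma exists_holomorphicOnProd_tube (hU : IsOpen U) (hC : 0 < C) (hM : 0 < M) (hc : 0 < c)
    (hd : ∀ n, ∀ z ∈ U, ∀ x : ℝ, 0 ≤ x → HasDerivAt (B n z) (B (n + 1) z x) x)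
    (hb : ∀ n, ∀ z ∈ U, ∀ x : ℝ, 0 ≤ x →
      ‖B n z x‖ ≤ C * M ^ n * n.factorial * Real.exp (c * x))
    (hz : ∀ n, ∀ x : ℝ, DifferentiableOn ℂ (fun z => B n z x) U) :
    ∃ ε : ℝ, 0 < ε ∧ ∃ α : ℂ → ℂ → ℂ, HolomorphicOnProd α U (tube ε) ∧
      (∃ K L : ℝ, 0 < K ∧ 0 < L ∧ ∀ z ∈ U, ∀ ξ ∈ tube ε, ‖α z ξ‖ ≤ K * Real.exp (L * ‖ξ‖)) ∧
      (∀ z ∈ U, ∀ x : ℝ, 0 ≤ x → α z x = B 0 z x) ∧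
      ∀ z ∈ U, ∀ ξ : ℂ, ‖ξ‖ < ε → HasSum (fun k => B k z 0 / k.factorial * ξ ^ k) (α z ξ) := by
  obtain ⟨ε, hε⟩ : ∃ ε : ℝ, ε = 1 / (2 * M) := ⟨_, rfl⟩
  have hε0 : 0 < ε := by rw [hε]; positivity
  have hex : ∀ ξ : ℂ, ∃ x : ℝ, ξ ∈ tube ε → 0 ≤ x ∧ ‖ξ - x‖ < ε := by
    intro ξ
    by_cases h : ξ ∈ tube ε
    · obtain ⟨x, hx⟩ := mem_tube_iff.1 h
      exact ⟨x, fun _ => hx⟩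
    · exact ⟨0, fun h' => absurd h' h⟩
  choose X hX using hex
  have hterm : ∀ z ∈ U, ∀ x : ℝ, 0 ≤ x → ∀ ξ : ℂ, ‖ξ - x‖ < ε → ∀ n : ℕ,
      ‖B n z x / n.factorial * (ξ - x) ^ n‖ ≤ C * Real.exp (c * x) * (1 / 2) ^ n :=
    fun z hz x hx ξ hξ n => norm_taylor_term_le hC.le hM (hb n z hz x hx) hε hξ
  have heq : ∀ z ∈ U, ∀ x : ℝ, 0 ≤ x → ∀ ξ : ℂ, ‖ξ - x‖ < ε →
      ∑' n : ℕ, B n z (X ξ) / n.factorial * (ξ - X ξ) ^ n =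
        ∑' n : ℕ, B n z x / n.factorial * (ξ - x) ^ n := by
    intro z hz x hx ξ hξ
    have hm := hX ξ (mem_tube_iff.2 ⟨x, hx, hξ⟩)
    exact tsum_taylor_eq hC.le hM hc.le (fun n x hx => hd n z hz x hx)
      (fun n x hx => hb n z hz x hx) hε hm.1 hx hm.2 hξ
  refine ⟨ε, hε0, fun z ξ => ∑' n : ℕ, B n z (X ξ) / n.factorial * (ξ - X ξ) ^ n, ?_, ?_, ?_, ?_⟩
  · rintro ⟨z₀, ξ₀⟩ ⟨hz₀, hξ₀⟩
    obtain ⟨hx0, hx1⟩ := hX ξ₀ hξ₀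
    set x := X ξ₀
    have hopen : IsOpen (U ×ˢ Metric.ball (x : ℂ) ε) := hU.prod Metric.isOpen_ball
    have hD : DifferentiableOn ℂ (fun p : ℂ × ℂ =>
        ∑' n : ℕ, B n p.1 x / n.factorial * (p.2 - x) ^ n) (U ×ˢ Metric.ball (x : ℂ) ε) := by
      refine differentiableOn_tsum_of_holomorphic hopen (fun n => ?_) fun p hp =>
        ⟨1, one_pos, fun n => C * Real.exp (c * x) * (1 / 2) ^ n,
          summable_geometric_two.mul_left _, fun n q _ hq => ?_⟩
      · have : DifferentiableOn ℂ (fun p : ℂ × ℂ => B n p.1 x) (U ×ˢ Metric.ball (x : ℂ) ε) :=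
          (hz n x).comp (by fun_prop) fun p hp => hp.1
        simp_rw [div_eq_mul_inv]
        exact (this.mul_const _).mul (by fun_prop)
      · exact hterm _ hq.1 x hx0 _ (by simpa [dist_eq_norm] using hq.2) n
    have hin : ((z₀, ξ₀) : ℂ × ℂ) ∈ U ×ˢ Metric.ball (x : ℂ) ε :=
      ⟨hz₀, by simpa [dist_eq_norm] using hx1⟩
    refine DifferentiableAt.differentiableWithinAt ?_
    refine (hD.differentiableAt (hopen.mem_nhds hin)).congr_of_eventuallyEq ?_
    filter_upwards [hopen.mem_nhds hin] with p hp
    exact heq p.1 hp.1 x hx0 p.2 (by simpa [dist_eq_norm] using hp.2)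
  · refine ⟨2 * (C * Real.exp (c * ε)), c, by positivity, hc, fun z hz ξ hξ => ?_⟩
    obtain ⟨hx0, hx1⟩ := hX ξ hξ
    have hle : X ξ ≤ ‖ξ‖ + ε := by
      have h1 : ‖(X ξ : ℂ)‖ ≤ ‖ξ‖ + ‖ξ - X ξ‖ := by
        calc ‖(X ξ : ℂ)‖ = ‖ξ - (ξ - X ξ)‖ := by congr 1; ring
          _ ≤ _ := norm_sub_le _ _
      rw [Complex.norm_real, Real.norm_of_nonneg hx0] at h1
      linarith
    refine (tsum_of_norm_bounded (summable_geometric_two.mul_left _).hasSum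
      (hterm z hz _ hx0 ξ hx1)).trans ?_
    rw [tsum_mul_left, tsum_geometric_two]
    calc C * Real.exp (c * X ξ) * 2 ≤ C * Real.exp (c * (‖ξ‖ + ε)) * 2 := by gcongr
      _ = 2 * (C * Real.exp (c * ε)) * Real.exp (c * ‖ξ‖) := by
          rw [mul_add, Real.exp_add]; ring
  · intro z hz x hx
    simp only
    rw [heq z hz x hx x (by simpa using hε0), tsum_eq_single 0]
    · simp
    · intro n hn; simp [hn]
  · intro z hz ξ hξ
    simp only
    have h0 : ‖ξ - (0 : ℝ)‖ < ε := by simpa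
    rw [heq z hz 0 le_rfl ξ h0]
    have hsum : Summable fun n : ℕ => B n z 0 / n.factorial * (ξ - (0 : ℝ)) ^ n :=
      Summable.of_norm_bounded (summable_geometric_two.mul_left _) (hterm z hz 0 le_rfl ξ h0)
    simpa using hsum.hasSum

end TaylorTube

/-! ### Nevanlinna's theorem -/

lemma le_of_forall_small {A B C δ : ℝ} (hδ : 0 < δ) (h : ∀ x : ℝ, 0 < x → x < δ → A ≤ B + C * x) :
    A ≤ B := by
  have hlim : Tendsto (fun x : ℝ => B + C * x) (𝓝[>] 0) (𝓝 (B + C * 0)) :=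
    ((continuous_const.add (continuous_const.mul continuous_id)).tendsto 0).mono_left
      nhdsWithin_le_nhds
  have := ge_of_tendsto hlim (by
    filter_upwards [Ioo_mem_nhdsGT hδ] with x hx using h x hx.1 hx.2)
  simpa using this

lemma UniformGevreyAsymptotics.mono {U U' : Set ℂ} {d d' : ℝ} {f : ℂ → ℂ → ℂ} {a : ℕ → ℂ → ℂ}
    (h : UniformGevreyAsymptotics U d f a) (hU : U' ⊆ U) (hd : 0 < d') :
    UniformGevreyAsymptotics U' d' f a := by
  obtain ⟨h1, δ, hδ, hδd, C, M, hC, hM, hb⟩ := h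
  refine ⟨fun k => (h1 k).mono hU, min δ d', lt_min hδ hd, min_le_right _ _, C, M, hC, hM,
    fun n z hz h hh => hb n z (hU hz) h (borelDisc_mono (lt_min hδ hd) (min_le_left _ _) hh)⟩

/-- The term `a n * h ^ n` is the difference of two successive remainders. Dividing by `h ^ n` and
letting `h` tend to zero along the positive axis removes the contribution of the higher one, so the
constants are unchanged. -/
lemma norm_coeff_le_of_gevrey {δ C M : ℝ} (hδ : 0 < δ) {f : ℂ → ℂ} {a : ℕ → ℂ}
    (hb : ∀ n : ℕ, ∀ h ∈ borelDisc δ,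
      ‖f h - ∑ k ∈ Finset.range n, a k * h ^ k‖ ≤ C * M ^ n * (n.factorial : ℝ) * ‖h‖ ^ n)
    (n : ℕ) : ‖a n‖ ≤ C * M ^ n * (n.factorial : ℝ) := by
  refine le_of_forall_small (C := C * M ^ (n + 1) * ((n + 1).factorial : ℝ)) hδ fun x hx hxδ => ?_
  have hmem := ofReal_mem_borelDisc hx hxδ
  have h1 := hb n x hmem
  have h2 := hb (n + 1) x hmem
  rw [Finset.sum_range_succ] at h2
  have hn : ‖(x : ℂ)‖ = x := by rw [Complex.norm_real, Real.norm_of_nonneg hx.le]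
  rw [hn] at h1 h2
  have h3 : ‖a n * (x : ℂ) ^ n‖ ≤ C * M ^ n * (n.factorial : ℝ) * x ^ n +
      C * M ^ (n + 1) * ((n + 1).factorial : ℝ) * x ^ (n + 1) := by
    refine le_trans (le_of_eq ?_) ((norm_sub_le _ _).trans (add_le_add h1 h2))
    congr 1; ring
  rw [norm_mul, norm_pow, hn] at h3
  have hxn : 0 < x ^ n := by positivity
  refine le_of_mul_le_mul_right (h3.trans (le_of_eq ?_)) hxn
  ring

lemma UniformGevreyAsymptotics.uniformGevreySeries {U : Set ℂ} {d : ℝ} {f : ℂ → ℂ → ℂ}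
    {a : ℕ → ℂ → ℂ} (h : UniformGevreyAsymptotics U d f a) : UniformGevreySeries U a := by
  obtain ⟨h1, δ, hδ, hδd, C, M, hC, hM, hb⟩ := h
  exact ⟨h1, C, M, hC, hM, fun k z hz => norm_coeff_le_of_gevrey (a := fun k => a k z) hδ
    (fun n h hh => hb n z hz h hh) k⟩

/-- The `n`-th derivative is estimated through a remainder of order `n + 3`; this costs only a
geometric factor. -/
lemma factorial_add_three_le (n : ℕ) :
    ((n + 3).factorial : ℝ) ≤ 6 * 4 ^ n * n.factorial := by
  induction n with
  | zero => norm_num [Nat.factorial]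
  | succ n ih =>
    rw [show n + 1 + 3 = (n + 3) + 1 by ring, Nat.factorial_succ, Nat.factorial_succ n]
    push_cast
    have h4 : ((n : ℝ) + 3 + 1) ≤ 4 * (n + 1) := by linarith [(Nat.cast_nonneg n : (0 : ℝ) ≤ n)]
    calc ((n : ℝ) + 3 + 1) * ((n + 3).factorial : ℝ)
        ≤ (4 * (n + 1)) * (6 * 4 ^ n * n.factorial) := by gcongr
      _ = _ := by ring

lemma laplace_one {s : ℂ} (hs : 0 < s.re) :
    ∫ x in Ioi (0 : ℝ), Complex.exp (-(s * x)) = s⁻¹ := by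
  have := integral_exp_mul_complex_Ioi (a := -s) (by simpa) 0
  simp only [neg_mul, Complex.ofReal_zero, mul_zero, Complex.exp_zero] at this
  rw [this]
  ring

/-- The `n`-th remainder of an asymptotic series, times `s ^ (n - 3)`, as a function of
`s = 1 / ħ`. -/
noncomputable def scaledRemainder (f : ℂ → ℂ) (a : ℕ → ℂ) (n : ℕ) (s : ℂ) : ℂ :=
  s ^ n * (f s⁻¹ - ∑ k ∈ Finset.range (n + 3), a k * s⁻¹ ^ k)

/-- The derivatives of the Borel transform of a function with asymptotic series `a`. -/
noncomputable def borelDeriv (f : ℂ → ℂ) (a : ℕ → ℂ) (c : ℝ) (n : ℕ) (x : ℝ) : ℂ :=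
  a (n + 1) + a (n + 2) * x +
    ∫ v, scaledRemainder f a n (verticalLine c v) * Complex.exp (verticalLine c v * x)

section Nevanlinna

variable {δ C M : ℝ} {f : ℂ → ℂ} {a : ℕ → ℂ}

/-- Differentiating `e ^ (s x)` brings down a factor `s`. The correction `a (n + 3) s⁻²` has inverse
Laplace transform `a (n + 3) x`, which is the linear term of `borelDeriv f a c (n + 1)`. -/
lemma scaledRemainder_succ {s : ℂ} (hs : s ≠ 0) (n : ℕ) :
    s * scaledRemainder f a n s = scaledRemainder f a (n + 1) s + a (n + 3) * (s ^ 2)⁻¹ := by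
  rw [scaledRemainder, scaledRemainder, show n + 1 + 3 = (n + 3) + 1 by ring,
    Finset.sum_range_succ _ (n + 3)]
  simp only [inv_pow]
  field_simp
  ring

/-- Subtracting three terms more than the power `s ^ n` leaves cubic decay, which is what
`laplace_integral_verticalLine` needs. -/
lemma norm_scaledRemainder_le
    (hb : ∀ n : ℕ, ∀ h ∈ borelDisc δ,
      ‖f h - ∑ k ∈ Finset.range n, a k * h ^ k‖ ≤ C * M ^ n * (n.factorial : ℝ) * ‖h‖ ^ n)
    (n : ℕ) {s : ℂ} (hs0 : s ≠ 0) (hs : 1 / δ < s.re) :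
    ‖scaledRemainder f a n s‖ ≤ (C * M ^ (n + 3) * ((n + 3).factorial : ℝ)) / ‖s‖ ^ 3 := by
  rw [scaledRemainder, norm_mul, norm_pow]
  have h0 : 0 < ‖s‖ := norm_pos_iff.2 hs0
  have := hb (n + 3) s⁻¹ (inv_mem_borelDisc_iff.2 hs)
  calc ‖s‖ ^ n * _ ≤ ‖s‖ ^ n * (C * M ^ (n + 3) * ((n + 3).factorial : ℝ) * ‖s⁻¹‖ ^ (n + 3)) := by
        gcongr
    _ = _ := by
        rw [norm_inv, inv_pow, pow_add ‖s‖]; field_simp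

lemma differentiableOn_scaledRemainder (hδ : 0 < δ) (hf : DifferentiableOn ℂ f (borelDisc δ))
    (n : ℕ) : DifferentiableOn ℂ (scaledRemainder f a n) {s : ℂ | 1 / δ < s.re} := by
  have hinv : DifferentiableOn ℂ (fun s : ℂ => s⁻¹) {s : ℂ | 1 / δ < s.re} := by
    intro s hs
    refine (differentiableAt_inv ?_).differentiableWithinAt
    rintro rfl
    have : 0 < 1 / δ := by positivity
    have : 1 / δ < 0 := by simpa using hs
    linarith
  have h1 : DifferentiableOn ℂ (fun s : ℂ => f s⁻¹) {s : ℂ | 1 / δ < s.re} :=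
    hf.comp hinv fun s hs => inv_mem_borelDisc_iff.2 hs
  exact (differentiableOn_id.pow n).mul
    (h1.sub (DifferentiableOn.fun_sum fun k _ => (hinv.pow k).const_mul _))

lemma laplace_scaledRemainder (hδ : 0 < δ) (hC : 0 < C) (hM : 0 < M)
    (hf : DifferentiableOn ℂ f (borelDisc δ))
    (hb : ∀ n : ℕ, ∀ h ∈ borelDisc δ,
      ‖f h - ∑ k ∈ Finset.range n, a k * h ^ k‖ ≤ C * M ^ n * (n.factorial : ℝ) * ‖h‖ ^ n)
    {c : ℝ} (hc : c = 1 / δ + 1) (n : ℕ) {ψ : ℝ → ℂ}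
    (hψ : ∀ x : ℝ, ψ x = ∫ v, scaledRemainder f a n (verticalLine c v) *
      Complex.exp (verticalLine c v * x)) :
    Continuous ψ ∧
    (∀ x, ‖ψ x‖ ≤ C * M ^ (n + 3) * ((n + 3).factorial : ℝ) * Real.pi * Real.exp (c * x)) ∧
      (∀ x ≤ 0, ψ x = 0) ∧ ∀ s : ℂ, c < s.re →
        ∫ x in Ioi (0 : ℝ), ψ x * Complex.exp (-(s * x)) = scaledRemainder f a n s := by
  have h0 : 0 < 1 / δ := by positivity
  refine laplace_integral_verticalLine (σ := 1 / δ) (by linarith) (by linarith) (by positivity)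
    (differentiableOn_scaledRemainder hδ hf n) (fun s hs => ?_) hψ
  refine norm_scaledRemainder_le hb n ?_ (by linarith)
  rintro rfl
  simp at hs; linarith

lemma hasDerivAt_borelDeriv (hδ : 0 < δ) (hC : 0 < C) (hM : 0 < M)
    (hf : DifferentiableOn ℂ f (borelDisc δ))
    (hb : ∀ n : ℕ, ∀ h ∈ borelDisc δ,
      ‖f h - ∑ k ∈ Finset.range n, a k * h ^ k‖ ≤ C * M ^ n * (n.factorial : ℝ) * ‖h‖ ^ n)
    {c : ℝ} (hc : c = 1 / δ + 1) (n : ℕ) {x : ℝ} (hx : 0 ≤ x) :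
    HasDerivAt (borelDeriv f a c n) (borelDeriv f a c (n + 1) x) x := by
  have h0 : 0 < 1 / δ := by positivity
  have hc1 : 1 ≤ c := by linarith
  have hne : ∀ v, verticalLine c v ≠ 0 := fun v h => by
    have := congrArg Complex.re h
    simp at this; linarith
  have hn1 : ∀ v, 1 ≤ ‖verticalLine c v‖ := fun v => by
    have := Complex.re_le_norm (verticalLine c v)
    rw [verticalLine_re] at this; linarith
  have hcont : ∀ n, Continuous fun v => scaledRemainder f a n (verticalLine c v) := fun n =>
    continuous_comp_verticalLine (by linarith)
      (differentiableOn_scaledRemainder hδ hf n).continuousOn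
  have hbound : ∀ n v, ‖scaledRemainder f a n (verticalLine c v)‖ ≤
      (C * M ^ (n + 3) * ((n + 3).factorial : ℝ)) / ‖verticalLine c v‖ ^ 3 := fun n v =>
    norm_scaledRemainder_le hb n (hne v) (by rw [verticalLine_re]; linarith)
  have hbound2 : ∀ n v, ‖scaledRemainder f a n (verticalLine c v)‖ ≤
      (C * M ^ (n + 3) * ((n + 3).factorial : ℝ)) / ‖verticalLine c v‖ ^ 2 := fun n v => by
    refine (hbound n v).trans ?_
    have := hn1 v
    have : ‖verticalLine c v‖ ^ 2 ≤ ‖verticalLine c v‖ ^ 3 := pow_le_pow_right₀ this (by norm_num)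
    gcongr
  set K := C * M ^ (n + 3) * ((n + 3).factorial : ℝ) with hK
  have hK0 : 0 < K := by positivity
  -- The extra factor `s` reduces cubic to quadratic decay, still integrable. On the ball of radius
  -- `1` about `x` the exponential is at most `e ^ (c (x + 1))`.
  have key := hasDerivAt_integral_of_dominated_loc_of_deriv_le (μ := volume) (𝕜 := ℝ)
    (F := fun (y : ℝ) v => scaledRemainder f a n (verticalLine c v) *
      Complex.exp (verticalLine c v * y))
    (F' := fun (y : ℝ) v => verticalLine c v * scaledRemainder f a n (verticalLine c v) *
      Complex.exp (verticalLine c v * y))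
    (x₀ := x) (bound := fun v => K * Real.exp (c * (x + 1)) * (1 + v ^ 2)⁻¹)
    (Metric.ball_mem_nhds x one_pos) ?_ ?_ ?_ ?_ (integrable_inv_one_add_sq.const_mul _) ?_
  · have hid : HasDerivAt (fun y : ℝ => (y : ℂ)) 1 x := Complex.ofRealCLM.hasDerivAt
    have h3 := ((hid.const_mul (a (n + 2))).const_add (a (n + 1))).add key.2
    refine h3.congr_deriv ?_
    have hi1 : Integrable fun v => scaledRemainder f a (n + 1) (verticalLine c v) *
        Complex.exp (verticalLine c v * x) := by
      refine integrable_verticalLine (q := fun s => scaledRemainder f a (n + 1) s *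
        Complex.exp (s * x)) (C := C * M ^ (n + 1 + 3) * ((n + 1 + 3).factorial : ℝ) *
          Real.exp (c * x)) hc1 (by positivity) ?_ fun v => ?_
      · exact (hcont (n + 1)).mul (by fun_prop)
      · rw [norm_mul, norm_exp_verticalLine_mul, mul_div_right_comm]
        gcongr
        exact hbound2 _ _
    have hi2 : Integrable fun v => a (n + 3) * ((verticalLine c v ^ 2)⁻¹ *
        Complex.exp (verticalLine c v * x)) := by
      refine Integrable.const_mul (integrable_verticalLine (q := fun s => (s ^ 2)⁻¹ *
        Complex.exp (s * x)) (C := Real.exp (c * x)) hc1 (by positivity) ?_ fun v => ?_) _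
      · have := fun v => pow_ne_zero 2 (hne v)
        fun_prop (disch := assumption)
      · rw [norm_mul, norm_exp_verticalLine_mul, norm_inv, norm_pow, div_eq_inv_mul]
    rw [borelDeriv, mul_one]
    simp_rw [scaledRemainder_succ (hne _), add_mul, mul_assoc]
    rw [integral_add hi1 hi2, integral_const_mul, integral_verticalLine_inv_sq hc1 hx]
    ring
  · refine Eventually.of_forall fun y => ?_
    exact ((hcont n).mul (by fun_prop)).aestronglyMeasurable
  · refine integrable_verticalLine (q := fun s => scaledRemainder f a n s *
        Complex.exp (s * x)) (C := K * Real.exp (c * x)) hc1 (by positivity) ?_ fun v => ?_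
    · exact (hcont n).mul (by fun_prop)
    · rw [norm_mul, norm_exp_verticalLine_mul, mul_div_right_comm]
      gcongr
      exact hbound2 _ _
  · exact ((((continuous_verticalLine c).mul (hcont n))).mul (by fun_prop)).aestronglyMeasurable
  · refine Eventually.of_forall fun v y hy => ?_
    refine norm_le_inv_one_add_sq hc1 (by positivity) ?_
    rw [norm_mul, norm_exp_verticalLine_mul, norm_mul]
    have hyx : y ≤ x + 1 := by
      have := (abs_lt.1 (Metric.mem_ball.1 hy)).2
      linarith
    have hp : 0 < ‖verticalLine c v‖ := by linarith [hn1 v]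
    have hc0 : 0 ≤ c := by linarith
    calc ‖verticalLine c v‖ * ‖scaledRemainder f a n (verticalLine c v)‖ * Real.exp (c * y)
        ≤ ‖verticalLine c v‖ * (K / ‖verticalLine c v‖ ^ 3) * Real.exp (c * (x + 1)) := by
          gcongr
          exact hbound n v
      _ = _ := by field_simp
  · refine Eventually.of_forall fun v y _ => ?_
    have hid : HasDerivAt (fun y : ℝ => (y : ℂ)) 1 y := Complex.ofRealCLM.hasDerivAt
    refine (((hid.const_mul (verticalLine c v)).cexp).const_mul
      (scaledRemainder f a n (verticalLine c v))).congr_deriv ?_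
    ring

lemma norm_borelDeriv_le (hδ : 0 < δ) (hC : 0 < C) (hM : 0 < M)
    (hf : DifferentiableOn ℂ f (borelDisc δ))
    (hb : ∀ n : ℕ, ∀ h ∈ borelDisc δ,
      ‖f h - ∑ k ∈ Finset.range n, a k * h ^ k‖ ≤ C * M ^ n * (n.factorial : ℝ) * ‖h‖ ^ n)
    {c : ℝ} (hc : c = 1 / δ + 1) (n : ℕ) {x : ℝ} (hx : 0 ≤ x) :
    ‖borelDeriv f a c n x‖ ≤ (6 * C * max M 1 ^ 3 * (2 + Real.pi)) * (4 * max M 1) ^ n *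
      n.factorial * Real.exp (c * x) := by
  have h0 : 0 < 1 / δ := by positivity
  obtain ⟨-, h2, -⟩ := laplace_scaledRemainder hδ hC hM hf hb hc n (ψ := fun x =>
    ∫ v, scaledRemainder f a n (verticalLine c v) * Complex.exp (verticalLine c v * x))
    (fun _ => rfl)
  -- With `m ≥ 1` the Gevrey bounds are monotone in the order, so those of orders `n + 1` and `n +
  -- 2` are absorbed in the one of order `n + 3`.
  set m := max M 1
  have hm1 : 1 ≤ m := le_max_right _ _
  have hmM : M ≤ m := le_max_left _ _
  have hcoef : ∀ j, j ≤ 3 → C * M ^ (n + j) * ((n + j).factorial : ℝ) ≤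
      C * m ^ (n + 3) * ((n + 3).factorial : ℝ) := by
    intro j hj
    have h1 : M ^ (n + j) ≤ m ^ (n + 3) :=
      (pow_le_pow_left₀ hM.le hmM _).trans (pow_le_pow_right₀ hm1 (by omega))
    have h2 : ((n + j).factorial : ℝ) ≤ ((n + 3).factorial : ℝ) := by
      exact_mod_cast Nat.factorial_le (by omega)
    gcongr
  set K := C * m ^ (n + 3) * ((n + 3).factorial : ℝ) with hK
  have hK0 : 0 ≤ K := by positivity
  have hxe : x ≤ Real.exp (c * x) := by
    have := Real.add_one_le_exp (c * x)
    nlinarith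
  have h1e : 1 ≤ Real.exp (c * x) := Real.one_le_exp (by nlinarith)
  have hnx : ‖(x : ℂ)‖ = x := by rw [Complex.norm_real, Real.norm_of_nonneg hx]
  have t1 : ‖a (n + 1)‖ ≤ K * Real.exp (c * x) := by
    have := (norm_coeff_le_of_gevrey hδ hb (n + 1)).trans (hcoef 1 (by norm_num))
    exact this.trans (le_mul_of_one_le_right hK0 h1e)
  have t2 : ‖a (n + 2) * x‖ ≤ K * Real.exp (c * x) := by
    rw [norm_mul, hnx]
    have := (norm_coeff_le_of_gevrey hδ hb (n + 2)).trans (hcoef 2 (by norm_num))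
    gcongr
  have t3 := (h2 x).trans (mul_le_mul_of_nonneg_right (mul_le_mul_of_nonneg_right
    (hcoef 3 le_rfl) Real.pi_pos.le) (Real.exp_pos _).le)
  calc ‖borelDeriv f a c n x‖ ≤ K * Real.exp (c * x) + K * Real.exp (c * x) +
        K * Real.pi * Real.exp (c * x) := by
        rw [borelDeriv]
        exact (norm_add_le _ _).trans (add_le_add ((norm_add_le _ _).trans (add_le_add t1 t2)) t3)
    _ = C * m ^ (n + 3) * (2 + Real.pi) * Real.exp (c * x) * ((n + 3).factorial : ℝ) := by
        rw [hK]; ring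
    _ ≤ C * m ^ (n + 3) * (2 + Real.pi) * Real.exp (c * x) * (6 * 4 ^ n * n.factorial) := by
        gcongr
        exact factorial_add_three_le n
    _ = _ := by rw [mul_pow, pow_add]; ring

/-- The three summands of `borelDeriv f a c 0` have Laplace transforms `a 1 / s`, `a 2 / s²` and the
remainder of `f` after those terms and `a 0`. -/
lemma laplace_borelDeriv_zero (hδ : 0 < δ) (hC : 0 < C) (hM : 0 < M)
    (hf : DifferentiableOn ℂ f (borelDisc δ))
    (hb : ∀ n : ℕ, ∀ h ∈ borelDisc δ,
      ‖f h - ∑ k ∈ Finset.range n, a k * h ^ k‖ ≤ C * M ^ n * (n.factorial : ℝ) * ‖h‖ ^ n)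
    {c : ℝ} (hc : c = 1 / δ + 1) {s : ℂ} (hs : c < s.re) :
    ∫ x in Ioi (0 : ℝ), borelDeriv f a c 0 x * Complex.exp (-(s * x)) = f s⁻¹ - a 0 := by
  have h0 : 0 < 1 / δ := by positivity
  have hs0 : 0 < s.re := by linarith
  have hsne : s ≠ 0 := by rintro rfl; simp at hs0
  obtain ⟨h1, h2, -, h4⟩ := laplace_scaledRemainder hδ hC hM hf hb hc 0 (ψ := fun x =>
    ∫ v, scaledRemainder f a 0 (verticalLine c v) * Complex.exp (verticalLine c v * x))
    (fun _ => rfl)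
  have hn : ∀ x : ℝ, ‖Complex.exp (-(s * x))‖ = Real.exp (-s.re * x) := fun x => by
    simp [Complex.norm_exp]
  set ψ : ℝ → ℂ := fun x =>
    ∫ v, scaledRemainder f a 0 (verticalLine c v) * Complex.exp (verticalLine c v * x)
  have i1 : IntegrableOn (fun x : ℝ => Complex.exp (-(s * x))) (Ioi 0) := by
    refine Integrable.mono' (exp_neg_integrableOn_Ioi 0 hs0)
      (Continuous.aestronglyMeasurable (by fun_prop)) (Eventually.of_forall fun x => ?_)
    rw [hn]
  have i2 : IntegrableOn (fun x : ℝ => (x : ℂ) * Complex.exp (-(s * x))) (Ioi 0) := by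
    refine Integrable.mono' (integrableOn_mul_exp_neg_mul hs0)
      (Continuous.aestronglyMeasurable (by fun_prop)) ?_
    refine (ae_restrict_iff' measurableSet_Ioi).2 (Eventually.of_forall fun x hx => ?_)
    rw [norm_mul, hn, Complex.norm_real, Real.norm_of_nonneg (le_of_lt hx)]
  have i3 : IntegrableOn (fun x : ℝ => ψ x * Complex.exp (-(s * x))) (Ioi 0) := by
    refine Integrable.mono' ((exp_neg_integrableOn_Ioi 0 (sub_pos.2 hs)).const_mul
        (C * M ^ (0 + 3) * ((0 + 3).factorial : ℝ) * Real.pi))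
        (Continuous.aestronglyMeasurable (by fun_prop)) (Eventually.of_forall fun x => ?_)
    rw [norm_mul, hn]
    refine (mul_le_mul_of_nonneg_right (h2 x) (Real.exp_pos _).le).trans (le_of_eq ?_)
    rw [mul_assoc, ← Real.exp_add]
    congr 2; ring
  have : ∀ x : ℝ, borelDeriv f a c 0 x * Complex.exp (-(s * x)) =
      a 1 * Complex.exp (-(s * x)) + a 2 * ((x : ℂ) * Complex.exp (-(s * x))) +
        ψ x * Complex.exp (-(s * x)) := by
    intro x
    simp only [borelDeriv, zero_add, ψ]
    ring
  simp_rw [this]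
  have i12 : IntegrableOn (fun x : ℝ => a 1 * Complex.exp (-(s * x)) +
    a 2 * ((x : ℂ) * Complex.exp (-(s * x)))) (Ioi 0) := (i1.const_mul _).add (i2.const_mul _)
  rw [integral_add i12 i3, integral_add (i1.const_mul _)
    (i2.const_mul _), integral_const_mul, integral_const_mul, laplace_one hs0, laplace_id hs0,
    h4 s hs, scaledRemainder]
  simp [Finset.sum_range_succ]
  ring

end Nevanlinna

/-- **Nevanlinna's theorem**, with parameters. -/
theorem exists_isBorelContinuation {U : Set ℂ} (hU : IsOpen U) {d : ℝ} {f : ℂ → ℂ → ℂ}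
    {a : ℕ → ℂ → ℂ} (hf : HolomorphicOnProd f U (borelDisc d))
    (hfa : UniformGevreyAsymptotics U d f a) :
    ∃ ε : ℝ, 0 < ε ∧ ∃ δ : ℝ, 0 < δ ∧ δ ≤ d ∧ ∃ α : ℂ → ℂ → ℂ, IsBorelContinuation U ε a α ∧
      ∀ z ∈ U, ∀ h ∈ borelDisc δ, f z h = a 0 z + laplace α z h := by
  obtain ⟨ha, δ, hδ, hδd, C, M, hC, hM, hb⟩ := hfa
  have h0 : 0 < 1 / δ := by positivity
  obtain ⟨c, hc⟩ : ∃ c : ℝ, c = 1 / δ + 1 := ⟨_, rfl⟩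
  have hc1 : 1 ≤ c := by linarith
  have hfz : ∀ z ∈ U, DifferentiableOn ℂ (f z) (borelDisc δ) := fun z hz =>
    (hf.right hz).mono (borelDisc_mono hδ hδd)
  have hbz : ∀ z ∈ U, ∀ n : ℕ, ∀ h ∈ borelDisc δ, ‖f z h - ∑ k ∈ Finset.range n, a k z * h ^ k‖ ≤
      C * M ^ n * (n.factorial : ℝ) * ‖h‖ ^ n := fun z hz n h hh => hb n z hz h hh
  have hne : ∀ v, verticalLine c v ≠ 0 := fun v h => by
    have := congrArg Complex.re h
    simp at this; linarith
  have hin : ∀ v, (verticalLine c v)⁻¹ ∈ borelDisc δ := fun v =>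
    inv_mem_borelDisc_iff.2 (by rw [verticalLine_re]; linarith)
  have hhol : ∀ n, ∀ x : ℝ, DifferentiableOn ℂ
      (fun z => borelDeriv (f z) (fun k => a k z) c n x) U := by
    intro n x
    -- The parameter lemma has two complex parameters; the second is a dummy here.
    have hopen : IsOpen (U ×ˢ (univ : Set ℂ)) := hU.prod isOpen_univ
    have hrem : ∀ v, DifferentiableOn ℂ (fun p : ℂ × ℂ =>
        scaledRemainder (f p.1) (fun k => a k p.1) n (verticalLine c v)) (U ×ˢ univ) := by
      intro v
      have h1 : DifferentiableOn ℂ (fun z => f z (verticalLine c v)⁻¹) U :=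
        hf.left (borelDisc_mono hδ hδd (hin v))
      have h2 : DifferentiableOn ℂ (fun z =>
          scaledRemainder (f z) (fun k => a k z) n (verticalLine c v)) U := by
        unfold scaledRemainder
        refine (differentiableOn_const _).mul (h1.sub ?_)
        refine DifferentiableOn.fun_sum fun k _ => (ha k).mul (differentiableOn_const _)
      exact h2.comp (f := Prod.fst) (by fun_prop) fun p hp => hp.1
    have hint := differentiableOn_integral_of_holomorphic (μ := volume)
      (G := fun (p : ℂ × ℂ) v => scaledRemainder (f p.1) (fun k => a k p.1) n (verticalLine c v) *
        Complex.exp (verticalLine c v * x)) hopen ?_ ?_ ?_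
    · have hint' : DifferentiableOn ℂ (fun z => ∫ v, scaledRemainder (f z) (fun k => a k z) n
          (verticalLine c v) * Complex.exp (verticalLine c v * x)) U :=
        hint.comp (f := fun z : ℂ => (z, (0 : ℂ))) (by fun_prop) fun z hz => ⟨hz, mem_univ _⟩
      unfold borelDeriv
      exact ((ha _).add ((ha _).mul (differentiableOn_const _))).add hint'
    · intro p hp
      exact ((continuous_comp_verticalLine (by linarith) (differentiableOn_scaledRemainder hδ
        (hfz p.1 hp.1) n).continuousOn).mul (by fun_prop)).aestronglyMeasurable
    · exact Eventually.of_forall fun v => (hrem v).mul (differentiableOn_const _)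
    · intro p hp
      refine ⟨1, one_pos, fun v => C * M ^ (n + 3) * ((n + 3).factorial : ℝ) *
        Real.exp (c * x) * (1 + v ^ 2)⁻¹, integrable_inv_one_add_sq.const_mul _,
        Eventually.of_forall fun v q _ hq => ?_⟩
      refine norm_le_inv_one_add_sq hc1 (by positivity) ?_
      rw [norm_mul, norm_exp_verticalLine_mul, mul_div_right_comm]
      have h1 := norm_scaledRemainder_le (hbz q.1 hq.1) n (hne v) (by rw [verticalLine_re]; linarith)
      have hn1 : 1 ≤ ‖verticalLine c v‖ := by
        have := Complex.re_le_norm (verticalLine c v)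
        rw [verticalLine_re] at this; linarith
      have h2 : ‖verticalLine c v‖ ^ 2 ≤ ‖verticalLine c v‖ ^ 3 :=
        pow_le_pow_right₀ hn1 (by norm_num)
      refine mul_le_mul_of_nonneg_right (h1.trans ?_) (Real.exp_pos _).le
      gcongr
  obtain ⟨ε, hε, α, hα1, hα2, hα3, hα4⟩ := exists_holomorphicOnProd_tube (U := U)
    (B := fun n z x => borelDeriv (f z) (fun k => a k z) c n x)
    (C := 6 * C * max M 1 ^ 3 * (2 + Real.pi)) (M := 4 * max M 1) (c := c) hU
    (by have := Real.pi_pos; positivity) (by positivity) (by linarith)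
    (fun n z hz x hx => hasDerivAt_borelDeriv hδ hC hM (hfz z hz) (hbz z hz) hc n hx)
    (fun n z hz x hx => norm_borelDeriv_le hδ hC hM (hfz z hz) (hbz z hz) hc n hx) hhol
  · refine ⟨ε, hε, 1 / c, by positivity, ?_, α, ⟨hα1, hα2, ε, hε, fun z hz ξ _ hξ => ?_⟩, ?_⟩
    · refine le_trans ?_ hδd
      rw [div_le_iff₀ (by linarith), hc]
      have : δ * (1 / δ) = 1 := by field_simp
      nlinarith
    -- The `k`-th derivative at `0` is exactly `a (k + 1)`: the linear term and the inverse Laplace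
    -- integral of the remainder both vanish at `x = 0`.
    · convert hα4 z hz ξ hξ using 3 with k
      rw [formalBorel, borelDeriv]
      obtain ⟨-, -, h3, -⟩ := laplace_scaledRemainder hδ hC hM (hfz z hz) (hbz z hz) hc k
        (ψ := fun x => ∫ v, scaledRemainder (f z) (fun k => a k z) k (verticalLine c v) *
          Complex.exp (verticalLine c v * x)) (fun _ => rfl)
      rw [h3 0 le_rfl]
      simp
    · intro z hz h hh
      have hs : c < (h⁻¹).re := by simpa using mem_borelDisc_iff.1 hh
      have key := laplace_borelDeriv_zero hδ hC hM (hfz z hz) (hbz z hz) hc hs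
      rw [inv_inv] at key
      rw [laplace, show f z h = a 0 z + (f z h - a 0 z) by ring, ← key]
      congr 1
      refine setIntegral_congr_fun measurableSet_Ioi fun x hx => ?_
      rw [hα3 z hz x (le_of_lt hx)]
      congr 2
      ring

/-- Watson's lemma: a holomorphic function is determined by its Gevrey asymptotics along a closed
arc of opening `π`. -/
theorem eqOn_borelDisc_of_gevrey {d : ℝ} {f g : ℂ → ℂ} {a : ℕ → ℂ}
    (hf : DifferentiableOn ℂ f (borelDisc d)) (hg : DifferentiableOn ℂ g (borelDisc d))
    {δ C M : ℝ} (hδ : 0 < δ) (hδd : δ ≤ d) (hC : 0 < C) (hM : 0 < M)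
    (hfa : ∀ n : ℕ, ∀ h ∈ borelDisc δ,
      ‖f h - ∑ k ∈ Finset.range n, a k * h ^ k‖ ≤ C * M ^ n * (n.factorial : ℝ) * ‖h‖ ^ n)
    (hga : ∀ n : ℕ, ∀ h ∈ borelDisc δ,
      ‖g h - ∑ k ∈ Finset.range n, a k * h ^ k‖ ≤ C * M ^ n * (n.factorial : ℝ) * ‖h‖ ^ n) :
    EqOn f g (borelDisc d) := by
  -- The difference, viewed as constant in a dummy `z`, has zero asymptotic series. By Nevanlinna's
  -- theorem it is the Laplace transform of a continuation of the zero series, which vanishes.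
  have hD : HolomorphicOnProd (fun _ h => f h - g h) univ (borelDisc d) :=
    (hf.sub hg).comp (f := Prod.snd) (by fun_prop) fun p hp => hp.2
  have hDa : UniformGevreyAsymptotics univ d (fun _ h => f h - g h) (fun _ _ => 0) := by
    refine ⟨fun k => differentiableOn_const _, δ, hδ, hδd, 2 * C, M, by positivity, hM,
      fun n _ _ h hh => ?_⟩
    have := norm_sub_le (f h - ∑ k ∈ Finset.range n, a k * h ^ k)
      (g h - ∑ k ∈ Finset.range n, a k * h ^ k)
    rw [sub_sub_sub_cancel_right] at this
    simp only [zero_mul, Finset.sum_const_zero, sub_zero]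
    linarith [hfa n h hh, hga n h hh]
  obtain ⟨ε, hε, δ', hδ', hδ'd, α, hα, hlap⟩ := exists_isBorelContinuation isOpen_univ hD hDa
  have h0 : IsBorelContinuation univ ε (fun _ _ => 0) (fun _ _ => 0) := by
    refine ⟨differentiableOn_const _, ⟨1, 1, one_pos, one_pos, fun z _ ξ _ => ?_⟩,
      1, one_pos, fun z _ ξ _ _ => ?_⟩
    · simp only [norm_zero]; positivity
    · simp [formalBorel, hasSum_zero]
  refine eqOn_borelDisc_of_eqOn hδ' hδ'd hf hg fun h hh => ?_
  have := hlap 0 (mem_univ _) h hh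
  have hzero : laplace α 0 h = 0 := by
    rw [laplace, ← integral_zero ℝ ℂ (μ := volume.restrict (Ioi 0))]
    refine setIntegral_congr_fun measurableSet_Ioi fun x hx => ?_
    rw [hα.eq_of_mem hε hε h0 (mem_univ _) (fun _ => rfl) (ofReal_mem_tube hε (le_of_lt hx))
      (ofReal_mem_tube hε (le_of_lt hx)), zero_mul]
  rw [hzero, add_zero] at this
  exact sub_eq_zero.1 this

/-! ### Exponential bounds for convolutions and characteristic integrals -/

/-- This Beta integral is the reason for the normalisation `|ξ| ^ n / n!`: the convolution of the
weights of orders `i` and `j` is exactly the weight of order `i + j + 1`. -/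
lemma integral_one_sub_pow_mul_pow (i j : ℕ) :
    ∫ t in (0 : ℝ)..1, (1 - t) ^ i * t ^ j =
      (i.factorial : ℝ) * j.factorial / (i + j + 1).factorial := by
  have h := Complex.betaIntegral_eq_Gamma_mul_div ((j : ℂ) + 1) ((i : ℂ) + 1)
    (by simp; positivity) (by simp; positivity)
  rw [Complex.Gamma_nat_eq_factorial, Complex.Gamma_nat_eq_factorial,
    show (j : ℂ) + 1 + (i + 1) = ((i + j + 1 : ℕ) : ℂ) + 1 by push_cast; ring,
    Complex.Gamma_nat_eq_factorial, Complex.betaIntegral] at h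
  simp only [add_sub_cancel_right, Complex.cpow_natCast] at h
  have e : ∀ x : ℝ, (x : ℂ) ^ j * (1 - (x : ℂ)) ^ i = (((1 - x) ^ i * x ^ j : ℝ) : ℂ) := by
    intro x; push_cast; ring
  simp_rw [e] at h
  rw [intervalIntegral.integral_ofReal] at h
  apply Complex.ofReal_injective
  rw [h]
  push_cast
  ring

/-- A domain in the `(z, ξ)`-space that contains, with each point, the segments over which
`borelConv` and `charIntegral` integrate. -/
structure IsBorelDomain (W : Set (ℂ × ℂ)) : Prop where
  isOpen : IsOpen W
  mul_mem : ∀ {z ξ : ℂ}, (z, ξ) ∈ W → ∀ {t : ℝ}, 0 ≤ t → t ≤ 1 → (z, (t : ℂ) * ξ) ∈ W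
  char_mem : ∀ {z ξ : ℂ}, (z, ξ) ∈ W → ∀ {t : ℝ}, 0 ≤ t → t ≤ 1 →
    (z + ξ - (t : ℂ) * ξ, (t : ℂ) * ξ) ∈ W

lemma IsBorelDomain.sub_mem {W : Set (ℂ × ℂ)} (hW : IsBorelDomain W) {z ξ : ℂ}
    (h : (z, ξ) ∈ W) {t : ℝ} (h0 : 0 ≤ t) (h1 : t ≤ 1) : (z, ξ - (t : ℂ) * ξ) ∈ W := by
  have := hW.mul_mem h (sub_nonneg.2 h1) (sub_le_self 1 h0)
  convert this using 2
  push_cast; ring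

/-- `f (z, ξ)` is at most `C |ξ| ^ n / n! e ^ (L |ξ|)` on `W`. -/
def HasExpBound (W : Set (ℂ × ℂ)) (L C : ℝ) (n : ℕ) (f : ℂ → ℂ → ℂ) : Prop :=
  ∀ z ξ, (z, ξ) ∈ W → ‖f z ξ‖ ≤ C * (‖ξ‖ ^ n / n.factorial * Real.exp (L * ‖ξ‖))

section ExpBound

variable {W : Set (ℂ × ℂ)} {L C C' : ℝ} {n : ℕ} {f g : ℂ → ℂ → ℂ}

lemma HasExpBound.norm_le_of_norm_le (hf : HasExpBound W L C n f) (hL : 0 ≤ L) (hC : 0 ≤ C)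
    {z ξ : ℂ} (h : (z, ξ) ∈ W) {ρ : ℝ} (hξ : ‖ξ‖ ≤ ρ) :
    ‖f z ξ‖ ≤ C * (ρ ^ n / n.factorial * Real.exp (L * ρ)) := by
  refine (hf z ξ h).trans ?_
  have : 0 ≤ ρ := (norm_nonneg _).trans hξ
  gcongr

lemma HasExpBound.mono (hf : HasExpBound W L C n f) (h : C ≤ C') : HasExpBound W L C' n f :=
  fun z ξ hz => (hf z ξ hz).trans (mul_le_mul_of_nonneg_right h (by positivity))

lemma HasExpBound.add (hf : HasExpBound W L C n f) (hg : HasExpBound W L C' n g) :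
    HasExpBound W L (C + C') n (fun z ξ => f z ξ + g z ξ) := fun z ξ hz => by
  rw [add_mul]
  exact (norm_add_le _ _).trans (add_le_add (hf z ξ hz) (hg z ξ hz))

lemma HasExpBound.sum {ι : Type*} {s : Finset ι} {f : ι → ℂ → ℂ → ℂ} {C : ι → ℝ}
    (hf : ∀ i ∈ s, HasExpBound W L (C i) n (f i)) :
    HasExpBound W L (∑ i ∈ s, C i) n (fun z ξ => ∑ i ∈ s, f i z ξ) := fun z ξ hz => by
  rw [Finset.sum_mul]
  exact (norm_sum_le _ _).trans (Finset.sum_le_sum fun i hi => hf i hi z ξ hz)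

lemma HasExpBound.coeff_mul {b : ℂ → ℂ} (hb : ∀ z ξ, (z, ξ) ∈ W → ‖b z‖ ≤ C')
    (hf : HasExpBound W L C n f) : HasExpBound W L (C' * C) n (fun z ξ => b z * f z ξ) :=
  fun z ξ hz => by
  rw [norm_mul, mul_assoc]
  exact mul_le_mul (hb z ξ hz) (hf z ξ hz) (norm_nonneg _) ((norm_nonneg _).trans (hb z ξ hz))

lemma norm_ofReal_mul_of_nonneg {t : ℝ} (ht : 0 ≤ t) (ξ : ℂ) : ‖(t : ℂ) * ξ‖ = t * ‖ξ‖ := by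
  rw [norm_mul, Complex.norm_real, Real.norm_of_nonneg ht]

lemma norm_sub_ofReal_mul {t : ℝ} (ht : t ≤ 1) (ξ : ℂ) :
    ‖ξ - (t : ℂ) * ξ‖ = (1 - t) * ‖ξ‖ := by
  rw [← norm_ofReal_mul_of_nonneg (sub_nonneg.2 ht)]
  congr 1; push_cast; ring

/-- The lengths of `ξ - t ξ` and `t ξ` add up to `‖ξ‖`, so the exponentials multiply to `e ^ (L
‖ξ‖)` and the powers integrate to a Beta integral. No constant is lost. -/
lemma HasExpBound.borelConv {i j : ℕ} (hW : IsBorelDomain W) (hf : HasExpBound W L C i f)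
    (hg : HasExpBound W L C' j g) :
    HasExpBound W L (C * C') (i + j + 1) (borelConv f g) := by
  intro z ξ hz
  rw [_root_.borelConv, norm_mul]
  have hint : ‖∫ t in (0 : ℝ)..1, f z (ξ - t * ξ) * g z (t * ξ)‖ ≤
      ∫ t in (0 : ℝ)..1, (C * C' * Real.exp (L * ‖ξ‖) * ‖ξ‖ ^ (i + j) /
        (i.factorial * j.factorial)) * ((1 - t) ^ i * t ^ j) := by
    refine intervalIntegral.norm_integral_le_of_norm_le zero_le_one
      (Eventually.of_forall fun t ht => ?_) (Continuous.intervalIntegrable (by fun_prop) _ _)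
    have h1 := hf z _ (hW.sub_mem hz ht.1.le ht.2)
    have h2 := hg z _ (hW.mul_mem hz ht.1.le ht.2)
    rw [norm_sub_ofReal_mul ht.2] at h1
    rw [norm_ofReal_mul_of_nonneg ht.1.le] at h2
    rw [norm_mul]
    refine (mul_le_mul h1 h2 (norm_nonneg _) ((norm_nonneg _).trans h1)).trans (le_of_eq ?_)
    have : Real.exp (L * ‖ξ‖) = Real.exp (L * ((1 - t) * ‖ξ‖)) * Real.exp (L * (t * ‖ξ‖)) := by
      rw [← Real.exp_add]; congr 1; ring
    rw [this, mul_pow, mul_pow, pow_add]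
    field_simp
  refine (mul_le_mul_of_nonneg_left hint (norm_nonneg _)).trans (le_of_eq ?_)
  rw [intervalIntegral.integral_const_mul, integral_one_sub_pow_mul_pow]
  have hi : (i.factorial : ℝ) ≠ 0 := by exact_mod_cast i.factorial_ne_zero
  have hj : (j.factorial : ℝ) ≠ 0 := by exact_mod_cast j.factorial_ne_zero
  rw [pow_succ ‖ξ‖ (i + j)]
  field_simp

/-- The exponential is bounded by its value at the end of the segment, and integrating `t ^ n`
supplies the factor `1 / (n + 1)` of the next factorial. -/
lemma HasExpBound.charIntegral (hW : IsBorelDomain W) (hL : 0 ≤ L) (hC : 0 ≤ C)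
    (hf : HasExpBound W L C n f) : HasExpBound W L C (n + 1) (charIntegral f) := by
  intro z ξ hz
  rw [_root_.charIntegral, norm_neg, norm_mul]
  have hint : ‖∫ t in (0 : ℝ)..1, f (z + ξ - t * ξ) (t * ξ)‖ ≤
      ∫ t in (0 : ℝ)..1, (C * Real.exp (L * ‖ξ‖) * ‖ξ‖ ^ n / n.factorial) *
        ((1 - t) ^ 0 * t ^ n) := by
    refine intervalIntegral.norm_integral_le_of_norm_le zero_le_one
      (Eventually.of_forall fun t ht => ?_) (Continuous.intervalIntegrable (by fun_prop) _ _)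
    have h1 := hf _ _ (hW.char_mem hz ht.1.le ht.2)
    rw [norm_ofReal_mul_of_nonneg ht.1.le] at h1
    refine h1.trans ?_
    have ht0 := ht.1.le
    have : Real.exp (L * (t * ‖ξ‖)) ≤ Real.exp (L * ‖ξ‖) := by
      have : t * ‖ξ‖ ≤ ‖ξ‖ := mul_le_of_le_one_left (norm_nonneg _) ht.2
      gcongr
    calc C * ((t * ‖ξ‖) ^ n / n.factorial * Real.exp (L * (t * ‖ξ‖)))
        ≤ C * ((t * ‖ξ‖) ^ n / n.factorial * Real.exp (L * ‖ξ‖)) := by gcongr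
      _ = _ := by rw [mul_pow]; field_simp
  refine (mul_le_mul_of_nonneg_left hint (norm_nonneg _)).trans (le_of_eq ?_)
  rw [intervalIntegral.integral_const_mul, integral_one_sub_pow_mul_pow]
  have hj : (n.factorial : ℝ) ≠ 0 := by exact_mod_cast n.factorial_ne_zero
  rw [pow_succ ‖ξ‖ n, zero_add, Nat.factorial_zero]
  field_simp
  simp

lemma continuousOn_segment (hW : IsBorelDomain W)
    (hf : ContinuousOn (fun p : ℂ × ℂ => f p.1 p.2) W) :
    ContinuousOn (fun x : (ℂ × ℂ) × ℝ => f x.1.1 ((x.2 : ℂ) * x.1.2)) (W ×ˢ Icc 0 1) :=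
  hf.comp (f := fun x : (ℂ × ℂ) × ℝ => (x.1.1, (x.2 : ℂ) * x.1.2)) (by fun_prop)
    fun x hx => hW.mul_mem (z := x.1.1) (ξ := x.1.2) hx.1 hx.2.1 hx.2.2

lemma continuousOn_segment_sub (hW : IsBorelDomain W)
    (hf : ContinuousOn (fun p : ℂ × ℂ => f p.1 p.2) W) :
    ContinuousOn (fun x : (ℂ × ℂ) × ℝ => f x.1.1 (x.1.2 - (x.2 : ℂ) * x.1.2)) (W ×ˢ Icc 0 1) :=
  hf.comp (f := fun x : (ℂ × ℂ) × ℝ => (x.1.1, x.1.2 - (x.2 : ℂ) * x.1.2)) (by fun_prop)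
    fun x hx => hW.sub_mem (z := x.1.1) (ξ := x.1.2) hx.1 hx.2.1 hx.2.2

lemma continuousOn_segment_char (hW : IsBorelDomain W)
    (hf : ContinuousOn (fun p : ℂ × ℂ => f p.1 p.2) W) :
    ContinuousOn (fun x : (ℂ × ℂ) × ℝ =>
      f (x.1.1 + x.1.2 - (x.2 : ℂ) * x.1.2) ((x.2 : ℂ) * x.1.2)) (W ×ˢ Icc 0 1) :=
  hf.comp (f := fun x : (ℂ × ℂ) × ℝ =>
    (x.1.1 + x.1.2 - (x.2 : ℂ) * x.1.2, (x.2 : ℂ) * x.1.2)) (by fun_prop)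
    fun x hx => hW.char_mem (z := x.1.1) (ξ := x.1.2) hx.1 hx.2.1 hx.2.2

lemma ContinuousOn.borelConv_integrand (hW : IsBorelDomain W)
    (hf : ContinuousOn (fun p : ℂ × ℂ => f p.1 p.2) W)
    (hg : ContinuousOn (fun p : ℂ × ℂ => g p.1 p.2) W) {z ξ : ℂ} (hz : (z, ξ) ∈ W) :
    ContinuousOn (fun t : ℝ => f z (ξ - t * ξ) * g z (t * ξ)) (Icc 0 1) :=
  ((continuousOn_segment_sub hW hf).mul (continuousOn_segment hW hg)).comp
    (f := fun t : ℝ => ((z, ξ), t)) (by fun_prop) fun _ ht => ⟨hz, ht⟩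

lemma ContinuousOn.charIntegral_integrand (hW : IsBorelDomain W)
    (hf : ContinuousOn (fun p : ℂ × ℂ => f p.1 p.2) W) {z ξ : ℂ} (hz : (z, ξ) ∈ W) :
    ContinuousOn (fun t : ℝ => f (z + ξ - t * ξ) (t * ξ)) (Icc 0 1) :=
  (continuousOn_segment_char hW hf).comp
    (f := fun t : ℝ => ((z, ξ), t)) (by fun_prop) fun _ ht => ⟨hz, ht⟩

lemma DifferentiableOn.borelConv (hW : IsBorelDomain W)
    (hf : DifferentiableOn ℂ (fun p : ℂ × ℂ => f p.1 p.2) W)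
    (hg : DifferentiableOn ℂ (fun p : ℂ × ℂ => g p.1 p.2) W) :
    DifferentiableOn ℂ (fun p : ℂ × ℂ => borelConv f g p.1 p.2) W := by
  refine differentiableOn_snd.mul (differentiableOn_intervalIntegral_of_holomorphic hW.isOpen
    ((continuousOn_segment_sub hW hf.continuousOn).mul
      (continuousOn_segment hW hg.continuousOn)) fun t ht => ?_)
  exact (hf.comp (f := fun p : ℂ × ℂ => (p.1, p.2 - (t : ℂ) * p.2)) (by fun_prop)
    fun p hp => hW.sub_mem (z := p.1) (ξ := p.2) hp ht.1 ht.2).mul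
    (hg.comp (f := fun p : ℂ × ℂ => (p.1, (t : ℂ) * p.2)) (by fun_prop)
    fun p hp => hW.mul_mem (z := p.1) (ξ := p.2) hp ht.1 ht.2)

lemma DifferentiableOn.charIntegral (hW : IsBorelDomain W)
    (hf : DifferentiableOn ℂ (fun p : ℂ × ℂ => f p.1 p.2) W) :
    DifferentiableOn ℂ (fun p : ℂ × ℂ => charIntegral f p.1 p.2) W := by
  refine (differentiableOn_snd.mul (differentiableOn_intervalIntegral_of_holomorphic hW.isOpen
    (continuousOn_segment_char hW hf.continuousOn) fun t ht => ?_)).neg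
  exact hf.comp (f := fun p : ℂ × ℂ => (p.1 + p.2 - (t : ℂ) * p.2, (t : ℂ) * p.2)) (by fun_prop)
    fun p hp => hW.char_mem (z := p.1) (ξ := p.2) hp ht.1 ht.2

/-! ### Convolutions and characteristic integrals of series -/

lemma hasSum_intervalIntegral_of_norm_le {F : ℕ → ℝ → ℂ} {G : ℝ → ℂ} {b : ℕ → ℝ}
    (hF : ∀ n, ContinuousOn (F n) (Icc 0 1)) (hb : ∀ n, ∀ t ∈ Icc (0 : ℝ) 1, ‖F n t‖ ≤ b n)
    (hs : Summable b) (hG : ∀ t ∈ Icc (0 : ℝ) 1, HasSum (fun n => F n t) (G t)) :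
    HasSum (fun n => ∫ t in (0 : ℝ)..1, F n t) (∫ t in (0 : ℝ)..1, G t) := by
  have hsub : Set.uIoc (0 : ℝ) 1 ⊆ Icc 0 1 := by
    rw [uIoc_of_le zero_le_one]; exact Ioc_subset_Icc_self
  refine intervalIntegral.hasSum_integral_of_dominated_convergence (fun n _ => b n)
    (fun n => ?_) (fun n => Eventually.of_forall fun t ht => hb n t (hsub ht))
    (Eventually.of_forall fun t _ => hs) intervalIntegrable_const
    (Eventually.of_forall fun t ht => hG t (hsub ht))
  exact ((hF n).mono hsub).aestronglyMeasurable measurableSet_uIoc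

lemma hasSum_charIntegral {f : ℕ → ℂ → ℂ → ℂ} {F : ℂ → ℂ → ℂ} (hW : IsBorelDomain W)
    (hf : ∀ n, ContinuousOn (fun p : ℂ × ℂ => f n p.1 p.2) W) {z ξ : ℂ} (hz : (z, ξ) ∈ W)
    {b : ℕ → ℝ} (hs : Summable b) (hb : ∀ n w η, (w, η) ∈ W → ‖η‖ ≤ ‖ξ‖ → ‖f n w η‖ ≤ b n)
    (hF : ∀ w η, (w, η) ∈ W → HasSum (fun n => f n w η) (F w η)) :
    HasSum (fun n => charIntegral (f n) z ξ) (charIntegral F z ξ) := by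
  refine ((hasSum_intervalIntegral_of_norm_le
    (fun n => (hf n).charIntegral_integrand hW hz) (fun n t ht => hb n _ _
    (hW.char_mem hz ht.1 ht.2) ?_) hs fun t ht => hF _ _ (hW.char_mem hz ht.1 ht.2)).mul_left
    ξ).neg
  rw [norm_ofReal_mul_of_nonneg ht.1]
  exact mul_le_of_le_one_left (norm_nonneg _) ht.2

lemma hasSum_borelConv_right {g : ℕ → ℂ → ℂ → ℂ} {G : ℂ → ℂ → ℂ} (hW : IsBorelDomain W)
    (hf : ContinuousOn (fun p : ℂ × ℂ => f p.1 p.2) W)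
    (hg : ∀ n, ContinuousOn (fun p : ℂ × ℂ => g n p.1 p.2) W) {z ξ : ℂ} (hz : (z, ξ) ∈ W)
    {b : ℕ → ℝ} {B : ℝ} (hs : Summable b)
    (hB : ∀ w η, (w, η) ∈ W → ‖η‖ ≤ ‖ξ‖ → ‖f w η‖ ≤ B)
    (hb : ∀ n w η, (w, η) ∈ W → ‖η‖ ≤ ‖ξ‖ → ‖g n w η‖ ≤ b n)
    (hG : ∀ w η, (w, η) ∈ W → HasSum (fun n => g n w η) (G w η)) :
    HasSum (fun n => borelConv f (g n) z ξ) (borelConv f G z ξ) := by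
  refine (hasSum_intervalIntegral_of_norm_le (b := fun n => B * b n)
    (fun n => hf.borelConv_integrand hW (hg n) hz) (fun n t ht => ?_) (hs.mul_left B)
    fun t ht => (hG _ _ (hW.mul_mem hz ht.1 ht.2)).mul_left _).mul_left ξ
  rw [norm_mul]
  have h1 := hB _ _ (hW.sub_mem hz ht.1 ht.2) (by
    rw [norm_sub_ofReal_mul ht.2]
    exact mul_le_of_le_one_left (norm_nonneg _) (sub_le_self 1 ht.1))
  have h2 := hb n _ _ (hW.mul_mem hz ht.1 ht.2) (by
    rw [norm_ofReal_mul_of_nonneg ht.1]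
    exact mul_le_of_le_one_left (norm_nonneg _) ht.2)
  exact mul_le_mul h1 h2 (norm_nonneg _) ((norm_nonneg _).trans h1)

/-- Cauchy products of series for the convolution. -/
lemma hasSum_borelConv_cauchy {f g : ℕ → ℂ → ℂ → ℂ} {F G : ℂ → ℂ → ℂ} (hW : IsBorelDomain W)
    (hf : ∀ n, ContinuousOn (fun p : ℂ × ℂ => f n p.1 p.2) W)
    (hg : ∀ n, ContinuousOn (fun p : ℂ × ℂ => g n p.1 p.2) W) {z ξ : ℂ} (hz : (z, ξ) ∈ W)
    {b b' : ℕ → ℝ} (hs : Summable b) (hs' : Summable b')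
    (hb : ∀ n w η, (w, η) ∈ W → ‖η‖ ≤ ‖ξ‖ → ‖f n w η‖ ≤ b n)
    (hb' : ∀ n w η, (w, η) ∈ W → ‖η‖ ≤ ‖ξ‖ → ‖g n w η‖ ≤ b' n)
    (hF : ∀ w η, (w, η) ∈ W → HasSum (fun n => f n w η) (F w η))
    (hG : ∀ w η, (w, η) ∈ W → HasSum (fun n => g n w η) (G w η)) :
    HasSum (fun n => ∑ i : Fin (n + 1), borelConv (f i) (g (n - i)) z ξ) (borelConv F G z ξ) := by
  have h1 : ∀ n, ∀ t ∈ Icc (0 : ℝ) 1, ‖f n z (ξ - t * ξ)‖ ≤ b n := fun n t ht =>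
    hb n _ _ (hW.sub_mem hz ht.1 ht.2) (by
      rw [norm_sub_ofReal_mul ht.2]
      exact mul_le_of_le_one_left (norm_nonneg _) (sub_le_self 1 ht.1))
  have h2 : ∀ n, ∀ t ∈ Icc (0 : ℝ) 1, ‖g n z (t * ξ)‖ ≤ b' n := fun n t ht =>
    hb' n _ _ (hW.mul_mem hz ht.1 ht.2) (by
      rw [norm_ofReal_mul_of_nonneg ht.1]
      exact mul_le_of_le_one_left (norm_nonneg _) ht.2)
  have hb0 : ∀ n, 0 ≤ b n := fun n => (norm_nonneg _).trans (h1 n 0 (by simp))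
  have hb0' : ∀ n, 0 ≤ b' n := fun n => (norm_nonneg _).trans (h2 n 0 (by simp))
  have hc := fun i j => (hf i).borelConv_integrand hW (hg j) hz
  have key := (hasSum_intervalIntegral_of_norm_le
    (F := fun n t => ∑ i ∈ Finset.range (n + 1), f i z (ξ - t * ξ) * g (n - i) z (t * ξ))
    (G := fun t => F z (ξ - t * ξ) * G z (t * ξ))
    (b := fun n => ∑ i ∈ Finset.range (n + 1), b i * b' (n - i))
    (fun n => continuousOn_finsetSum _ fun i _ => hc i (n - i)) (fun n t ht => ?_) ?_
    fun t ht => ?_).mul_left ξ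
  · refine key.congr_fun fun n => ?_
    rw [intervalIntegral.integral_finsetSum, Finset.mul_sum, ← Fin.sum_univ_eq_sum_range
      (fun i => ξ * ∫ t in (0 : ℝ)..1, f i z (ξ - t * ξ) * g (n - i) z (t * ξ)) (n + 1)]
    · rfl
    · intro i _
      exact (hc i (n - i)).intervalIntegrable_of_Icc zero_le_one
  · refine (norm_sum_le _ _).trans (Finset.sum_le_sum fun i _ => ?_)
    rw [norm_mul]
    exact mul_le_mul (h1 i t ht) (h2 _ t ht) (norm_nonneg _) (hb0 i)
  · have := summable_norm_sum_mul_range_of_summable_norm hs.norm hs'.norm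
    refine this.congr fun n => Real.norm_of_nonneg ?_
    exact Finset.sum_nonneg fun i _ => mul_nonneg (hb0 i) (hb0' _)
  · have e1 := hF _ _ (hW.sub_mem hz ht.1 ht.2)
    have e2 := hG _ _ (hW.mul_mem hz ht.1 ht.2)
    have n1 : Summable fun n => ‖f n z (ξ - t * ξ)‖ :=
      Summable.of_nonneg_of_le (fun _ => norm_nonneg _) (fun n => h1 n t ht) hs
    have n2 : Summable fun n => ‖g n z (t * ξ)‖ :=
      Summable.of_nonneg_of_le (fun _ => norm_nonneg _) (fun n => h2 n t ht) hs'
    rw [← e1.tsum_eq, ← e2.tsum_eq, tsum_mul_tsum_eq_tsum_sum_range_of_summable_norm n1 n2]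
    exact (summable_norm_sum_mul_range_of_summable_norm n1 n2).of_norm.hasSum

lemma borelConv_sum_right {ι : Type*} {s : Finset ι} {g : ι → ℂ → ℂ → ℂ} (hW : IsBorelDomain W)
    (hf : ContinuousOn (fun p : ℂ × ℂ => f p.1 p.2) W)
    (hg : ∀ i ∈ s, ContinuousOn (fun p : ℂ × ℂ => g i p.1 p.2) W) {z ξ : ℂ} (hz : (z, ξ) ∈ W) :
    borelConv f (fun w η => ∑ i ∈ s, g i w η) z ξ = ∑ i ∈ s, borelConv f (g i) z ξ := by
  simp only [borelConv, Finset.mul_sum]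
  rw [intervalIntegral.integral_finsetSum, Finset.mul_sum]
  exact fun i hi => (hf.borelConv_integrand hW (hg i hi) hz).intervalIntegrable_of_Icc zero_le_one

end ExpBound

/-! ### Successive approximations -/

/-- The quadratic sums in the recursion for `succApprox` reproduce the Catalan recursion, so Catalan
numbers carry the bounds through the induction. They cost only a geometric factor at the end. -/
lemma catalan_le_four_pow (n : ℕ) : catalan n ≤ 4 ^ n := by
  rw [catalan_eq_centralBinom_div]
  refine (Nat.div_le_self _ _).trans ?_
  rw [Nat.centralBinom, show (4 : ℕ) = 2 ^ 2 by norm_num, ← pow_mul]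
  exact Nat.choose_le_two_pow _ _

lemma catalan_le_succ (n : ℕ) : catalan n ≤ catalan (n + 1) := by
  rw [catalan_succ]
  refine le_trans (le_of_eq ?_) (Finset.single_le_sum (f := fun i : Fin n.succ =>
    catalan i * catalan (n - i)) (fun _ _ => Nat.zero_le _) (Finset.mem_univ (Fin.last n)))
  simp

/-- The function to which `charIntegral` is applied in the recursion for `succApprox`. -/
noncomputable def succIntegrand (a : Fin 3 → ℂ → ℂ) (α : Fin 3 → ℂ → ℂ → ℂ) : ℕ → ℂ → ℂ → ℂ
  | 0 => fun z ξ => α 0 z ξ + a 1 z * succApprox a α 0 z ξ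
  | n + 1 => fun z ξ =>
      a 1 z * succApprox a α (n + 1) z ξ
        + borelConv (α 1) (succApprox a α n) z ξ
        + ∑ i : Fin (n + 1),
            a 2 z * borelConv (succApprox a α i.1) (succApprox a α (n - i.1)) z ξ
        + ∑ i : Fin n,
            borelConv (α 2) (borelConv (succApprox a α i.1) (succApprox a α (n - 1 - i.1))) z ξ

lemma succApprox_succ (a : Fin 3 → ℂ → ℂ) (α : Fin 3 → ℂ → ℂ → ℂ) (n : ℕ) :
    succApprox a α (n + 1) = charIntegral (succIntegrand a α n) := by
  cases n with
  | zero => rw [succApprox]; simp only [succIntegrand, succApprox]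
  | succ n => rw [succApprox]; rfl

/-- Bounded holomorphic coefficients `a` and exponentially bounded holomorphic functions `α` on
a domain `W`. -/
structure IsBorelData (W : Set (ℂ × ℂ)) (a : Fin 3 → ℂ → ℂ) (α : Fin 3 → ℂ → ℂ → ℂ) (K L : ℝ) :
    Prop where
  domain : IsBorelDomain W
  K_pos : 0 < K
  L_nonneg : 0 ≤ L
  diff_coeff : ∀ i, DifferentiableOn ℂ (fun p : ℂ × ℂ => a i p.1) W
  diff_shift : DifferentiableOn ℂ (fun p : ℂ × ℂ => a 0 (p.1 + p.2)) W
  norm_coeff : ∀ i z ξ, (z, ξ) ∈ W → ‖a i z‖ ≤ K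
  norm_shift : ∀ z ξ, (z, ξ) ∈ W → ‖a 0 (z + ξ)‖ ≤ K
  diff : ∀ i, DifferentiableOn ℂ (fun p : ℂ × ℂ => α i p.1 p.2) W
  bound : ∀ i, HasExpBound W L K 0 (α i)

/-- The right-hand side of the equation in the Borel plane. -/
noncomputable def borelRHS (a : Fin 3 → ℂ → ℂ) (α : Fin 3 → ℂ → ℂ → ℂ) (Φ : ℂ → ℂ → ℂ)
    (z ξ : ℂ) : ℂ :=
  α 0 z ξ + a 1 z * Φ z ξ + borelConv (α 1) Φ z ξ + a 2 z * borelConv Φ Φ z ξ +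
    borelConv (α 2) (borelConv Φ Φ) z ξ

/-- The sum of the successive approximations. -/
noncomputable def approxSum (a : Fin 3 → ℂ → ℂ) (α : Fin 3 → ℂ → ℂ → ℂ) (z ξ : ℂ) : ℂ :=
  ∑' n, succApprox a α n z ξ

namespace IsBorelData

variable {W : Set (ℂ × ℂ)} {a : Fin 3 → ℂ → ℂ} {α : Fin 3 → ℂ → ℂ → ℂ} {K L : ℝ}

lemma differentiableOn_succIntegrand_of (h : IsBorelData W a α K L) (n : ℕ)
    (ih : ∀ m ≤ n, DifferentiableOn ℂ (fun p : ℂ × ℂ => succApprox a α m p.1 p.2) W) :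
    DifferentiableOn ℂ (fun p : ℂ × ℂ => succIntegrand a α n p.1 p.2) W := by
  cases n with
  | zero => exact (h.diff 0).add ((h.diff_coeff 1).mul (ih 0 le_rfl))
  | succ n =>
    refine ((((h.diff_coeff 1).mul (ih _ le_rfl)).add ((h.diff 1).borelConv h.domain
      (ih n (by omega)))).add (DifferentiableOn.fun_sum fun i _ => (h.diff_coeff 2).mul
        ((ih _ (by omega)).borelConv h.domain (ih _ (by omega))))).add
      (DifferentiableOn.fun_sum fun i _ => (h.diff 2).borelConv h.domain
        ((ih _ (by omega)).borelConv h.domain (ih _ (by omega))))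

lemma differentiableOn_succApprox (h : IsBorelData W a α K L) (n : ℕ) :
    DifferentiableOn ℂ (fun p : ℂ × ℂ => succApprox a α n p.1 p.2) W := by
  induction n using Nat.strong_induction_on with
  | _ n ih =>
    cases n with
    | zero =>
      simp only [succApprox]
      exact h.diff_shift.neg
    | succ n =>
      rw [succApprox_succ]
      exact (h.differentiableOn_succIntegrand_of n fun m hm => ih m (by omega)).charIntegral
        h.domain

lemma differentiableOn_succIntegrand (h : IsBorelData W a α K L) (n : ℕ) :
    DifferentiableOn ℂ (fun p : ℂ × ℂ => succIntegrand a α n p.1 p.2) W :=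
  h.differentiableOn_succIntegrand_of n fun m _ => h.differentiableOn_succApprox m

/-- The powers of `M` in each product combine to `M ^ n`, and the sum of the products of Catalan
numbers is the next Catalan number. -/
lemma hasExpBound_conv_sum (h : IsBorelData W a α K L) {M : ℝ} (n : ℕ)
    (ih : ∀ m ≤ n, HasExpBound W L (K * M ^ m * catalan m) m (succApprox a α m)) :
    HasExpBound W L (K ^ 2 * M ^ n * catalan (n + 1)) (n + 1) (fun z ξ =>
      ∑ i : Fin (n + 1), borelConv (succApprox a α i.1) (succApprox a α (n - i.1)) z ξ) := by
  have : ∀ i ∈ (Finset.univ : Finset (Fin (n + 1))), HasExpBound W L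
      (K ^ 2 * M ^ n * ((catalan i.1 : ℝ) * catalan (n - i.1))) (n + 1)
      (borelConv (succApprox a α i.1) (succApprox a α (n - i.1))) := by
    intro i _
    have hi : i.1 + (n - i.1) = n := by omega
    have := (ih i.1 (by omega)).borelConv h.domain (ih (n - i.1) (by omega))
    rw [hi] at this
    convert this using 1
    have : M ^ n = M ^ i.1 * M ^ (n - i.1) := by rw [← pow_add, hi]
    rw [this]
    ring
  convert HasExpBound.sum this using 1
  rw [← Finset.mul_sum, catalan_succ]
  push_cast
  rfl

/-- In the generic step the two linear terms contribute `K ^ 2` each and the two quadratic ones `K ^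
3` each, times a common factor. The value of `M` is chosen so that `2 K ^ 2 + 2 K ^ 3 ≤ K M`, and so
that `M ≥ 1` makes powers of `M` monotone. -/
lemma hasExpBound_succIntegrand_of (h : IsBorelData W a α K L) {M : ℝ}
    (hM : M = 1 + 2 * K + 2 * K ^ 2) (n : ℕ)
    (ih : ∀ m ≤ n, HasExpBound W L (K * M ^ m * catalan m) m (succApprox a α m)) :
    HasExpBound W L (K * M ^ (n + 1) * catalan (n + 1)) n (succIntegrand a α n) := by
  have hK := h.K_pos
  have hM1 : 1 ≤ M := by nlinarith
  cases n with
  | zero =>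
    have := (h.bound 0).add ((ih 0 le_rfl).coeff_mul (h.norm_coeff 1))
    refine this.mono ?_
    simp only [pow_zero, mul_one, catalan_zero, Nat.cast_one, zero_add, pow_one, catalan_one]
    rw [hM]; nlinarith [pow_pos hK 3]
  | succ n =>
    have b1 := (ih (n + 1) le_rfl).coeff_mul (h.norm_coeff 1)
    have b2 := (h.bound 1).borelConv h.domain (ih n (by omega))
    have b3 := (h.hasExpBound_conv_sum n fun m hm => ih m (by omega)).coeff_mul (h.norm_coeff 2)
    rw [show 0 + n + 1 = n + 1 by ring] at b2
    have hc1 : (catalan (n + 1) : ℝ) ≤ catalan (n + 2) := by exact_mod_cast catalan_le_succ _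
    have hc0 : (catalan n : ℝ) ≤ catalan (n + 1) := by exact_mod_cast catalan_le_succ _
    have hMn : M ^ n ≤ M ^ (n + 1) := pow_le_pow_right₀ hM1 (by omega)
    have b4 : HasExpBound W L (K ^ 3 * M ^ (n + 1) * catalan (n + 2)) (n + 1) (fun z ξ =>
        ∑ i : Fin n, borelConv (α 2)
          (borelConv (succApprox a α i.1) (succApprox a α (n - 1 - i.1))) z ξ) := by
      -- The term with `α 2` enters one step later than the others: for `n = 0` its sum is empty, so
      -- the truncated `n - 1` never occurs.
      cases n with
      | zero =>
        intro z ξ _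
        simp only [Finset.univ_eq_empty, Finset.sum_empty, norm_zero]
        positivity
      | succ n =>
        have b := (h.bound 2).borelConv h.domain
          (h.hasExpBound_conv_sum n fun m hm => ih m (by omega))
        rw [show 0 + (n + 1) + 1 = n + 1 + 1 by ring] at b
        have hMn' : M ^ n ≤ M ^ (n + 1) := pow_le_pow_right₀ hM1 (by omega)
        refine HasExpBound.mono (C := K * (K ^ 2 * M ^ n * catalan (n + 1))) ?_ ?_
        · intro z ξ hz
          beta_reduce
          rw [Nat.add_sub_cancel, ← borelConv_sum_right h.domain (h.diff 2).continuousOn (fun i _ =>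
            ((h.differentiableOn_succApprox _).borelConv h.domain
              (h.differentiableOn_succApprox _)).continuousOn) hz]
          exact b z ξ hz
        · calc K * (K ^ 2 * M ^ n * catalan (n + 1)) = K ^ 3 * M ^ n * catalan (n + 1) := by ring
            _ ≤ K ^ 3 * M ^ (n + 1 + 1) * catalan (n + 1 + 2) := by
              gcongr ?_ * ?_ * ?_
              · exact hMn'.trans hMn
              · exact hc0.trans hc1
    have b3' : HasExpBound W L (K * (K ^ 2 * M ^ n * catalan (n + 1))) (n + 1) (fun z ξ =>
        ∑ i : Fin (n + 1),
          a 2 z * borelConv (succApprox a α i.1) (succApprox a α (n - i.1)) z ξ) := by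
      intro z ξ hz
      beta_reduce
      rw [← Finset.mul_sum]
      exact b3 z ξ hz
    refine (((b1.add b2).add b3').add b4).mono ?_
    have e1 : K * (K * M ^ (n + 1) * catalan (n + 1)) ≤
        K ^ 2 * (M ^ (n + 1) * catalan (n + 2)) := by
      calc _ = K ^ 2 * (M ^ (n + 1) * catalan (n + 1)) := by ring
        _ ≤ _ := by gcongr
    have e2 : K * (K * M ^ n * catalan n) ≤ K ^ 2 * (M ^ (n + 1) * catalan (n + 2)) := by
      calc _ = K ^ 2 * (M ^ n * catalan n) := by ring
        _ ≤ _ := by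
          gcongr ?_ * (?_ * ?_)
          exact hc0.trans hc1
    have e3 : K * (K ^ 2 * M ^ n * catalan (n + 1)) ≤
        K ^ 3 * (M ^ (n + 1) * catalan (n + 2)) := by
      calc _ = K ^ 3 * (M ^ n * catalan (n + 1)) := by ring
        _ ≤ _ := by gcongr
    have e4 : K ^ 3 * M ^ (n + 1) * catalan (n + 2) = K ^ 3 * (M ^ (n + 1) * catalan (n + 2)) := by
      ring
    have e5 : 0 ≤ K * (M ^ (n + 1) * (catalan (n + 2) : ℝ)) := by positivity
    have e6 : K * M ^ (n + 1 + 1) * (catalan (n + 1 + 1) : ℝ) =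
        (1 + 2 * K + 2 * K ^ 2) * (K * (M ^ (n + 1) * (catalan (n + 2) : ℝ))) := by
      rw [← hM]; ring
    rw [e6]
    nlinarith

lemma hasExpBound_succApprox (h : IsBorelData W a α K L) {M : ℝ}
    (hM : M = 1 + 2 * K + 2 * K ^ 2) (n : ℕ) :
    HasExpBound W L (K * M ^ n * catalan n) n (succApprox a α n) := by
  have hK := h.K_pos
  have hM1 : 1 ≤ M := by nlinarith
  induction n using Nat.strong_induction_on with
  | _ n ih =>
    cases n with
    | zero =>
      intro z ξ hz
      simp only [succApprox, norm_neg]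
      refine (h.norm_shift z ξ hz).trans ?_
      have : 1 ≤ Real.exp (L * ‖ξ‖) := Real.one_le_exp (mul_nonneg h.L_nonneg (norm_nonneg _))
      simpa using le_mul_of_one_le_right hK.le this
    | succ n =>
      rw [succApprox_succ]
      exact (h.hasExpBound_succIntegrand_of hM n fun m hm => ih m (by omega)).charIntegral
        h.domain h.L_nonneg (by positivity)

/-- The growth constant in the bounds for the successive approximations. -/
lemma exists_norm_bounds (h : IsBorelData W a α K L) :
    ∃ Q : ℝ, 0 < Q ∧
      (∀ n, HasExpBound W L (K * Q ^ n) n (succApprox a α n)) ∧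
      (∀ n, HasExpBound W L (K * Q * Q ^ n) n (succIntegrand a α n)) ∧
      (∀ n, HasExpBound W L (K ^ 2 * Q * Q ^ n) (n + 1) (fun z ξ =>
        ∑ i : Fin (n + 1), borelConv (succApprox a α i.1) (succApprox a α (n - i.1)) z ξ)) := by
  have hK := h.K_pos
  obtain ⟨M, hM⟩ : ∃ M : ℝ, M = 1 + 2 * K + 2 * K ^ 2 := ⟨_, rfl⟩
  have hM1 : 1 ≤ M := by nlinarith
  have hcat : ∀ n, (catalan n : ℝ) ≤ 4 ^ n := fun n => by exact_mod_cast catalan_le_four_pow n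
  -- The factor `4` absorbs the Catalan numbers.
  refine ⟨4 * M, by positivity, fun n => (h.hasExpBound_succApprox hM n).mono ?_,
    fun n => (h.hasExpBound_succIntegrand_of hM n fun m _ => h.hasExpBound_succApprox hM m).mono ?_,
    fun n => (h.hasExpBound_conv_sum n fun m _ => h.hasExpBound_succApprox hM m).mono ?_⟩
  · calc K * M ^ n * catalan n ≤ K * M ^ n * 4 ^ n := by gcongr; exact hcat n
      _ = _ := by rw [mul_pow]; ring
  · calc K * M ^ (n + 1) * catalan (n + 1) ≤ K * M ^ (n + 1) * 4 ^ (n + 1) := by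
          gcongr; exact hcat _
      _ = _ := by rw [mul_pow]; ring
  · have hMn : M ^ n ≤ M ^ (n + 1) := pow_le_pow_right₀ hM1 (by omega)
    calc K ^ 2 * M ^ n * catalan (n + 1) ≤ K ^ 2 * M ^ (n + 1) * 4 ^ (n + 1) := by
          gcongr; exact hcat _
      _ = _ := by rw [mul_pow]; ring

lemma summable_bound (C Q L ρ : ℝ) :
    Summable fun n : ℕ => C * Q ^ n * (ρ ^ n / n.factorial * Real.exp (L * ρ)) := by
  have := ((Real.summable_pow_div_factorial (Q * ρ)).mul_left C).mul_right (Real.exp (L * ρ))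
  refine this.congr fun n => ?_
  rw [mul_pow]; ring

lemma summable_bound_succ (C Q L ρ : ℝ) :
    Summable fun n : ℕ => C * Q * Q ^ n * (ρ ^ (n + 1) / (n + 1).factorial * Real.exp (L * ρ)) := by
  refine ((summable_bound C Q L ρ).comp_injective (add_left_injective 1)).congr fun n => ?_
  simp only [Function.comp_apply]
  ring

lemma hasSum_approxSum (h : IsBorelData W a α K L) {z ξ : ℂ} (hz : (z, ξ) ∈ W) :
    HasSum (fun n => succApprox a α n z ξ) (approxSum a α z ξ) := by
  obtain ⟨Q, hQ, h1, -⟩ := h.exists_norm_bounds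
  exact (Summable.of_norm_bounded (summable_bound K Q L ‖ξ‖) fun n => h1 n z ξ hz).hasSum

/-- The bounds sum to `K e ^ (L ‖ξ‖)` times the exponential series of `Q ‖ξ‖`, whence `L' = L + Q`.
-/
lemma norm_approxSum_le (h : IsBorelData W a α K L) :
    ∃ L' : ℝ, L ≤ L' ∧ 0 < L' ∧ HasExpBound W L' K 0 (approxSum a α) := by
  obtain ⟨Q, hQ, h1, -⟩ := h.exists_norm_bounds
  refine ⟨L + Q, by linarith, by linarith [h.L_nonneg], fun z ξ hz => ?_⟩
  have hs := (NormedSpace.expSeries_div_hasSum_exp (Q * ‖ξ‖)).mul_left (K * Real.exp (L * ‖ξ‖))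
  refine (tsum_of_norm_bounded hs fun n => (h1 n z ξ hz).trans (le_of_eq ?_)).trans
    (le_of_eq ?_)
  · rw [mul_pow]; ring
  · rw [← Real.exp_eq_exp_ℝ, add_mul, Real.exp_add]; simp; ring

lemma differentiableOn_approxSum (h : IsBorelData W a α K L) :
    DifferentiableOn ℂ (fun p : ℂ × ℂ => approxSum a α p.1 p.2) W := by
  obtain ⟨Q, hQ, h1, -⟩ := h.exists_norm_bounds
  have hK := h.K_pos
  refine differentiableOn_tsum_of_holomorphic h.domain.isOpen h.differentiableOn_succApprox
    fun p hp => ⟨1, one_pos, _, summable_bound K Q L (‖p.2‖ + 1), fun n q hq hqW => ?_⟩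
  refine (h1 n).norm_le_of_norm_le h.L_nonneg (by positivity) hqW ?_
  have h2 : ‖q.2 - p.2‖ ≤ ‖q - p‖ := norm_snd_le (q - p)
  have h3 : ‖q - p‖ < 1 := by simpa [dist_eq_norm] using hq
  have h4 : ‖q.2‖ ≤ ‖p.2‖ + ‖q.2 - p.2‖ := by
    calc ‖q.2‖ = ‖p.2 + (q.2 - p.2)‖ := by congr 1; ring
      _ ≤ _ := norm_add_le _ _
  linarith

lemma differentiableOn_borelRHS (h : IsBorelData W a α K L) :
    DifferentiableOn ℂ (fun p : ℂ × ℂ => borelRHS a α (approxSum a α) p.1 p.2) W := by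
  have hΦ := h.differentiableOn_approxSum
  have hΦΦ := hΦ.borelConv h.domain hΦ
  exact ((((h.diff 0).add ((h.diff_coeff 1).mul hΦ)).add ((h.diff 1).borelConv h.domain hΦ)).add
    ((h.diff_coeff 2).mul hΦΦ)).add ((h.diff 2).borelConv h.domain hΦΦ)

/-- `succIntegrand` sorts the terms obtained by inserting the series into `borelRHS` according to
the order in `ξ` of their bounds: each convolution raises it by one. The rearrangement is licensed
by absolute convergence. -/
lemma hasSum_succIntegrand (h : IsBorelData W a α K L) {z ξ : ℂ} (hz : (z, ξ) ∈ W) :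
    HasSum (fun n => succIntegrand a α n z ξ) (borelRHS a α (approxSum a α) z ξ) := by
  obtain ⟨Q, hQ, h1, -, h3⟩ := h.exists_norm_bounds
  have hK := h.K_pos
  have hφc := fun n => (h.differentiableOn_succApprox n).continuousOn
  have hcc : ∀ n, ContinuousOn (fun p : ℂ × ℂ => ∑ i : Fin (n + 1),
      borelConv (succApprox a α i.1) (succApprox a α (n - i.1)) p.1 p.2) W := fun n =>
    continuousOn_finsetSum _ fun i _ => ((h.differentiableOn_succApprox _).borelConv h.domain
      (h.differentiableOn_succApprox _)).continuousOn
  have bφ : ∀ ξ : ℂ, ∀ n w η, (w, η) ∈ W → ‖η‖ ≤ ‖ξ‖ → ‖succApprox a α n w η‖ ≤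
      K * Q ^ n * (‖ξ‖ ^ n / n.factorial * Real.exp (L * ‖ξ‖)) := fun ξ n w η hw hη =>
    (h1 n).norm_le_of_norm_le h.L_nonneg (by positivity) hw hη
  have bα : ∀ i w η, (w, η) ∈ W → ‖η‖ ≤ ‖ξ‖ → ‖α i w η‖ ≤
      K * (‖ξ‖ ^ 0 / (0 : ℕ).factorial * Real.exp (L * ‖ξ‖)) := fun i w η hw hη =>
    (h.bound i).norm_le_of_norm_le h.L_nonneg hK.le hw hη
  have hΦ : ∀ w η, (w, η) ∈ W → HasSum (fun n => succApprox a α n w η) (approxSum a α w η) :=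
    fun w η hw => h.hasSum_approxSum hw
  have hΦΦ : ∀ w η, (w, η) ∈ W → HasSum (fun n => ∑ i : Fin (n + 1),
      borelConv (succApprox a α i.1) (succApprox a α (n - i.1)) w η)
      (borelConv (approxSum a α) (approxSum a α) w η) := fun w η hw =>
    hasSum_borelConv_cauchy h.domain hφc hφc hw (summable_bound K Q L ‖η‖)
      (summable_bound K Q L ‖η‖) (bφ η) (bφ η) hΦ hΦ
  have s1 := (hΦ z ξ hz).mul_left (a 1 z)
  have s2 := hasSum_borelConv_right h.domain (h.diff 1).continuousOn hφc hz
    (summable_bound K Q L ‖ξ‖) (bα 1) (bφ ξ) hΦ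
  have s3 := (hΦΦ z ξ hz).mul_left (a 2 z)
  have s4 := hasSum_borelConv_right h.domain (h.diff 2).continuousOn hcc hz
    (summable_bound_succ (K ^ 2) Q L ‖ξ‖) (bα 2) (fun n w η hw hη =>
      (h3 n).norm_le_of_norm_le h.L_nonneg (by positivity) hw hη) hΦΦ
  have s4' : HasSum (fun n => ∑ i : Fin n, borelConv (α 2)
      (borelConv (succApprox a α i.1) (succApprox a α (n - 1 - i.1))) z ξ)
      (borelConv (α 2) (borelConv (approxSum a α) (approxSum a α)) z ξ) := by
    -- The `n`-th term of this series is the Cauchy term of index `n - 1`, and vanishes for `n = 0`.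
    rw [← hasSum_nat_add_iff' 1]
    simp only [Finset.range_one, Finset.sum_singleton, Finset.univ_eq_empty, Finset.sum_empty,
      sub_zero]
    refine s4.congr_fun fun n => ?_
    rw [borelConv_sum_right h.domain (h.diff 2).continuousOn (fun i _ =>
      ((h.differentiableOn_succApprox _).borelConv h.domain
        (h.differentiableOn_succApprox _)).continuousOn) hz]
    rfl
  rw [← hasSum_nat_add_iff' 1] at s1 ⊢
  have key := ((s1.add s2).add s3).add s4'
  simp only [Finset.range_one, Finset.sum_singleton] at key ⊢
  convert key using 1
  · ext n
    simp only [succIntegrand, Finset.mul_sum]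
  · simp only [borelRHS, succIntegrand]
    ring

/-- The integral equation for the sum of the successive approximations. -/
lemma approxSum_eq (h : IsBorelData W a α K L) {z ξ : ℂ} (hz : (z, ξ) ∈ W) :
    approxSum a α z ξ =
      -a 0 (z + ξ) + charIntegral (borelRHS a α (approxSum a α)) z ξ := by
  obtain ⟨Q, hQ, -, h2, -⟩ := h.exists_norm_bounds
  have hK := h.K_pos
  have s := hasSum_charIntegral h.domain
    (fun n => (h.differentiableOn_succIntegrand n).continuousOn) hz
    (summable_bound (K * Q) Q L ‖ξ‖) (fun n w η hw hη =>
      (h2 n).norm_le_of_norm_le h.L_nonneg (by positivity) hw hη)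
    (fun w η hw => h.hasSum_succIntegrand hw)
  have t := h.hasSum_approxSum hz
  rw [← hasSum_nat_add_iff' 1] at t
  simp only [Finset.range_one, Finset.sum_singleton, succApprox_succ] at t
  have := t.unique s
  rw [← this]
  simp only [succApprox]
  ring

end IsBorelData

/-! ### The differential equation in the Borel plane -/

/-- Along the characteristic `u ↦ (z + x - u, u)` the integral equation expresses the sum as a
constant minus a primitive of the right-hand side. The fundamental theorem of calculus gives the
derivative in direction `(-1, 1)`. Positive real `x` is all that the Laplace integral sees. -/
lemma IsBorelData.fderiv_approxSum {W : Set (ℂ × ℂ)} {a : Fin 3 → ℂ → ℂ}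
    {α : Fin 3 → ℂ → ℂ → ℂ} {K L : ℝ} (h : IsBorelData W a α K L) {z : ℂ} {x : ℝ} (hx : 0 < x)
    (hz : (z, (x : ℂ)) ∈ W) :
    fderiv ℂ (fun p : ℂ × ℂ => approxSum a α p.1 p.2) (z, (x : ℂ)) (1, 0) -
      fderiv ℂ (fun p : ℂ × ℂ => approxSum a α p.1 p.2) (z, (x : ℂ)) (0, 1) =
      borelRHS a α (approxSum a α) z x := by
  set Φ := approxSum a α with hΦ
  set N := borelRHS a α Φ with hN
  have hid : ∀ y : ℝ, HasDerivAt (fun y : ℝ => (y : ℂ)) 1 y := fun y =>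
    Complex.ofRealCLM.hasDerivAt
  set S : Set ℝ := {y | ((z + x - y, (y : ℂ)) : ℂ × ℂ) ∈ W} with hS
  have hSo : IsOpen S := h.domain.isOpen.preimage (by fun_prop)
  have hIcc : Icc 0 x ⊆ S := by
    intro y hy
    have := h.domain.char_mem hz (div_nonneg hy.1 hx.le) (div_le_one_of_le₀ hy.2 hx.le)
    have e : ((y / x : ℝ) : ℂ) * (x : ℂ) = y := by
      rw [← Complex.ofReal_mul, div_mul_cancel₀ _ hx.ne']
    rwa [e] at this
  have hfc : ContinuousOn (fun y : ℝ => N (z + x - y) y) S :=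
    h.differentiableOn_borelRHS.continuousOn.comp
      (f := fun y : ℝ => ((z + x - y, (y : ℂ)) : ℂ × ℂ)) (by fun_prop) fun y hy => hy
  have hxS : x ∈ S := hIcc (right_mem_Icc.2 hx.le)
  have hint : HasDerivAt (fun u : ℝ => -a 0 (z + x) - ∫ y in (0 : ℝ)..u, N (z + x - y) y)
      (-N (z + x - x) x) x := by
    refine (intervalIntegral.integral_hasDerivAt_right ?_ ?_ ?_).const_sub _
    · exact (hfc.mono hIcc).intervalIntegrable_of_Icc hx.le
    · exact hfc.stronglyMeasurableAtFilter hSo x hxS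
    · exact hfc.continuousAt (hSo.mem_nhds hxS)
  have heq : (fun u : ℝ => Φ (z + x - u) u) =ᶠ[𝓝 x]
      fun u : ℝ => -a 0 (z + x) - ∫ y in (0 : ℝ)..u, N (z + x - y) y := by
    filter_upwards [hSo.mem_nhds hxS] with u hu
    rw [hΦ, h.approxSum_eq hu, charIntegral]
    have := intervalIntegral.smul_integral_comp_mul_right (a := 0) (b := 1)
      (fun y : ℝ => N (z + x - y) y) u
    rw [zero_mul, one_mul, Complex.real_smul] at this
    rw [← this, sub_add_cancel, sub_eq_add_neg]
    simp only [Complex.ofReal_mul]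
    rfl
  have hfd := (h.differentiableOn_approxSum.differentiableAt
    (h.domain.isOpen.mem_nhds hz)).hasFDerivAt
  have hline : HasDerivAt (fun u : ℝ => ((z + x - u, (u : ℂ)) : ℂ × ℂ)) (-1, 1) x :=
    ((hid x).const_sub (z + x)).prodMk (hid x)
  have hz' : (z + x - x, (x : ℂ)) = ((z, (x : ℂ)) : ℂ × ℂ) := by rw [add_sub_cancel_right]
  rw [← hz'] at hfd
  have hcomp := (hfd.restrictScalars ℝ).comp_hasDerivAt x hline
  have huniq := hcomp.unique (hint.congr_of_eventuallyEq heq)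
  rw [hz', add_sub_cancel_right] at huniq
  have e : ((-1, 1) : ℂ × ℂ) = -((1, 0) - (0, 1)) := by ext <;> simp
  rw [ContinuousLinearMap.coe_restrictScalars', e, map_neg, map_sub] at huniq
  exact neg_injective huniq

lemma charIntegral_zero (f : ℂ → ℂ → ℂ) (z : ℂ) : charIntegral f z 0 = 0 := by
  simp [charIntegral]

/-! ### Laplace transforms of functions on the positive half-line -/

/-- The Laplace transform of `g`, as a function of `s = 1 / ħ`. -/
noncomputable def realLaplace (g : ℝ → ℂ) (s : ℂ) : ℂ :=
  ∫ x in Ioi (0 : ℝ), g x * Complex.exp (-(s * x))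

/-- The Laplace integral of `g` converges absolutely at `s`. -/
def LaplaceIntegrable (g : ℝ → ℂ) (s : ℂ) : Prop :=
  IntegrableOn (fun x : ℝ => g x * Complex.exp (-(s * x))) (Ioi 0)

lemma neg_div_eq_neg_inv_mul (x : ℝ) (h : ℂ) : -(x : ℂ) / h = -(h⁻¹ * x) := by
  rw [neg_div, div_eq_inv_mul]

lemma laplace_eq_realLaplace (φ : ℂ → ℂ → ℂ) (z h : ℂ) :
    laplace φ z h = realLaplace (fun x => φ z x) h⁻¹ := by
  simp only [laplace, realLaplace, neg_div_eq_neg_inv_mul]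

lemma norm_exp_neg_mul (s : ℂ) (x : ℝ) : ‖Complex.exp (-(s * x))‖ = Real.exp (-s.re * x) := by
  simp [Complex.norm_exp]

lemma integrableOn_pow_mul_exp_neg_mul (n : ℕ) {b : ℝ} (hb : 0 < b) :
    IntegrableOn (fun x : ℝ => x ^ n * Real.exp (-b * x)) (Ioi 0) := by
  have := integrableOn_rpow_mul_exp_neg_mul_rpow (s := n) (p := 1)
    (by linarith [(Nat.cast_nonneg n : (0 : ℝ) ≤ n)]) one_pos hb
  simpa using this

lemma laplaceIntegrable_of_norm_le {g : ℝ → ℂ} {C L : ℝ} {n : ℕ} {s : ℂ}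
    (hg : ContinuousOn g (Ioi 0))
    (hb : ∀ x : ℝ, 0 < x → ‖g x‖ ≤ C * (x ^ n / n.factorial * Real.exp (L * x)))
    (hs : L < s.re) : LaplaceIntegrable g s := by
  refine Integrable.mono' ((integrableOn_pow_mul_exp_neg_mul n (sub_pos.2 hs)).const_mul
    (C / n.factorial)) ((hg.mul (by fun_prop)).aestronglyMeasurable measurableSet_Ioi) ?_
  refine (ae_restrict_iff' measurableSet_Ioi).2 (Eventually.of_forall fun x hx => ?_)
  rw [norm_mul, norm_exp_neg_mul]
  refine (mul_le_mul_of_nonneg_right (hb x hx) (Real.exp_pos _).le).trans (le_of_eq ?_)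
  have : Real.exp (-(s.re - L) * x) = Real.exp (L * x) * Real.exp (-s.re * x) := by
    rw [← Real.exp_add]; congr 1; ring
  rw [this]; ring

lemma borelConv_ofReal (β γ : ℂ → ℂ → ℂ) (z : ℂ) (x : ℝ) :
    borelConv β γ z x = ∫ y in (0 : ℝ)..x, γ z y * β z ((x - y : ℝ) : ℂ) := by
  have := intervalIntegral.smul_integral_comp_mul_right (a := 0) (b := 1)
    (fun y : ℝ => γ z y * β z ((x - y : ℝ) : ℂ)) x
  rw [zero_mul, one_mul, Complex.real_smul] at this
  rw [← this, borelConv]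
  push_cast
  simp only [mul_comm]

/-- Since `e ^ (-s x) = e ^ (-s y) e ^ (-s (x - y))`, the damped convolution is the convolution of
the damped functions, and Fubini applies. -/
lemma laplace_borelConv {β γ : ℂ → ℂ → ℂ} {z s : ℂ} (hβ : LaplaceIntegrable (fun x => β z x) s)
    (hγ : LaplaceIntegrable (fun x => γ z x) s) :
    LaplaceIntegrable (fun x => borelConv β γ z x) s ∧
    realLaplace (fun x => borelConv β γ z x) s =
      realLaplace (fun x => β z x) s * realLaplace (fun x => γ z x) s := by
  have e : ∀ x : ℝ, borelConv β γ z x * Complex.exp (-(s * x)) =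
      ∫ y in (0 : ℝ)..x, ContinuousLinearMap.mul ℝ ℂ (γ z y * Complex.exp (-(s * y)))
        (β z ((x - y : ℝ) : ℂ) * Complex.exp (-(s * ((x - y : ℝ) : ℂ)))) := by
    intro x
    rw [borelConv_ofReal, ← intervalIntegral.integral_mul_const]
    congr 1
    ext y
    rw [ContinuousLinearMap.mul_apply']
    have : Complex.exp (-(s * x)) =
        Complex.exp (-(s * y)) * Complex.exp (-(s * ((x - y : ℝ) : ℂ))) := by
      rw [← Complex.exp_add]; congr 1; push_cast; ring
    rw [this]; ring
  constructor
  · have := (integrable_posConvolution hγ hβ (ContinuousLinearMap.mul ℝ ℂ)).integrableOn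
      (s := Ioi (0 : ℝ))
    refine this.congr_fun (fun x hx => ?_) measurableSet_Ioi
    rw [posConvolution, indicator_of_mem hx, e]
  · rw [mul_comm]
    have := integral_posConvolution hγ hβ (ContinuousLinearMap.mul ℝ ℂ)
    rw [realLaplace]
    simp_rw [e]
    exact this

lemma realLaplace_add {f g : ℝ → ℂ} {s : ℂ} (hf : LaplaceIntegrable f s)
    (hg : LaplaceIntegrable g s) : LaplaceIntegrable (fun x => f x + g x) s ∧
      realLaplace (fun x => f x + g x) s = realLaplace f s + realLaplace g s := by
  have e : ∀ x : ℝ, (f x + g x) * Complex.exp (-(s * x)) = f x * Complex.exp (-(s * x)) +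
      g x * Complex.exp (-(s * x)) := fun x => add_mul _ _ _
  constructor
  · simp only [LaplaceIntegrable, e]
    exact hf.add hg
  · simp only [realLaplace, e]
    exact integral_add hf hg

lemma realLaplace_const_mul {f : ℝ → ℂ} {s : ℂ} (c : ℂ) (hf : LaplaceIntegrable f s) :
    LaplaceIntegrable (fun x => c * f x) s ∧
      realLaplace (fun x => c * f x) s = c * realLaplace f s := by
  constructor
  · simp only [LaplaceIntegrable, mul_assoc]
    exact hf.const_mul c
  · simp only [realLaplace, mul_assoc]
    exact integral_const_mul _ _

lemma laplace_borelRHS {a : Fin 3 → ℂ → ℂ} {α : Fin 3 → ℂ → ℂ → ℂ} {Φ : ℂ → ℂ → ℂ} {z s : ℂ}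
    (hα : ∀ i, LaplaceIntegrable (fun x => α i z x) s) (hΦ : LaplaceIntegrable (fun x => Φ z x) s) :
    LaplaceIntegrable (fun x => borelRHS a α Φ z x) s ∧
    realLaplace (fun x => borelRHS a α Φ z x) s =
      realLaplace (fun x => α 0 z x) s +
        (a 1 z + realLaplace (fun x => α 1 z x) s) * realLaplace (fun x => Φ z x) s +
        (a 2 z + realLaplace (fun x => α 2 z x) s) * realLaplace (fun x => Φ z x) s ^ 2 := by
  obtain ⟨i1, e1⟩ := realLaplace_const_mul (a 1 z) hΦ
  obtain ⟨i2, e2⟩ := laplace_borelConv (hα 1) hΦ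
  obtain ⟨i3, e3⟩ := laplace_borelConv hΦ hΦ
  obtain ⟨i4, e4⟩ := realLaplace_const_mul (a 2 z) i3
  obtain ⟨i5, e5⟩ := laplace_borelConv (hα 2) i3
  obtain ⟨j1, f1⟩ := realLaplace_add (hα 0) i1
  obtain ⟨j2, f2⟩ := realLaplace_add j1 i2
  obtain ⟨j3, f3⟩ := realLaplace_add j2 i4
  obtain ⟨j4, f4⟩ := realLaplace_add j3 i5
  refine ⟨j4, f4.trans ?_⟩
  rw [f3, f2, f1, e5, e4, e3, e2, e1]
  ring

/-! ### Holomorphy of the Laplace transform -/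

section Laplace

variable {U : Set ℂ} {ε K L d : ℝ} {φ : ℂ → ℂ → ℂ}

lemma continuousOn_ofReal_of_differentiableOn_tube {g : ℂ → ℂ} (hε : 0 < ε)
    (hg : DifferentiableOn ℂ g (tube ε)) : ContinuousOn (fun x : ℝ => g x) (Ici 0) :=
  hg.continuousOn.comp (by fun_prop) fun _ hx => ofReal_mem_tube hε hx

lemma laplaceIntegrable_of_expBound {g : ℂ → ℂ} (hε : 0 < ε) (hg : DifferentiableOn ℂ g (tube ε))
    (hb : ∀ ξ ∈ tube ε, ‖g ξ‖ ≤ K * Real.exp (L * ‖ξ‖)) {s : ℂ} (hs : L < s.re) :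
    LaplaceIntegrable (fun x => g x) s := by
  refine laplaceIntegrable_of_norm_le (C := K) (n := 0)
    ((continuousOn_ofReal_of_differentiableOn_tube hε hg).mono Ioi_subset_Ici_self)
    (fun x hx => ?_) hs
  have := hb x (ofReal_mem_tube hε hx.le)
  rw [Complex.norm_real, Real.norm_of_nonneg hx.le] at this
  simpa using this

lemma norm_mul_exp_le {g : ℂ → ℂ} (hε : 0 < ε)
    (hb : ∀ ξ ∈ tube ε, ‖g ξ‖ ≤ K * Real.exp (L * ‖ξ‖)) {s : ℂ} (hs : L + 1 ≤ s.re) {x : ℝ}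
    (hx : 0 ≤ x) : ‖g x * Complex.exp (-(s * x))‖ ≤ K * Real.exp (-1 * x) := by
  have h1 := hb x (ofReal_mem_tube hε hx)
  have hK : 0 ≤ K := by
    have := (norm_nonneg _).trans h1
    exact nonneg_of_mul_nonneg_left this (Real.exp_pos _)
  rw [Complex.norm_real, Real.norm_of_nonneg hx] at h1
  rw [norm_mul, norm_exp_neg_mul]
  calc ‖g x‖ * Real.exp (-s.re * x) ≤ K * Real.exp (L * x) * Real.exp (-s.re * x) := by gcongr
    _ = K * Real.exp (L * x + -s.re * x) := by rw [mul_assoc, Real.exp_add]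
    _ ≤ K * Real.exp (-1 * x) := by gcongr; nlinarith

/-- The margin `L + 1 ≤ 1 / d` gives the majorant `K e ^ (-x)` throughout the Borel disc.
Integrability of the `z`-derivative comes with it and is needed to transform the differential
equation term by term. -/
lemma hasFDerivAt_laplace (hU : IsOpen U) (hε : 0 < ε) (hφ : HolomorphicOnProd φ U (tube ε))
    (hb : ∀ z ∈ U, ∀ ξ ∈ tube ε, ‖φ z ξ‖ ≤ K * Real.exp (L * ‖ξ‖)) (hd : 0 < d)
    (hdL : L + 1 ≤ 1 / d) {z h : ℂ} (hz : z ∈ U) (hh : h ∈ borelDisc d) :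
    DifferentiableAt ℂ (fun p : ℂ × ℂ => laplace φ p.1 p.2) (z, h) ∧
    LaplaceIntegrable (fun x => fderiv ℂ (fun p : ℂ × ℂ => φ p.1 p.2) (z, (x : ℂ)) (1, 0)) h⁻¹ ∧
    deriv (fun w => laplace φ w h) z =
      realLaplace (fun x => fderiv ℂ (fun p : ℂ × ℂ => φ p.1 p.2) (z, (x : ℂ)) (1, 0)) h⁻¹ := by
  have hopen : IsOpen (U ×ˢ borelDisc d) := hU.prod (isOpen_borelDisc hd)
  obtain ⟨R, hR, hsub⟩ := Metric.isOpen_iff.1 hopen (z, h) ⟨hz, hh⟩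
  have hre : ∀ q ∈ U ×ˢ borelDisc d, L + 1 ≤ (q.2⁻¹).re := fun q hq =>
    hdL.trans (mem_borelDisc_iff.1 hq.2).le
  have hφx : ∀ x : ℝ, 0 ≤ x → DifferentiableOn ℂ (fun w => φ w x) U := fun x hx =>
    hφ.left (ofReal_mem_tube hε hx)
  have hae : ∀ {p : ℝ → Prop}, (∀ x : ℝ, 0 < x → p x) →
      ∀ᵐ x ∂(volume.restrict (Ioi (0 : ℝ))), p x := fun hp =>
    (ae_restrict_iff' measurableSet_Ioi).2 (Eventually.of_forall fun x hx => hp x hx)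
  have hGd : ∀ x : ℝ, 0 < x → DifferentiableOn ℂ (fun q : ℂ × ℂ =>
      φ q.1 x * Complex.exp (-(q.2⁻¹ * x))) (U ×ˢ borelDisc d) := by
    intro x hx
    have h1 : DifferentiableOn ℂ (fun q : ℂ × ℂ => φ q.1 x) (U ×ˢ borelDisc d) :=
      (hφx x hx.le).comp (f := Prod.fst) (by fun_prop) fun q hq => hq.1
    have h2 : DifferentiableOn ℂ (fun q : ℂ × ℂ => q.2⁻¹) (U ×ˢ borelDisc d) :=
      differentiableOn_snd.inv fun q hq => ne_zero_of_mem_borelDisc hd hq.2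
    exact h1.mul ((h2.mul_const _).neg.cexp)
  have key := hasFDerivAt_integral_of_holomorphic (μ := volume.restrict (Ioi (0 : ℝ)))
    (G := fun (q : ℂ × ℂ) (x : ℝ) => φ q.1 x * Complex.exp (-(q.2⁻¹ * x))) hR
    (b := fun x => K * Real.exp (-1 * x)) ?_ (hae fun x hx => (hGd x hx).mono hsub) ?_
    ((exp_neg_integrableOn_Ioi 0 one_pos).const_mul K)
  · have hlap : (fun q : ℂ × ℂ => ∫ x in Ioi (0 : ℝ), φ q.1 x * Complex.exp (-(q.2⁻¹ * x))) =
        fun p : ℂ × ℂ => laplace φ p.1 p.2 := by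
      ext q; rw [laplace_eq_realLaplace, realLaplace]
    rw [hlap] at key
    have hdir : ∀ x : ℝ, 0 < x → fderiv ℂ (fun q : ℂ × ℂ =>
        φ q.1 x * Complex.exp (-(q.2⁻¹ * x))) (z, h) (1, 0) =
        fderiv ℂ (fun p : ℂ × ℂ => φ p.1 p.2) (z, (x : ℂ)) (1, 0) *
          Complex.exp (-(h⁻¹ * x)) := by
      intro x hx
      have h1 := ((hGd x hx).differentiableAt (hopen.mem_nhds (show (z, h) ∈ U ×ˢ borelDisc d from ⟨hz, hh⟩))).hasFDerivAt
      have h2 := (hφ.differentiableAt ((hU.prod (isOpen_tube ε)).mem_nhds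
        ⟨hz, ofReal_mem_tube hε hx.le⟩ : U ×ˢ tube ε ∈ 𝓝 ((z, (x : ℂ)) : ℂ × ℂ))).hasFDerivAt
      have l1 : HasDerivAt (fun w : ℂ => ((w, h) : ℂ × ℂ)) (1, 0) z :=
        (hasDerivAt_id z).prodMk (hasDerivAt_const z h)
      have l2 : HasDerivAt (fun w : ℂ => ((w, (x : ℂ)) : ℂ × ℂ)) (1, 0) z :=
        (hasDerivAt_id z).prodMk (hasDerivAt_const z (x : ℂ))
      exact (h1.comp_hasDerivAt z l1).unique
        ((h2.comp_hasDerivAt z l2).mul_const (Complex.exp (-(h⁻¹ * x))))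
    refine ⟨key.2.differentiableAt, ?_, ?_⟩
    · refine (key.1.apply_continuousLinearMap (1, 0)).congr (hae hdir)
    · have l1 : HasDerivAt (fun w : ℂ => ((w, h) : ℂ × ℂ)) (1, 0) z :=
        (hasDerivAt_id z).prodMk (hasDerivAt_const z h)
      refine (key.2.comp_hasDerivAt z l1).deriv.trans ?_
      rw [ContinuousLinearMap.integral_apply key.1, realLaplace]
      exact integral_congr_ae (hae hdir)
  · intro q hq
    have := (continuousOn_ofReal_of_differentiableOn_tube hε
      (hφ.right (hsub hq).1)).mono Ioi_subset_Ici_self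
    exact (this.mul (by fun_prop)).aestronglyMeasurable measurableSet_Ioi
  · exact hae fun x hx q hq =>
      norm_mul_exp_le hε (hb q.1 (hsub hq).1) (hre q (hsub hq)) hx.le

lemma holomorphicOnProd_laplace (hU : IsOpen U) (hε : 0 < ε) (hφ : HolomorphicOnProd φ U (tube ε))
    (hb : ∀ z ∈ U, ∀ ξ ∈ tube ε, ‖φ z ξ‖ ≤ K * Real.exp (L * ‖ξ‖)) (hd : 0 < d)
    (hdL : L + 1 ≤ 1 / d) : HolomorphicOnProd (laplace φ) U (borelDisc d) := fun _ hp =>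
  (hasFDerivAt_laplace hU hε hφ hb hd hdL hp.1 hp.2).1.differentiableWithinAt

end Laplace

/-! ### The exact solution -/

/-- The Laplace transform of the sum of the successive approximations solves the Riccati
equation. -/
theorem IsBorelData.solvesRiccati {W : Set (ℂ × ℂ)} {a : Fin 3 → ℂ → ℂ}
    {α : Fin 3 → ℂ → ℂ → ℂ} {K L L' ε d : ℝ} (h : IsBorelData W a α K L) {U : Set ℂ}
    (hU : IsOpen U) (hε : 0 < ε) (hUW : U ×ˢ tube ε ⊆ W) (hL : L ≤ L')
    (hΦ : HasExpBound W L' K 0 (approxSum a α)) (hd : 0 < d) (hdL : L' + 1 ≤ 1 / d)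
    {A : Fin 3 → ℂ → ℂ → ℂ}
    (hA : ∀ i, ∀ z ∈ U, ∀ h ∈ borelDisc d, A i z h = a i z + laplace (α i) z h) :
    SolvesRiccati A U (borelDisc d) (laplace (approxSum a α)) := by
  intro z hz h' hh
  have hmem : ∀ x : ℝ, 0 ≤ x → (z, (x : ℂ)) ∈ W := fun x hx => hUW ⟨hz, ofReal_mem_tube hε hx⟩
  have hhol : HolomorphicOnProd (approxSum a α) U (tube ε) := h.differentiableOn_approxSum.mono hUW
  have hbd : ∀ z ∈ U, ∀ ξ ∈ tube ε, ‖approxSum a α z ξ‖ ≤ K * Real.exp (L' * ‖ξ‖) := by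
    intro z hz ξ hξ
    simpa using hΦ z ξ (hUW ⟨hz, hξ⟩)
  obtain ⟨-, hint1, hderiv⟩ := hasFDerivAt_laplace hU hε hhol hbd hd hdL hz hh
  have hne := ne_zero_of_mem_borelDisc hd hh
  obtain ⟨s, hs⟩ : ∃ s : ℂ, s = h'⁻¹ := ⟨_, rfl⟩
  have hre : L' + 1 < s.re := by rw [hs]; exact hdL.trans_lt (mem_borelDisc_iff.1 hh)
  have hiΦ : LaplaceIntegrable (fun x => approxSum a α z x) s :=
    laplaceIntegrable_of_expBound hε (hhol.right hz) (hbd z hz) (by linarith)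
  have hiα : ∀ i, LaplaceIntegrable (fun x => α i z x) s := by
    intro i
    refine laplaceIntegrable_of_expBound (K := K) (L := L) hε (HolomorphicOnProd.right
      ((h.diff i).mono hUW) hz) (fun ξ hξ => ?_) (by linarith)
    simpa using h.bound i z ξ (hUW ⟨hz, hξ⟩)
  obtain ⟨hiN, hN⟩ := laplace_borelRHS (a := a) hiα hiΦ
  rw [← hs] at hint1 hderiv
  set D1 := fun x : ℝ => fderiv ℂ (fun p : ℂ × ℂ => approxSum a α p.1 p.2) (z, (x : ℂ)) (1, 0)
    with hD1
  set N := fun x : ℝ => borelRHS a α (approxSum a α) z x with hNdef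
  -- The integrand is the derivative of `Φ(z, x) e ^ (-s x)`, where `Φ` is the sum, because `∂_ξ Φ =
  -- ∂_z Φ - N`. The boundary term at `0` is the initial value `-a 0 z`, and the one at infinity
  -- vanishes.
  have hparts : ∫ x in Ioi (0 : ℝ), (D1 x * Complex.exp (-(s * x)) - N x * Complex.exp (-(s * x)) -
      s * (approxSum a α z x * Complex.exp (-(s * x)))) = 0 - (-a 0 z) := by
    have h0 : approxSum a α z ((0 : ℝ) : ℂ) * Complex.exp (-(s * ((0 : ℝ) : ℂ))) = -a 0 z := by
      rw [h.approxSum_eq (hmem 0 le_rfl)]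
      simp [charIntegral_zero]
    rw [← h0]
    refine integral_Ioi_of_hasDerivAt_of_tendsto
      (f := fun x : ℝ => approxSum a α z x * Complex.exp (-(s * x))) ?_ ?_ ?_ ?_
    · refine ContinuousWithinAt.mul ?_ (Continuous.continuousWithinAt (by fun_prop))
      exact continuousOn_ofReal_of_differentiableOn_tube hε (hhol.right hz) 0 self_mem_Ici
    · intro x hx
      have hfd := (h.differentiableOn_approxSum.differentiableAt
        (h.domain.isOpen.mem_nhds (hmem x (le_of_lt hx)))).hasFDerivAt
      have hid : HasDerivAt (fun y : ℝ => (y : ℂ)) 1 x := Complex.ofRealCLM.hasDerivAt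
      have hline : HasDerivAt (fun u : ℝ => ((z, (u : ℂ)) : ℂ × ℂ)) (0, 1) x :=
        (hasDerivAt_const x z).prodMk hid
      have h1 := (hfd.restrictScalars ℝ).comp_hasDerivAt x hline
      have h2 := h1.mul ((hid.const_mul s).neg.cexp)
      refine h2.congr_deriv ?_
      have hpde := h.fderiv_approxSum hx (hmem x (le_of_lt hx))
      simp only [ContinuousLinearMap.coe_restrictScalars', Function.comp_apply, hD1, hNdef,
        ← hpde, Pi.neg_apply]
      ring
    · exact (hint1.sub hiN).sub (hiΦ.const_mul s)
    · have hexp : Tendsto (fun x : ℝ => K * Real.exp (-1 * x)) atTop (𝓝 0) := by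
        have : Tendsto (fun x : ℝ => Real.exp (-1 * x)) atTop (𝓝 0) := by
          simp only [neg_mul, one_mul]; exact Real.tendsto_exp_neg_atTop_nhds_zero
        simpa using this.const_mul K
      refine squeeze_zero_norm' ?_ hexp
      filter_upwards [eventually_ge_atTop 0] with x hx
      exact norm_mul_exp_le hε (hbd z hz) hre.le hx
  have hsplit : ∫ x in Ioi (0 : ℝ), (D1 x * Complex.exp (-(s * x)) -
      N x * Complex.exp (-(s * x)) - s * (approxSum a α z x * Complex.exp (-(s * x)))) =
      realLaplace D1 s - realLaplace N s - s * realLaplace (fun x => approxSum a α z x) s := by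
    have i1 : IntegrableOn (fun x : ℝ => D1 x * Complex.exp (-(s * x)) -
      N x * Complex.exp (-(s * x))) (Ioi 0) := hint1.sub hiN
    rw [integral_sub i1 (hiΦ.const_mul s), integral_sub hint1 hiN, integral_const_mul]
    rfl
  rw [hsplit, hN, ← hderiv] at hparts
  rw [hA 0 z hz h' hh, hA 1 z hz h' hh, hA 2 z hz h' hh]
  simp only [laplace_eq_realLaplace, ← hs] at hparts ⊢
  have hsh : h' * s = 1 := by rw [hs, mul_inv_cancel₀ hne]
  linear_combination h' * hparts + realLaplace (fun x => approxSum a α z x) s * hsh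

/-! ### Gevrey asymptotics of Laplace transforms -/

lemma differentiableOn_iteratedDeriv {g : ℂ → ℂ} {V : Set ℂ} (hV : IsOpen V)
    (hg : DifferentiableOn ℂ g V) (n : ℕ) : DifferentiableOn ℂ (iteratedDeriv n g) V := by
  induction n with
  | zero => simpa
  | succ n ih => rw [iteratedDeriv_succ]; exact ih.deriv hV

/-- Cauchy's estimate on circles of radius `ε / 2` about real points: the thickness of the tube
gives the Gevrey constant `2 / ε`. -/
lemma norm_iteratedDeriv_ofReal_le {g : ℂ → ℂ} {ε K L : ℝ} (hε : 0 < ε) (hL : 0 ≤ L)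
    (hg : DifferentiableOn ℂ g (tube ε)) (hb : ∀ ξ ∈ tube ε, ‖g ξ‖ ≤ K * Real.exp (L * ‖ξ‖))
    (n : ℕ) {x : ℝ} (hx : 0 ≤ x) :
    ‖iteratedDeriv n g x‖ ≤
      (K * Real.exp (L * ε)) * (2 / ε) ^ n * n.factorial * Real.exp (L * x) := by
  have hsub : Metric.closedBall (x : ℂ) (ε / 2) ⊆ tube ε := fun w hw =>
    mem_tube_iff.2 ⟨x, hx, by
      rw [Metric.mem_closedBall, dist_eq_norm] at hw; linarith⟩
  have hK : 0 ≤ K := by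
    have := (norm_nonneg _).trans (hb 0 (zero_mem_tube hε))
    exact nonneg_of_mul_nonneg_left this (Real.exp_pos _)
  have := Complex.norm_iteratedDeriv_le_of_forall_mem_sphere_norm_le (c := (x : ℂ)) (f := g)
    (C := K * Real.exp (L * (x + ε))) n (half_pos hε)
    (DifferentiableOn.diffContOnCl (hg.mono (by
      rw [closure_ball _ (half_pos hε).ne']; exact hsub)))
    (fun w hw => by
      refine (hb w (hsub (Metric.sphere_subset_closedBall hw))).trans ?_
      have h1 : ‖w‖ ≤ x + ε := by
        rw [mem_sphere_iff_norm] at hw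
        calc ‖w‖ = ‖(x : ℂ) + (w - x)‖ := by congr 1; ring
          _ ≤ ‖(x : ℂ)‖ + ‖w - x‖ := norm_add_le _ _
          _ = x + ε / 2 := by rw [hw, Complex.norm_real, Real.norm_of_nonneg hx]
          _ ≤ x + ε := by linarith
      gcongr)
  refine this.trans (le_of_eq ?_)
  rw [mul_add, Real.exp_add, div_pow, div_pow]
  field_simp

lemma realLaplace_eq_add_deriv {g : ℂ → ℂ} {ε K L : ℝ} (hε : 0 < ε)
    (hg : DifferentiableOn ℂ g (tube ε)) (hb : ∀ x : ℝ, 0 ≤ x → ‖g x‖ ≤ K * Real.exp (L * x))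
    {s : ℂ} (hs : L < s.re) (hs0 : s ≠ 0) (hi : LaplaceIntegrable (fun x => g x) s)
    (hi' : LaplaceIntegrable (fun x => deriv g x) s) :
    realLaplace (fun x => g x) s = g 0 * s⁻¹ + s⁻¹ * realLaplace (fun x => deriv g x) s := by
  have hparts : ∫ x in Ioi (0 : ℝ), (deriv g x * Complex.exp (-(s * x)) -
      s * (g x * Complex.exp (-(s * x)))) = 0 - g 0 := by
    have h0 : g ((0 : ℝ) : ℂ) * Complex.exp (-(s * ((0 : ℝ) : ℂ))) = g 0 := by simp
    rw [← h0]
    refine integral_Ioi_of_hasDerivAt_of_tendsto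
      (f := fun x : ℝ => g x * Complex.exp (-(s * x))) ?_ ?_ (hi'.sub (hi.const_mul s)) ?_
    · refine ContinuousWithinAt.mul ?_ (Continuous.continuousWithinAt (by fun_prop))
      exact continuousOn_ofReal_of_differentiableOn_tube hε hg 0 self_mem_Ici
    · intro x hx
      have hfd := (hg.differentiableAt ((isOpen_tube ε).mem_nhds
        (ofReal_mem_tube hε (le_of_lt hx)))).hasDerivAt
      have hid : HasDerivAt (fun y : ℝ => (y : ℂ)) 1 x := Complex.ofRealCLM.hasDerivAt
      refine (hfd.comp_ofReal.mul ((hid.const_mul s).neg.cexp)).congr_deriv ?_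
      simp only [Pi.neg_apply]
      ring
    · have hexp : Tendsto (fun x : ℝ => K * Real.exp (-(s.re - L) * x)) atTop (𝓝 0) := by
        have := tendsto_rpow_mul_exp_neg_mul_atTop_nhds_zero 0 (s.re - L) (sub_pos.2 hs)
        simpa using this.const_mul K
      refine squeeze_zero_norm' ?_ hexp
      filter_upwards [eventually_ge_atTop 0] with x hx
      rw [norm_mul, norm_exp_neg_mul]
      refine (mul_le_mul_of_nonneg_right (hb x hx) (Real.exp_pos _).le).trans (le_of_eq ?_)
      rw [mul_assoc, ← Real.exp_add]
      congr 2; ring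
  rw [integral_sub hi' (hi.const_mul s), integral_const_mul] at hparts
  have h2 : realLaplace (fun x => deriv g x) s - s * realLaplace (fun x => g x) s = 0 - g 0 :=
    hparts
  have h3 := mul_inv_cancel₀ hs0
  linear_combination (-s⁻¹) * h2 - realLaplace (fun x => g x) s * h3

lemma laplaceIntegrable_iteratedDeriv {g : ℂ → ℂ} {ε K L : ℝ} (hε : 0 < ε) (hL : 0 ≤ L)
    (hg : DifferentiableOn ℂ g (tube ε)) (hb : ∀ ξ ∈ tube ε, ‖g ξ‖ ≤ K * Real.exp (L * ‖ξ‖))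
    (n : ℕ) {s : ℂ} (hs : L < s.re) : LaplaceIntegrable (fun x => iteratedDeriv n g x) s := by
  refine laplaceIntegrable_of_norm_le (C := (K * Real.exp (L * ε)) * (2 / ε) ^ n * n.factorial)
    (n := 0) ((continuousOn_ofReal_of_differentiableOn_tube hε (differentiableOn_iteratedDeriv
      (isOpen_tube ε) hg n)).mono Ioi_subset_Ici_self) (fun x hx => ?_) hs
  simpa using norm_iteratedDeriv_ofReal_le hε hL hg hb n hx.le

/-- Repeated integration by parts: the boundary terms at `0` form the asymptotic series, and the
last integral is the remainder. -/
lemma realLaplace_eq_sum {g : ℂ → ℂ} {ε K L : ℝ} (hε : 0 < ε) (hL : 0 ≤ L)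
    (hg : DifferentiableOn ℂ g (tube ε)) (hb : ∀ ξ ∈ tube ε, ‖g ξ‖ ≤ K * Real.exp (L * ‖ξ‖))
    {s : ℂ} (hs : L < s.re) (n : ℕ) :
    realLaplace (fun x => g x) s = ∑ k ∈ Finset.range n, iteratedDeriv k g 0 * s⁻¹ ^ (k + 1) +
      s⁻¹ ^ n * realLaplace (fun x => iteratedDeriv n g x) s := by
  have hs0 : s ≠ 0 := by rintro rfl; simp at hs; linarith
  induction n with
  | zero => simp
  | succ n ih =>
    have h1 := realLaplace_eq_add_deriv hε (differentiableOn_iteratedDeriv (isOpen_tube ε) hg n)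
      (fun x hx => norm_iteratedDeriv_ofReal_le hε hL hg hb n hx) hs hs0
      (laplaceIntegrable_iteratedDeriv hε hL hg hb n hs)
      (by simpa only [iteratedDeriv_succ] using
        laplaceIntegrable_iteratedDeriv hε hL hg hb (n + 1) hs)
    rw [ih, Finset.sum_range_succ, h1, iteratedDeriv_succ]
    ring

lemma norm_realLaplace_iteratedDeriv_le {g : ℂ → ℂ} {ε K L : ℝ} (hε : 0 < ε) (hL : 0 ≤ L)
    (hg : DifferentiableOn ℂ g (tube ε)) (hb : ∀ ξ ∈ tube ε, ‖g ξ‖ ≤ K * Real.exp (L * ‖ξ‖))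
    {s : ℂ} (hs : L + 1 ≤ s.re) (n : ℕ) :
    ‖realLaplace (fun x => iteratedDeriv n g x) s‖ ≤
      (K * Real.exp (L * ε)) * (2 / ε) ^ n * n.factorial := by
  have hK : 0 ≤ K := by
    have := (norm_nonneg _).trans (hb 0 (zero_mem_tube hε))
    exact nonneg_of_mul_nonneg_left this (Real.exp_pos _)
  have hint := (exp_neg_integrableOn_Ioi 0 one_pos).const_mul
    ((K * Real.exp (L * ε)) * (2 / ε) ^ n * n.factorial)
  refine (norm_integral_le_of_norm_le hint ?_).trans (le_of_eq ?_)
  · refine (ae_restrict_iff' measurableSet_Ioi).2 (Eventually.of_forall fun x hx => ?_)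
    rw [norm_mul, norm_exp_neg_mul]
    refine (mul_le_mul_of_nonneg_right (norm_iteratedDeriv_ofReal_le hε hL hg hb n
      (le_of_lt hx)) (Real.exp_pos _).le).trans ?_
    rw [mul_assoc _ (Real.exp (L * x)), ← Real.exp_add]
    have hx0 : 0 < x := hx
    gcongr
    nlinarith
  · rw [integral_const_mul]
    simp only [neg_mul, one_mul, integral_exp_neg_Ioi_zero, mul_one]

/-- The coefficients of the asymptotic series of the Laplace transform of `φ`. -/
noncomputable def laplaceCoeff (φ : ℂ → ℂ → ℂ) : ℕ → ℂ → ℂ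
  | 0 => fun _ => 0
  | k + 1 => fun z => iteratedDeriv k (φ z) 0

/-- Coefficients of a uniform asymptotic series of a holomorphic function are holomorphic. -/
lemma holomorphicCoeffs_of_gevrey {U : Set ℂ} (hU : IsOpen U) {d δ C M : ℝ} {f : ℂ → ℂ → ℂ}
    {c : ℕ → ℂ → ℂ} (hf : HolomorphicOnProd f U (borelDisc d)) (hδ : 0 < δ) (hδd : δ ≤ d)
    (hb : ∀ n : ℕ, ∀ z ∈ U, ∀ h ∈ borelDisc δ,
      ‖f z h - ∑ k ∈ Finset.range n, c k z * h ^ k‖ ≤ C * M ^ n * (n.factorial : ℝ) * ‖h‖ ^ n) :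
    HolomorphicCoeffs U c := by
  intro n
  induction n using Nat.strong_induction_on with
  | _ n ih =>
    have hev : ∀ᶠ x : ℝ in 𝓝[>] 0, 0 < x ∧ x < δ := Ioo_mem_nhdsGT hδ
    -- The coefficient is the uniform limit of the rescaled remainders along the positive axis, and
    -- these are holomorphic by induction.
    have hlim : TendstoUniformlyOn (fun (x : ℝ) z =>
        (f z x - ∑ k ∈ Finset.range n, c k z * (x : ℂ) ^ k) / (x : ℂ) ^ n) (c n) (𝓝[>] 0) U := by
      rw [Metric.tendstoUniformlyOn_iff]
      intro e he
      set B := C * M ^ (n + 1) * ((n + 1).factorial : ℝ)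
      have hsmall : ∀ᶠ x : ℝ in 𝓝[>] 0, B * x < e := by
        have : Tendsto (fun x : ℝ => B * x) (𝓝[>] 0) (𝓝 (B * 0)) :=
          ((continuous_const.mul continuous_id).tendsto 0).mono_left nhdsWithin_le_nhds
        rw [mul_zero] at this
        exact this.eventually_lt_const he
      filter_upwards [hev, hsmall] with x hx hxe z hz
      have hx0 : (x : ℂ) ≠ 0 := by exact_mod_cast hx.1.ne'
      have h1 := hb (n + 1) z hz x (ofReal_mem_borelDisc hx.1 hx.2)
      rw [Finset.sum_range_succ, Complex.norm_real, Real.norm_of_nonneg hx.1.le] at h1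
      rw [dist_comm, dist_eq_norm]
      refine lt_of_le_of_lt ?_ hxe
      have h2 : (f z x - ∑ k ∈ Finset.range n, c k z * (x : ℂ) ^ k) / (x : ℂ) ^ n - c n z =
          (f z x - (∑ k ∈ Finset.range n, c k z * (x : ℂ) ^ k + c n z * (x : ℂ) ^ n)) /
            (x : ℂ) ^ n := by
        field_simp; ring
      have hxn : 0 < x ^ n := pow_pos hx.1 n
      rw [h2, norm_div, norm_pow, Complex.norm_real, Real.norm_of_nonneg hx.1.le,
        div_le_iff₀ hxn]
      refine h1.trans (le_of_eq ?_)
      simp only [B]; ring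
    refine hlim.tendstoLocallyUniformlyOn.differentiableOn ?_ hU
    filter_upwards [hev] with x hx
    refine DifferentiableOn.div_const ?_ _
    refine (hf.left (borelDisc_mono hδ hδd (ofReal_mem_borelDisc hx.1 hx.2))).sub ?_
    exact DifferentiableOn.fun_sum fun k hk => (ih k (Finset.mem_range.1 hk)).mul_const _

lemma uniformGevreyAsymptotics_laplace {U : Set ℂ} {ε K L d : ℝ}
    {φ : ℂ → ℂ → ℂ} (hε : 0 < ε) (hφ : HolomorphicOnProd φ U (tube ε)) (hK : 0 < K)
    (hL : 0 ≤ L) (hb : ∀ z ∈ U, ∀ ξ ∈ tube ε, ‖φ z ξ‖ ≤ K * Real.exp (L * ‖ξ‖))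
    (hdL : L + 1 ≤ 1 / d) :
    ∃ C M : ℝ, 0 < C ∧ 0 < M ∧ ∀ n : ℕ, ∀ z ∈ U, ∀ h ∈ borelDisc d,
      ‖laplace φ z h - ∑ k ∈ Finset.range n, laplaceCoeff φ k z * h ^ k‖ ≤
        C * M ^ n * (n.factorial : ℝ) * ‖h‖ ^ n := by
  set B := K * Real.exp (L * ε) with hB
  have hB0 : 0 < B := by positivity
  set m := max (2 / ε) 1 with hm
  have hm1 : 1 ≤ m := le_max_right _ _
  have hmM : 2 / ε ≤ m := le_max_left _ _
  refine ⟨2 * B, m, by positivity, by positivity, fun n z hz h hh => ?_⟩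
  have hs : L + 1 ≤ (h⁻¹).re := hdL.trans (mem_borelDisc_iff.1 hh).le
  have hs' : L < (h⁻¹).re := by linarith
  have hg := hφ.right hz
  have bound : ∀ j ≤ n, B * (2 / ε) ^ j * (j.factorial : ℝ) ≤ B * m ^ n * (n.factorial : ℝ) := by
    intro j hj
    have h1 : (2 / ε) ^ j ≤ m ^ n :=
      (pow_le_pow_left₀ (by positivity) hmM j).trans (pow_le_pow_right₀ hm1 hj)
    have h2 : (j.factorial : ℝ) ≤ n.factorial := by exact_mod_cast Nat.factorial_le hj
    gcongr
  rw [laplace_eq_realLaplace]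
  have hB1 : 0 ≤ B * m ^ n * (n.factorial : ℝ) := by positivity
  cases n with
  | zero =>
    have := norm_realLaplace_iteratedDeriv_le hε hL hg (hb z hz) hs 0
    simp only [iteratedDeriv_zero] at this
    have h0 := this.trans (bound 0 le_rfl)
    simp only [Finset.range_zero, Finset.sum_empty, sub_zero, pow_zero, mul_one]
    simp only [pow_zero, mul_one] at h0
    have : 0 ≤ B * ((Nat.factorial 0 : ℕ) : ℝ) := by positivity
    linarith
  | succ n =>
    have e1 : ∑ k ∈ Finset.range (n + 1), laplaceCoeff φ k z * h ^ k =
        ∑ k ∈ Finset.range n, iteratedDeriv k (φ z) 0 * h ^ (k + 1) := by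
      rw [Finset.sum_range_succ']
      simp [laplaceCoeff]
    -- The coefficient of index `0` is zero, so the expansion used has one term more than the
    -- partial sum. The remainder thus consists of that term and of the last integral, which is why
    -- the constant is `2 * B`.
    rw [e1, realLaplace_eq_sum hε hL hg (hb z hz) hs' (n + 1), inv_inv, Finset.sum_range_succ]
    have e : ∑ x ∈ Finset.range n, iteratedDeriv x (φ z) 0 * h ^ (x + 1) +
        iteratedDeriv n (φ z) 0 * h ^ (n + 1) + h ^ (n + 1) *
          realLaplace (fun x => iteratedDeriv (n + 1) (φ z) x) h⁻¹ -
        ∑ x ∈ Finset.range n, iteratedDeriv x (φ z) 0 * h ^ (x + 1) =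
        (iteratedDeriv n (φ z) 0 +
          realLaplace (fun x => iteratedDeriv (n + 1) (φ z) x) h⁻¹) * h ^ (n + 1) := by ring
    rw [e, norm_mul, norm_pow]
    have t1 := norm_iteratedDeriv_ofReal_le hε hL hg (hb z hz) n le_rfl
    simp only [Complex.ofReal_zero, mul_zero, Real.exp_zero, mul_one] at t1
    have t2 := norm_realLaplace_iteratedDeriv_le hε hL hg (hb z hz) hs (n + 1)
    have t3 := (norm_add_le _ _).trans (add_le_add (t1.trans (bound n (by omega)))
      (t2.trans (bound (n + 1) le_rfl)))
    refine mul_le_mul_of_nonneg_right (t3.trans (le_of_eq ?_)) (by positivity)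
    ring

/-- The Borel transform of the asymptotic series of the Laplace transform of `φ` is the Taylor
series of `φ`. -/
lemma hasSum_formalBorel_laplaceCoeff {ε : ℝ} {φ : ℂ → ℂ → ℂ} {z : ℂ}
    (hφ : DifferentiableOn ℂ (φ z) (tube ε)) {ξ : ℂ} (hξ : ‖ξ‖ < ε) :
    HasSum (fun k => formalBorel (laplaceCoeff φ) k z * ξ ^ k) (φ z ξ) := by
  have := Complex.hasSum_taylorSeries_on_ball (c := 0) (r := ε)
    (hφ.mono (ball_zero_subset_tube ε)) (z := ξ) (by simpa using hξ)
  have e : (fun k => formalBorel (laplaceCoeff φ) k z * ξ ^ k) =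
      fun k : ℕ => ((k.factorial : ℂ))⁻¹ • (ξ - 0) ^ k • iteratedDeriv k (φ z) 0 := by
    funext k
    simp only [formalBorel, laplaceCoeff, sub_zero, smul_eq_mul, div_eq_inv_mul]
    ring
  rw [e]
  exact this

/-! ### Pointwise asymptotic expansions -/

/-- `p` is the asymptotic expansion of `f x` as `x` tends to `0` from the right. -/
def HasExpansion (f : ℝ → ℂ) (p : PowerSeries ℂ) : Prop :=
  ∀ n : ℕ, (fun x : ℝ => f x - (p.trunc n).eval (x : ℂ)) =O[𝓝[>] 0] fun x => x ^ n

lemma isBigO_polynomial_eval (P : Polynomial ℂ) :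
    (fun x : ℝ => P.eval (x : ℂ)) =O[𝓝[>] 0] fun _ : ℝ => (1 : ℝ) := by
  have : Tendsto (fun x : ℝ => P.eval (x : ℂ)) (𝓝[>] 0) (𝓝 (P.eval ((0 : ℝ) : ℂ))) :=
    ((P.continuous.comp Complex.continuous_ofReal).tendsto 0).mono_left nhdsWithin_le_nhds
  exact this.isBigO_one ℝ

lemma isBigO_eval_of_X_pow_dvd {P : Polynomial ℂ} {n : ℕ} (h : Polynomial.X ^ n ∣ P) :
    (fun x : ℝ => P.eval (x : ℂ)) =O[𝓝[>] 0] fun x : ℝ => x ^ n := by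
  obtain ⟨Q, rfl⟩ := h
  have h1 : (fun x : ℝ => ((x : ℂ)) ^ n) =O[𝓝[>] (0 : ℝ)] fun x : ℝ => x ^ n :=
    Asymptotics.isBigO_of_le _ fun x => by simp
  simpa using h1.mul (isBigO_polynomial_eval Q)

namespace HasExpansion

variable {f g : ℝ → ℂ} {p q : PowerSeries ℂ}

lemma congr (hf : HasExpansion f p) (h : f =ᶠ[𝓝[>] 0] g) : HasExpansion g p := fun n =>
  (hf n).congr' (h.mono fun x hx => by simp only [hx]) EventuallyEq.rfl

lemma isBigO_one (hf : HasExpansion f p) : f =O[𝓝[>] 0] fun _ : ℝ => (1 : ℝ) := by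
  simpa using hf 0

lemma add (hf : HasExpansion f p) (hg : HasExpansion g q) :
    HasExpansion (fun x => f x + g x) (p + q) := fun n => by
  refine ((hf n).add (hg n)).congr_left fun x => ?_
  rw [map_add, Polynomial.eval_add]
  ring

/-- The product of the truncations agrees with the truncation of the product below degree `n`, so
they differ by a multiple of `X ^ n`. -/
lemma mul (hf : HasExpansion f p) (hg : HasExpansion g q) :
    HasExpansion (fun x => f x * g x) (p * q) := fun n => by
  have h1 := (hf n).mul hg.isBigO_one
  have h2 := (isBigO_polynomial_eval (p.trunc n)).mul (hg n)
  have h3 : (fun x : ℝ => (p.trunc n * q.trunc n - (p * q).trunc n).eval (x : ℂ))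
      =O[𝓝[>] 0] fun x : ℝ => x ^ n := by
    refine isBigO_eval_of_X_pow_dvd (Polynomial.X_pow_dvd_iff.2 fun k hk => ?_)
    rw [Polynomial.coeff_sub, PowerSeries.coeff_trunc, if_pos hk,
      PowerSeries.coeff_mul_eq_coeff_trunc_mul_trunc p q hk, ← Polynomial.coe_mul,
      Polynomial.coeff_coe, sub_self]
  simp only [mul_one, one_mul] at h1 h2
  refine ((h1.add h2).add h3).congr_left fun x => ?_
  rw [Polynomial.eval_sub, Polynomial.eval_mul]
  ring

lemma ofReal : HasExpansion (fun x => (x : ℂ)) PowerSeries.X := fun n => by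
  match n with
  | 0 =>
    simpa using (isBigO_polynomial_eval Polynomial.X)
  | 1 =>
    have : (fun x : ℝ => (Polynomial.X : Polynomial ℂ).eval (x : ℂ)) =O[𝓝[>] 0]
        fun x : ℝ => x ^ 1 := isBigO_eval_of_X_pow_dvd (by simp)
    refine this.congr_left fun x => ?_
    have : PowerSeries.trunc 1 (PowerSeries.X : PowerSeries ℂ) = 0 := by
      ext k
      rw [PowerSeries.coeff_trunc]
      split_ifs with h
      · have : k = 0 := by omega
        subst this; simp
      · simp
    simp [this]
  | n + 2 =>
    rw [PowerSeries.trunc_X]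
    simp only [Polynomial.eval_X, sub_self]
    exact Asymptotics.isBigO_zero _ _

lemma unique (hf : HasExpansion f p) (hg : HasExpansion f q) : p = q := by
  ext n
  induction n using Nat.strong_induction_on with
  | _ n ih =>
    have ht : p.trunc n = q.trunc n := by
      ext k
      rw [PowerSeries.coeff_trunc, PowerSeries.coeff_trunc]
      split_ifs with h
      · exact ih k h
      · rfl
    have h1 := (hg (n + 1)).sub (hf (n + 1))
    simp only [PowerSeries.trunc_succ, Polynomial.eval_add, Polynomial.eval_monomial, ht] at h1
    have h2 : (fun x : ℝ => (PowerSeries.coeff n p - PowerSeries.coeff n q) * (x : ℂ) ^ n)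
        =O[𝓝[>] 0] fun x : ℝ => x ^ (n + 1) := h1.congr_left fun x => by ring
    have h3 : (fun x : ℝ => PowerSeries.coeff n p - PowerSeries.coeff n q)
        =O[𝓝[>] 0] fun x : ℝ => x := by
      obtain ⟨C, hC⟩ := h2.bound
      refine Asymptotics.IsBigO.of_bound C ?_
      filter_upwards [hC, self_mem_nhdsWithin] with x hx hx0
      have hx1 : 0 < x := hx0
      rw [norm_mul, norm_pow, norm_pow, Complex.norm_real, pow_succ'] at hx
      have : 0 < ‖x‖ ^ n := pow_pos (norm_pos_iff.2 hx1.ne') n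
      refine le_of_mul_le_mul_right (hx.trans (le_of_eq ?_)) this
      ring
    have h4 : Tendsto (fun x : ℝ => x) (𝓝[>] 0) (𝓝 0) :=
      tendsto_id.mono_left nhdsWithin_le_nhds
    exact sub_eq_zero.1 (tendsto_nhds_unique tendsto_const_nhds (h3.trans_tendsto h4))

end HasExpansion

lemma eval_trunc_seriesAt (c : ℕ → ℂ → ℂ) (z w : ℂ) (n : ℕ) :
    ((seriesAt c z).trunc n).eval w = ∑ k ∈ Finset.range n, c k z * w ^ k := by
  rw [Polynomial.eval, PowerSeries.eval₂_trunc_eq_sum_range]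
  simp [seriesAt]

lemma hasExpansion_of_bound {f : ℝ → ℂ} {c : ℕ → ℂ → ℂ} {z : ℂ} {δ : ℝ} (hδ : 0 < δ)
    {B : ℕ → ℝ} (h : ∀ n, ∀ x : ℝ, 0 < x → x < δ →
      ‖f x - ∑ k ∈ Finset.range n, c k z * (x : ℂ) ^ k‖ ≤ B n * x ^ n) :
    HasExpansion f (seriesAt c z) := fun n => by
  refine Asymptotics.IsBigO.of_bound (B n) ?_
  filter_upwards [Ioo_mem_nhdsGT hδ] with x hx
  rw [eval_trunc_seriesAt, norm_pow, Real.norm_of_nonneg hx.1.le]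
  exact h n x hx.1 hx.2

namespace UniformGevreyAsymptotics

variable {U : Set ℂ} {d : ℝ} {f : ℂ → ℂ → ℂ} {c : ℕ → ℂ → ℂ}

lemma hasExpansion (h : UniformGevreyAsymptotics U d f c) {z : ℂ} (hz : z ∈ U) :
    HasExpansion (fun x => f z x) (seriesAt c z) := by
  obtain ⟨-, δ, hδ, -, C, M, -, -, hb⟩ := h
  refine hasExpansion_of_bound hδ (B := fun n => C * M ^ n * n.factorial) fun n x hx0 hx => ?_
  have := hb n z hz x (ofReal_mem_borelDisc hx0 hx)
  rwa [Complex.norm_real, Real.norm_of_nonneg hx0.le] at this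

/-- Uniform asymptotic expansions can be differentiated. -/
lemma hasExpansion_deriv (h : UniformGevreyAsymptotics U d f c) (hU : IsOpen U)
    (hf : HolomorphicOnProd f U (borelDisc d)) {z : ℂ} (hz : z ∈ U) :
    HasExpansion (fun x => deriv (fun w => f w x) z) (seriesAt (fun k => deriv (c k)) z) := by
  obtain ⟨hc, δ, hδ, hδd, C, M, -, -, hb⟩ := h
  obtain ⟨ρ, hρ, hball⟩ := Metric.nhds_basis_closedBall.mem_iff.1 (hU.mem_nhds hz)
  refine hasExpansion_of_bound hδ (B := fun n => C * M ^ n * n.factorial / ρ)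
    fun n x hx0 hx => ?_
  have hmem := ofReal_mem_borelDisc hx0 hx
  have hfx := hf.left (borelDisc_mono hδ hδd hmem)
  have hdiff : DifferentiableOn ℂ
      (fun w => f w x - ∑ k ∈ Finset.range n, c k w * (x : ℂ) ^ k) U :=
    hfx.sub (DifferentiableOn.fun_sum fun k _ => (hc k).mul_const _)
  have hd1 : deriv (fun w => f w x - ∑ k ∈ Finset.range n, c k w * (x : ℂ) ^ k) z =
      deriv (fun w => f w x) z - ∑ k ∈ Finset.range n, deriv (c k) z * (x : ℂ) ^ k := by
    have hck : ∀ k, DifferentiableAt ℂ (c k) z := fun k =>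
      (hc k).differentiableAt (hU.mem_nhds hz)
    rw [deriv_fun_sub (hfx.differentiableAt (hU.mem_nhds hz))
      (DifferentiableAt.fun_sum fun k _ => (hck k).mul_const _),
      deriv_fun_sum fun k _ => (hck k).mul_const _]
    simp only [deriv_mul_const (hck _)]
  rw [← hd1]
  -- Cauchy's estimate on a circle about `z` where the remainder bound is uniform; it costs the
  -- factor `1 / ρ`, harmless for an expansion at a single point.
  have := Complex.norm_deriv_le_of_forall_mem_sphere_norm_le (c := z) (R := ρ)
    (C := C * M ^ n * n.factorial * x ^ n) hρ
    ((hdiff.mono (by rwa [closure_ball _ hρ.ne'])).diffContOnCl) (fun w hw => by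
      have := hb n w (hball (Metric.sphere_subset_closedBall hw)) x hmem
      rwa [Complex.norm_real, Real.norm_of_nonneg hx0.le] at this)
  refine this.trans (le_of_eq ?_)
  ring

end UniformGevreyAsymptotics

/-- The asymptotic series of an exact solution is a formal solution. -/
lemma SolvesRiccati.isFormalSolution {A : Fin 3 → ℂ → ℂ → ℂ} {a : Fin 3 → ℕ → ℂ → ℂ} {U : Set ℂ}
    {d : ℝ} {F : ℂ → ℂ → ℂ} {c : ℕ → ℂ → ℂ} (hs : SolvesRiccati A U (borelDisc d) F)
    (hU : IsOpen U) (hd : 0 < d) (hF : HolomorphicOnProd F U (borelDisc d))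
    (hA : ∀ i, UniformGevreyAsymptotics U d (A i) (a i))
    (hc : UniformGevreyAsymptotics U d F c) : IsFormalSolution a U c := by
  refine ⟨hc.1, fun z hz => ?_⟩
  have hFe := hc.hasExpansion hz
  have hAe := fun i => (hA i).hasExpansion hz
  have hl := HasExpansion.ofReal.mul (hc.hasExpansion_deriv hU hF hz)
  have hr := hFe.add (HasExpansion.ofReal.mul
    ((((hAe 2).mul (hFe.mul hFe)).add ((hAe 1).mul hFe)).add (hAe 0)))
  rw [pow_two]
  refine hl.unique (hr.congr ?_)
  filter_upwards [Ioo_mem_nhdsGT hd] with x hx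
  rw [hs z hz x (ofReal_mem_borelDisc hx.1 hx.2), pow_two]

/-! ### Formal solutions -/

/-- The series `a₂ c² + a₁ c + a₀`. -/
noncomputable def riccatiSeries (a : Fin 3 → ℕ → ℂ → ℂ) (c : ℕ → ℂ → ℂ) (z : ℂ) :
    PowerSeries ℂ :=
  seriesAt (a 2) z * seriesAt c z ^ 2 + seriesAt (a 1) z * seriesAt c z + seriesAt (a 0) z

/-- Comparing coefficients turns the equation into a recursion: the right-hand side for `c (k + 1)`
involves only the coefficients up to `k`, whence existence and uniqueness. -/
lemma isFormalSolution_iff {a : Fin 3 → ℕ → ℂ → ℂ} {U : Set ℂ} {c : ℕ → ℂ → ℂ} :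
    IsFormalSolution a U c ↔ HolomorphicCoeffs U c ∧ ∀ z ∈ U, c 0 z = 0 ∧
      ∀ k, c (k + 1) z = deriv (c k) z - PowerSeries.coeff k (riccatiSeries a c z) := by
  refine and_congr_right fun _ => forall₂_congr fun z _ => ?_
  change _ = _ + PowerSeries.X * riccatiSeries a c z ↔ _
  rw [PowerSeries.ext_iff]
  constructor
  · intro h
    refine ⟨?_, fun k => ?_⟩
    · simpa [seriesAt] using (h 0).symm
    · have := h (k + 1)
      rw [map_add, PowerSeries.coeff_succ_X_mul, PowerSeries.coeff_succ_X_mul] at this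
      simp only [seriesAt, PowerSeries.coeff_mk] at this
      rw [this]; ring
  · rintro ⟨h0, h1⟩ k
    cases k with
    | zero => simp [seriesAt, h0]
    | succ k =>
      rw [map_add, PowerSeries.coeff_succ_X_mul, PowerSeries.coeff_succ_X_mul]
      simp only [seriesAt, PowerSeries.coeff_mk]
      rw [h1]; ring

/-- The difference of the two quadratic expressions is a multiple of the difference of the series,
which `X ^ (n + 1)` divides. -/
lemma coeff_riccatiSeries_congr {a : Fin 3 → ℕ → ℂ → ℂ} {c c' : ℕ → ℂ → ℂ} {z : ℂ} {n : ℕ}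
    (h : ∀ k ≤ n, c k z = c' k z) :
    PowerSeries.coeff n (riccatiSeries a c z) = PowerSeries.coeff n (riccatiSeries a c' z) := by
  have h1 : PowerSeries.X ^ (n + 1) ∣ seriesAt c z - seriesAt c' z := by
    refine PowerSeries.X_pow_dvd_iff.2 fun k hk => ?_
    simp [seriesAt, h k (by omega)]
  have h2 : riccatiSeries a c z - riccatiSeries a c' z = (seriesAt c z - seriesAt c' z) *
      (seriesAt (a 2) z * (seriesAt c z + seriesAt c' z) + seriesAt (a 1) z) := by
    simp only [riccatiSeries]; ring
  have h3 := PowerSeries.X_pow_dvd_iff.1 (h2 ▸ h1.mul_right _) n (by omega)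
  rwa [map_sub, sub_eq_zero] at h3

lemma differentiableOn_coeff_mul {U : Set ℂ} {p q : ℂ → PowerSeries ℂ}
    (hp : ∀ k, DifferentiableOn ℂ (fun z => PowerSeries.coeff k (p z)) U)
    (hq : ∀ k, DifferentiableOn ℂ (fun z => PowerSeries.coeff k (q z)) U) (n : ℕ) :
    DifferentiableOn ℂ (fun z => PowerSeries.coeff n (p z * q z)) U := by
  simp only [PowerSeries.coeff_mul]
  exact DifferentiableOn.fun_sum fun k _ => (hp _).mul (hq _)

lemma differentiableOn_coeff_riccatiSeries {a : Fin 3 → ℕ → ℂ → ℂ} {U : Set ℂ} {c : ℕ → ℂ → ℂ}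
    (ha : ∀ i, HolomorphicCoeffs U (a i)) (hc : HolomorphicCoeffs U c) (n : ℕ) :
    DifferentiableOn ℂ (fun z => PowerSeries.coeff n (riccatiSeries a c z)) U := by
  have h : ∀ {b : ℕ → ℂ → ℂ}, HolomorphicCoeffs U b →
      ∀ k, DifferentiableOn ℂ (fun z => PowerSeries.coeff k (seriesAt b z)) U := fun hb k => by
    simpa [seriesAt] using hb k
  simp only [riccatiSeries, map_add, pow_two]
  exact ((differentiableOn_coeff_mul (h (ha 2)) (differentiableOn_coeff_mul (h hc) (h hc)) n).add
    (differentiableOn_coeff_mul (h (ha 1)) (h hc) n)).add (h (ha 0) n)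

/-- The partial sums of the formal solution. -/
noncomputable def formalPartial (a : Fin 3 → ℕ → ℂ → ℂ) : ℕ → ℕ → ℂ → ℂ
  | 0 => fun _ _ => 0
  | n + 1 => Function.update (formalPartial a n) (n + 1) fun z =>
      deriv (formalPartial a n n) z -
        PowerSeries.coeff n (riccatiSeries a (formalPartial a n) z)

/-- The formal solution. -/
noncomputable def formalSolution (a : Fin 3 → ℕ → ℂ → ℂ) (k : ℕ) : ℂ → ℂ := formalPartial a k k

/-- Stage `n + 1` changes only the entry `n + 1`, so an entry is final once it has been set. -/
lemma formalPartial_eq (a : Fin 3 → ℕ → ℂ → ℂ) {n k : ℕ} (h : k ≤ n) :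
    formalPartial a n k = formalSolution a k := by
  induction n with
  | zero => obtain rfl : k = 0 := by omega
            rfl
  | succ n ih =>
    rcases h.eq_or_lt with rfl | h
    · rfl
    · rw [formalPartial, Function.update_of_ne (by omega), ih (by omega)]

lemma formalSolution_succ (a : Fin 3 → ℕ → ℂ → ℂ) (k : ℕ) (z : ℂ) :
    formalSolution a (k + 1) z = deriv (formalSolution a k) z -
      PowerSeries.coeff k (riccatiSeries a (formalSolution a) z) := by
  rw [formalSolution, formalPartial, Function.update_self, formalPartial_eq a le_rfl,
    coeff_riccatiSeries_congr fun j hj => by rw [formalPartial_eq a hj]]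

lemma isFormalSolution_formalSolution {a : Fin 3 → ℕ → ℂ → ℂ} {U : Set ℂ} (hU : IsOpen U)
    (ha : ∀ i, HolomorphicCoeffs U (a i)) : IsFormalSolution a U (formalSolution a) := by
  refine isFormalSolution_iff.2 ⟨?_, fun z _ => ⟨rfl, fun k => formalSolution_succ a k z⟩⟩
  have h : ∀ n, HolomorphicCoeffs U (formalPartial a n) := by
    intro n
    induction n with
    | zero => exact fun k => differentiableOn_const _
    | succ n ih =>
      intro k
      by_cases hk : k = n + 1
      · subst hk
        rw [formalPartial, Function.update_self]
        exact ((ih n).deriv hU).sub (differentiableOn_coeff_riccatiSeries ha ih n)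
      · rw [formalPartial, Function.update_of_ne hk]
        exact ih k
  exact fun k => h k k

namespace IsFormalSolution

variable {a : Fin 3 → ℕ → ℂ → ℂ} {U : Set ℂ} {c c' : ℕ → ℂ → ℂ}

lemma mono (h : IsFormalSolution a U c) {V : Set ℂ} (hV : V ⊆ U) : IsFormalSolution a V c :=
  ⟨fun k => (h.1 k).mono hV, fun z hz => h.2 z (hV hz)⟩

lemma unique (h : IsFormalSolution a U c) (h' : IsFormalSolution a U c') (hU : IsOpen U) (k : ℕ) :
    EqOn (c' k) (c k) U := by
  obtain ⟨-, h⟩ := isFormalSolution_iff.1 h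
  obtain ⟨-, h'⟩ := isFormalSolution_iff.1 h'
  induction k using Nat.strong_induction_on with
  | _ k ih =>
    intro z hz
    cases k with
    | zero => rw [(h z hz).1, (h' z hz).1]
    | succ k =>
      rw [(h z hz).2, (h' z hz).2, (ih k (by omega)).deriv hU hz,
        coeff_riccatiSeries_congr fun j hj => ih j (by omega) hz]

lemma apply_zero (h : IsFormalSolution a U c) {z : ℂ} (hz : z ∈ U) : c 0 z = 0 :=
  ((isFormalSolution_iff.1 h).2 z hz).1

lemma apply_one (h : IsFormalSolution a U c) (hU : IsOpen U) {z : ℂ} (hz : z ∈ U) :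
    c 1 z = -a 0 0 z := by
  have h0 : EqOn (c 0) (fun _ => 0) U := fun w hw => h.apply_zero hw
  rw [((isFormalSolution_iff.1 h).2 z hz).2 0, h0.deriv hU hz]
  simp [riccatiSeries, seriesAt, h.apply_zero hz, PowerSeries.coeff_zero_eq_constantCoeff]

/-- Translations. -/
lemma comp_add (h : IsFormalSolution a U c) (hU : IsOpen U) {ω : ℂ}
    (ha : ∀ i k, ∀ z ∈ U, z + ω ∈ U → a i k (z + ω) = a i k z) (k : ℕ) {z : ℂ} (hz : z ∈ U)
    (hzω : z + ω ∈ U) : c k (z + ω) = c k z := by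
  -- On the open set where both points lie in `U`, the translated series solves the same formal
  -- equation, so uniqueness applies there.
  set V := U ∩ (fun z => z + ω) ⁻¹' U
  have hV : IsOpen V := hU.inter (hU.preimage (by fun_prop))
  have h1 : IsFormalSolution a V fun k z => c k (z + ω) := by
    refine ⟨fun k => (h.1 k).comp (by fun_prop) fun z hz => hz.2, fun z hz => ?_⟩
    have := h.2 (z + ω) hz.2
    have e : ∀ i, seriesAt (a i) (z + ω) = seriesAt (a i) z := fun i => by
      ext k; simp [seriesAt, ha i k z hz.1 hz.2]
    rw [e, e, e] at this
    simpa only [seriesAt, deriv_comp_add_const] using this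
  exact (h.mono inter_subset_left).unique h1 hV k ⟨hz, hzω⟩

end IsFormalSolution

/-! ### Uniform convergence of improper integrals -/

/-- The tail is at most the tail of the majorant. When the majorant is free of parameters, this
makes the convergence of improper integrals uniform. -/
lemma norm_integral_sub_setIntegral_le {X : Type*} [MeasurableSpace X] {μ : Measure X} {s : Set X}
    (hs : MeasurableSet s) {F : X → ℂ} {g : X → ℝ} (hF : Integrable F μ) (hg : Integrable g μ)
    (hb : ∀ᵐ v ∂μ, ‖F v‖ ≤ g v) :
    ‖∫ v, F v ∂μ - ∫ v in s, F v ∂μ‖ ≤ ∫ v, g v ∂μ - ∫ v in s, g v ∂μ := by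
  rw [← integral_add_compl hs hF, ← integral_add_compl hs hg, add_sub_cancel_left,
    add_sub_cancel_left]
  exact norm_integral_le_of_norm_le hg.integrableOn (ae_restrict_of_ae hb)

lemma laplaceUniformlyConvergent_of_expBound {U : Set ℂ} {ε K L d : ℝ} {φ : ℂ → ℂ → ℂ}
    (hε : 0 < ε) (hφ : HolomorphicOnProd φ U (tube ε))
    (hb : ∀ z ∈ U, ∀ ξ ∈ tube ε, ‖φ z ξ‖ ≤ K * Real.exp (L * ‖ξ‖)) (hdL : L + 1 ≤ 1 / d) :
    LaplaceUniformlyConvergent U (borelDisc d) φ := by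
  have hre : ∀ h ∈ borelDisc d, L + 1 ≤ (h⁻¹).re := fun h hh =>
    hdL.trans (mem_borelDisc_iff.1 hh).le
  have hint : ∀ z ∈ U, ∀ h ∈ borelDisc d,
      IntegrableOn (fun ξ : ℝ => φ z (ξ : ℂ) * Complex.exp (-(ξ : ℂ) / h)) (Ioi 0) := by
    intro z hz h hh
    simp only [neg_div_eq_neg_inv_mul]
    exact laplaceIntegrable_of_expBound hε (hφ.right hz) (hb z hz) (by linarith [hre h hh])
  refine ⟨hint, Metric.tendstoUniformlyOn_iff.2 fun e he => ?_⟩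
  have hg := (exp_neg_integrableOn_Ioi 0 one_pos).const_mul K
  have hlim := (intervalIntegral_tendsto_integral_Ioi 0 hg tendsto_id).const_sub
    (∫ x in Ioi (0 : ℝ), K * Real.exp (-1 * x))
  rw [sub_self] at hlim
  filter_upwards [hlim.eventually_lt_const he, eventually_ge_atTop 0] with T hT hT0 p hp
  rw [dist_eq_norm]
  refine lt_of_le_of_lt ?_ hT
  have := norm_integral_sub_setIntegral_le (μ := volume.restrict (Ioi 0)) (s := Ioc 0 T)
    measurableSet_Ioc (hint p.1 hp.1 p.2 hp.2) hg
    ((ae_restrict_iff' measurableSet_Ioi).2 (Eventually.of_forall fun x hx => by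
      rw [neg_div_eq_neg_inv_mul]
      exact norm_mul_exp_le hε (hb p.1 hp.1) (hre p.2 hp.2) (le_of_lt hx)))
  rw [Measure.restrict_restrict measurableSet_Ioc,
    inter_eq_left.2 (Ioc_subset_Ioi_self : Ioc 0 T ⊆ Ioi 0)] at this
  simp only [id]
  rwa [intervalIntegral.integral_of_le hT0, intervalIntegral.integral_of_le hT0]

/-! ### Inversion of the Laplace transform on the boundary of a Borel disc -/

lemma borelPath_eq (δ v : ℝ) : borelPath δ (2 * Real.pi * v) = (verticalLine (1 / δ) v)⁻¹ := rfl

/-- The velocity cancels `ħ ^ (-2)`. With `t = 2πv`, the factors `-i`, `2π`, the reversal of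
orientation and `(2πi)⁻¹` multiply to `1`. -/
lemma borelIntegral_eq {f : ℂ → ℂ → ℂ} {δ : ℝ} (hδ : 0 < δ) (T : ℝ) (z ξ : ℂ) :
    borelIntegral f δ T z ξ = ∫ v in (-(T / (2 * Real.pi)))..(T / (2 * Real.pi)),
      f z (verticalLine (1 / δ) v)⁻¹ * Complex.exp (verticalLine (1 / δ) v * ξ) := by
  have hπ : (2 * Real.pi : ℝ) ≠ 0 := by positivity
  have hne : ∀ t, borelPath δ t ≠ 0 := by
    intro t h
    have := congrArg Complex.re (inv_eq_zero.1 h)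
    simp at this
    exact hδ.ne' this
  have e : ∀ t, f z (borelPath δ t) * Complex.exp (ξ / borelPath δ t) / borelPath δ t ^ 2 *
      (-Complex.I * borelPath δ t ^ 2) =
      -Complex.I * (f z (borelPath δ t) * Complex.exp (ξ / borelPath δ t)) := by
    intro t
    have := hne t
    field_simp
  have e2 : ∀ v, f z (verticalLine (1 / δ) v)⁻¹ * Complex.exp (verticalLine (1 / δ) v * ξ) =
      (fun t => f z (borelPath δ t) * Complex.exp (ξ / borelPath δ t)) (2 * Real.pi * v) := by
    intro v
    simp only [borelPath_eq, div_inv_eq_mul]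
    rw [mul_comm ξ]
  rw [borelIntegral]
  simp only [e]
  rw [intervalIntegral.integral_congr (fun v _ => e2 v), intervalIntegral.integral_const_mul,
    intervalIntegral.integral_symm, intervalIntegral.integral_comp_mul_left
      (fun t => f z (borelPath δ t) * Complex.exp (ξ / borelPath δ t)) hπ]
  have h1 : 2 * Real.pi * (T / (2 * Real.pi)) = T := by field_simp
  rw [mul_neg, h1, Complex.real_smul]
  have hI := Complex.I_ne_zero
  have hπ' : (Real.pi : ℂ) ≠ 0 := by exact_mod_cast Real.pi_ne_zero
  push_cast
  field_simp

section BorelInversion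

variable {ε K L c : ℝ} {g : ℂ → ℂ}

/-- The part of order `s ^ (-2)` of the Laplace transform. -/
noncomputable def laplaceRemainder (g : ℂ → ℂ) (s : ℂ) : ℂ :=
  realLaplace (fun x => g x) s - g 0 * s⁻¹

/-- Subtracting `g 0 / s` amounts to replacing `g` by `g - g 0`, which vanishes at `0` and so
extends continuously by zero, as inversion requires. -/
lemma integral_laplaceRemainder (hε : 0 < ε) (hg : DifferentiableOn ℂ g (tube ε))
    (hb : ∀ ξ ∈ tube ε, ‖g ξ‖ ≤ K * Real.exp (L * ‖ξ‖)) (hL : 0 ≤ L) (hc : L < c)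
    (hi : Integrable fun v => laplaceRemainder g (verticalLine c v)) {x : ℝ} (hx : 0 ≤ x) :
    ∫ v, laplaceRemainder g (verticalLine c v) * Complex.exp (verticalLine c v * x) =
      g x - g 0 := by
  set ψ : ℝ → ℂ := fun x => g ((max x 0 : ℝ) : ℂ) - g 0 with hψ
  have hψpos : ∀ x, 0 ≤ x → ψ x = g x - g 0 := fun x hx => by simp [hψ, max_eq_left hx]
  have h0 : ∀ x ≤ 0, ψ x = 0 := fun x hx => by simp [hψ, max_eq_right hx]
  have hcont : Continuous ψ := by
    have := (continuousOn_ofReal_of_differentiableOn_tube hε hg).comp_continuous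
      (f := fun x : ℝ => max x 0) (by fun_prop) (fun x => mem_Ici.2 (le_max_right _ _))
    exact this.sub continuous_const
  have hint : ∀ s : ℂ, L < s.re → LaplaceIntegrable (fun x => g x) s ∧
      IntegrableOn (fun x : ℝ => Complex.exp (-(s * x))) (Ioi 0) := by
    intro s hs
    refine ⟨laplaceIntegrable_of_expBound hε hg hb hs, ?_⟩
    have := integrableOn_exp_mul_complex_Ioi (a := -s) (by simpa using hL.trans_lt hs) 0
    simpa using this
  have hLI : ∀ s : ℂ, L < s.re →
      IntegrableOn (fun x : ℝ => ψ x * Complex.exp (-(s * x))) (Ioi 0) ∧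
      ∫ x in Ioi (0 : ℝ), ψ x * Complex.exp (-(s * x)) = laplaceRemainder g s := by
    intro s hs
    obtain ⟨i1, i2⟩ := hint s hs
    have e : EqOn (fun x : ℝ => ψ x * Complex.exp (-(s * x)))
        (fun x : ℝ => g x * Complex.exp (-(s * x)) - g 0 * Complex.exp (-(s * x))) (Ioi 0) :=
      fun x hx => by simp only [hψpos x (le_of_lt hx), sub_mul]
    refine ⟨(i1.sub (i2.const_mul (g 0))).congr_fun e.symm measurableSet_Ioi, ?_⟩
    rw [setIntegral_congr_fun measurableSet_Ioi e, integral_sub i1 (i2.const_mul (g 0)),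
      integral_const_mul, laplace_one (hL.trans_lt hs)]
    rfl
  rw [← hψpos x hx]
  refine integral_verticalLine_eq_of_laplace_eq hcont h0 ?_
    (fun v => (hLI _ (by simpa using hc)).2) hi x
  rw [← integrableOn_univ, ← Iic_union_Ioi (a := (0 : ℝ))]
  refine IntegrableOn.union ?_ (hLI c (by simpa using hc)).1
  refine integrableOn_zero.congr_fun (fun x hx => ?_) measurableSet_Iic
  simp [h0 x hx]

/-- Primitive of `(s⁻¹ - x⁻¹ s⁻²) e ^ (s x)` along a vertical line. -/
lemma intervalIntegral_verticalLine_inv (hc : 0 < c) {x : ℝ} (hx : 0 < x) (V : ℝ) :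
    ∫ v in (-V)..V, ((verticalLine c v)⁻¹ - (x : ℂ)⁻¹ * (verticalLine c v ^ 2)⁻¹) *
      Complex.exp (verticalLine c v * x) =
    (2 * Real.pi * Complex.I * x)⁻¹ *
      ((verticalLine c V)⁻¹ * Complex.exp (verticalLine c V * x) -
        (verticalLine c (-V))⁻¹ * Complex.exp (verticalLine c (-V) * x)) := by
  have hne : ∀ v, verticalLine c v ≠ 0 := fun v h => by
    have := congrArg Complex.re h
    simp at this
    exact hc.ne' this
  have hx0 : (x : ℂ) ≠ 0 := by exact_mod_cast hx.ne'
  have hπ' : (Real.pi : ℂ) ≠ 0 := by exact_mod_cast Real.pi_ne_zero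
  have hline : ∀ v, HasDerivAt (verticalLine c) (2 * Real.pi * Complex.I) v := by
    intro v
    have h1 : HasDerivAt (fun v : ℝ => (v : ℂ)) 1 v := Complex.ofRealCLM.hasDerivAt
    have h2 := ((h1.const_mul (2 * Real.pi : ℂ)).mul_const Complex.I).const_add (c : ℂ)
    rw [mul_one] at h2
    have e : verticalLine c = fun v : ℝ => (c : ℂ) + 2 * Real.pi * v * Complex.I := by
      funext v
      simp [verticalLine]
    rw [e]
    exact h2
  have hder : ∀ v ∈ uIcc (-V) V, HasDerivAt (fun v => (2 * Real.pi * Complex.I * x)⁻¹ *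
      ((verticalLine c v)⁻¹ * Complex.exp (verticalLine c v * x)))
      (((verticalLine c v)⁻¹ - (x : ℂ)⁻¹ * (verticalLine c v ^ 2)⁻¹) *
        Complex.exp (verticalLine c v * x)) v := by
    intro v _
    refine ((((hline v).fun_inv (hne v)).mul (((hline v).mul_const (x : ℂ)).cexp)).const_mul
      _).congr_deriv ?_
    have := hne v
    have := Complex.I_ne_zero
    field_simp
    ring
  rw [intervalIntegral.integral_eq_sub_of_hasDerivAt hder, mul_sub]
  refine Continuous.intervalIntegrable ?_ _ _
  have c1 : Continuous fun v => (verticalLine c v)⁻¹ := (continuous_verticalLine c).inv₀ hne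
  have c2 : Continuous fun v => (verticalLine c v ^ 2)⁻¹ :=
    ((continuous_verticalLine c).pow 2).inv₀ fun v => pow_ne_zero 2 (hne v)
  fun_prop

end BorelInversion

/-- The Borel integrals of the Laplace transform of `φ` converge to `φ`. -/
lemma isBorelTransform_laplace {U : Set ℂ} {ε K L d : ℝ} {φ : ℂ → ℂ → ℂ} (hU : IsOpen U)
    (hε : 0 < ε) (hφ : HolomorphicOnProd φ U (tube ε)) (hK : 0 < K) (hL : 0 ≤ L)
    (hb : ∀ z ∈ U, ∀ ξ ∈ tube ε, ‖φ z ξ‖ ≤ K * Real.exp (L * ‖ξ‖)) (hd : 0 < d)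
    (hdL : L + 1 ≤ 1 / d) : IsBorelTransform U d (laplace φ) φ := by
  intro δ hδ hδd S hS hSpos
  set c : ℝ := 1 / δ with hc
  have hcd : 1 / d < c := one_div_lt_one_div_of_lt hδ hδd
  have hc1 : 1 ≤ c := by linarith
  have hc0 : 0 < c := by linarith
  obtain ⟨C, M, hC, hM, hG⟩ := uniformGevreyAsymptotics_laplace hε hφ hK hL hb hdL
  obtain ⟨B, hB⟩ : ∃ B, B = C * M ^ 2 * 2 := ⟨_, rfl⟩
  have hB0 : 0 < B := by rw [hB]; positivity
  have hmem : ∀ v, (verticalLine c v)⁻¹ ∈ borelDisc d := fun v => by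
    rw [mem_borelDisc_iff, inv_inv, verticalLine_re]; exact hcd
  have hR : ∀ z ∈ U, ∀ v, ‖laplaceRemainder (φ z) (verticalLine c v)‖ ≤
      B / ‖verticalLine c v‖ ^ 2 := by
    intro z hz v
    have := hG 2 z hz _ (hmem v)
    rw [laplace_eq_realLaplace, inv_inv] at this
    simp only [Finset.sum_range_succ, Finset.range_zero, Finset.sum_empty, laplaceCoeff,
      zero_mul, zero_add, pow_one, iteratedDeriv_zero, Nat.factorial, norm_inv, inv_pow] at this
    rw [laplaceRemainder, hB, div_eq_mul_inv]
    simpa using this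
  have hGc : ∀ z ∈ U, Continuous fun v => realLaplace (fun x => φ z x) (verticalLine c v) := by
    intro z hz
    have h1 := (holomorphicOnProd_laplace hU hε hφ hb hd hdL).right hz
    have h2 := h1.continuousOn.comp_continuous
      (f := fun v => (verticalLine c v)⁻¹) ((continuous_verticalLine c).inv₀ fun v h => by
        have := congrArg Complex.re h
        simp at this
        exact hc0.ne' this) hmem
    simpa only [Function.comp_def, laplace_eq_realLaplace, inv_inv] using h2
  have hne : ∀ v, verticalLine c v ≠ 0 := fun v h => by
    have := congrArg Complex.re h
    simp at this
    exact hc0.ne' this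
  have c1 : Continuous fun v => (verticalLine c v)⁻¹ := (continuous_verticalLine c).inv₀ hne
  have c2 : Continuous fun v => (verticalLine c v ^ 2)⁻¹ :=
    ((continuous_verticalLine c).pow 2).inv₀ fun v => pow_ne_zero 2 (hne v)
  have hRc : ∀ z ∈ U, Continuous fun v => laplaceRemainder (φ z) (verticalLine c v) :=
    fun z hz => (hGc z hz).sub (continuous_const.mul c1)
  rcases S.eq_empty_or_nonempty with rfl | hne'
  · simpa using tendstoUniformlyOn_empty
  -- The least element controls `x⁻¹` and the greatest controls `e ^ (c x)`, uniformly on the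
  -- compact set.
  obtain ⟨a, haS, ha⟩ := hS.exists_isLeast hne'
  obtain ⟨b, hbS, hbub⟩ := hS.exists_isGreatest hne'
  have ha0 : 0 < a := hSpos haS
  have hφ0 : ∀ z ∈ U, ‖φ z 0‖ ≤ K := fun z hz => by
    simpa using hb z hz 0 (zero_mem_tube hε)
  obtain ⟨D, hD⟩ : ∃ D, D = (B + K * a⁻¹) * Real.exp (c * b) := ⟨_, rfl⟩
  have hD0 : 0 ≤ D := by rw [hD]; positivity
  have hgi : Integrable fun v : ℝ => D * (1 + v ^ 2)⁻¹ := integrable_inv_one_add_sq.const_mul D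
  -- The term `φ(z, 0) / s` is not absolutely integrable. Writing `s⁻¹` as `s⁻¹ - x⁻¹ s⁻²` plus `x⁻¹
  -- s⁻²` isolates a part with an explicit primitive, whose boundary values are `O(1 / V)`. The rest
  -- is `H`, absolutely integrable with integral `(φ(z, x) - φ(z, 0)) + φ(z, 0)`.
  set H : ℂ → ℝ → ℝ → ℂ := fun z x v => (laplaceRemainder (φ z) (verticalLine c v) +
    φ z 0 * ((x : ℂ)⁻¹ * (verticalLine c v ^ 2)⁻¹)) * Complex.exp (verticalLine c v * x) with hH
  have hHc : ∀ z ∈ U, ∀ x, Continuous (H z x) := fun z hz x => by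
    have := hRc z hz
    simp only [hH]
    fun_prop
  have hexp : ∀ x ∈ S, ∀ v, ‖Complex.exp (verticalLine c v * x)‖ ≤ Real.exp (c * b) := by
    intro x hx v
    rw [norm_exp_verticalLine_mul]
    exact Real.exp_le_exp.2 (mul_le_mul_of_nonneg_left (hbub hx) hc0.le)
  have hHb : ∀ z ∈ U, ∀ x ∈ S, ∀ v, ‖H z x v‖ ≤ D * (1 + v ^ 2)⁻¹ := by
    intro z hz x hx v
    have hxa : a ≤ x := ha hx
    have hx0 : 0 < x := ha0.trans_le hxa
    have h1 := norm_le_inv_one_add_sq hc1 hB0.le (hR z hz v)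
    have h2 : ‖φ z 0 * ((x : ℂ)⁻¹ * (verticalLine c v ^ 2)⁻¹)‖ ≤
        (K * a⁻¹) * (1 + v ^ 2)⁻¹ := by
      rw [norm_mul, norm_mul, norm_inv, norm_inv, Complex.norm_real, Real.norm_of_nonneg hx0.le,
        norm_pow, mul_assoc]
      have := hφ0 z hz
      have := one_add_sq_le_norm_verticalLine_sq hc1 v
      gcongr
    rw [hH, norm_mul, hD]
    refine (mul_le_mul ((norm_add_le _ _).trans (add_le_add h1 h2)) (hexp x hx v) (norm_nonneg _)
      (by positivity)).trans (le_of_eq ?_)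
    ring
  have hHi : ∀ z ∈ U, ∀ x ∈ S, Integrable (H z x) := fun z hz x hx =>
    hgi.mono' (hHc z hz x).aestronglyMeasurable (Eventually.of_forall (hHb z hz x hx))
  have hHint : ∀ z ∈ U, ∀ x ∈ S, ∫ v, H z x v = φ z x := by
    intro z hz x hx
    have hx0 : 0 < x := hSpos hx
    have hx0' : (x : ℂ) ≠ 0 := by exact_mod_cast hx0.ne'
    have i0 := integrable_verticalLine hc1 hB0.le (hRc z hz) (hR z hz)
    have i1 : Integrable fun v =>
        laplaceRemainder (φ z) (verticalLine c v) * Complex.exp (verticalLine c v * x) := by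
      refine (i0.norm.mul_const (Real.exp (c * x))).mono'
        (Continuous.aestronglyMeasurable ?_) (Eventually.of_forall fun v => ?_)
      · have := hRc z hz
        fun_prop
      · rw [norm_mul, norm_exp_verticalLine_mul]
    have i2 : Integrable fun v => φ z 0 * ((x : ℂ)⁻¹ *
        ((verticalLine c v ^ 2)⁻¹ * Complex.exp (verticalLine c v * x))) := by
      refine ((hHi z hz x hx).sub i1).congr (Eventually.of_forall fun v => ?_)
      simp only [hH, Pi.sub_apply]
      ring
    have e : H z x = fun v =>
        laplaceRemainder (φ z) (verticalLine c v) * Complex.exp (verticalLine c v * x) +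
        φ z 0 * ((x : ℂ)⁻¹ *
          ((verticalLine c v ^ 2)⁻¹ * Complex.exp (verticalLine c v * x))) := by
      ext v; simp only [hH]; ring
    rw [e, integral_add i1 i2, integral_const_mul, integral_const_mul,
      integral_verticalLine_inv_sq hc1 hx0.le,
      integral_laplaceRemainder hε (hφ.right hz) (hb z hz) hL (by linarith) i0 hx0.le]
    field_simp
    ring
  obtain ⟨E, hE⟩ : ∃ E, E = K * ((2 * Real.pi * a)⁻¹ * (2 * Real.exp (c * b))) := ⟨_, rfl⟩
  have hE0 : 0 ≤ E := by rw [hE]; positivity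
  have hsplit : ∀ z ∈ U, ∀ x ∈ S, ∀ V : ℝ,
      ∫ v in (-V)..V, realLaplace (fun x => φ z x) (verticalLine c v) *
        Complex.exp (verticalLine c v * x) =
      (∫ v in (-V)..V, H z x v) + φ z 0 * ((2 * Real.pi * Complex.I * x)⁻¹ *
      ((verticalLine c V)⁻¹ * Complex.exp (verticalLine c V * x) -
        (verticalLine c (-V))⁻¹ * Complex.exp (verticalLine c (-V) * x))) := by
    intro z hz x hx V
    rw [← intervalIntegral_verticalLine_inv hc0 (hSpos hx), ← intervalIntegral.integral_const_mul,
      ← intervalIntegral.integral_add ((hHc z hz x).intervalIntegrable _ _)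
        (Continuous.intervalIntegrable (by fun_prop) _ _)]
    congr 1
    ext v
    simp only [hH, laplaceRemainder]
    ring
  have hbdry : ∀ z ∈ U, ∀ x ∈ S, ∀ V : ℝ, 0 < V → ‖φ z 0 * ((2 * Real.pi * Complex.I * x)⁻¹ *
      ((verticalLine c V)⁻¹ * Complex.exp (verticalLine c V * x) -
        (verticalLine c (-V))⁻¹ * Complex.exp (verticalLine c (-V) * x)))‖ ≤ E * V⁻¹ := by
    intro z hz x hx V hV
    have hxa : a ≤ x := ha hx
    have hx0 : 0 < x := ha0.trans_le hxa
    have hV1 : ∀ v : ℝ, v ^ 2 = V ^ 2 → ‖(verticalLine c v)⁻¹ *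
        Complex.exp (verticalLine c v * x)‖ ≤ V⁻¹ * Real.exp (c * b) := by
      intro v hv
      have h1 : V ≤ ‖verticalLine c v‖ := by
        have := one_add_sq_le_norm_verticalLine_sq hc1 v
        exact le_of_sq_le_sq (by linarith) (norm_nonneg _)
      rw [norm_mul, norm_inv]
      exact mul_le_mul (inv_anti₀ hV h1) (hexp x hx v) (norm_nonneg _) (by positivity)
    have h2 := (norm_sub_le _ _).trans (add_le_add (hV1 V rfl) (hV1 (-V) (by ring)))
    have h3 : ‖(2 * Real.pi * Complex.I * x : ℂ)⁻¹‖ ≤ (2 * Real.pi * a)⁻¹ := by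
      rw [norm_inv, norm_mul, norm_mul, norm_mul, Complex.norm_I, Complex.norm_real,
        Complex.norm_real, Real.norm_of_nonneg hx0.le, Real.norm_of_nonneg Real.pi_pos.le,
        Complex.norm_ofNat, mul_one]
      exact inv_anti₀ (by positivity) (by gcongr)
    rw [norm_mul, norm_mul]
    refine (mul_le_mul (hφ0 z hz) (mul_le_mul h3 h2 (norm_nonneg _) (by positivity))
      (by positivity) hK.le).trans (le_of_eq ?_)
    rw [hE]; ring
  rw [Metric.tendstoUniformlyOn_iff]
  intro e he
  have hscale : Tendsto (fun T : ℝ => T / (2 * Real.pi)) atTop atTop :=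
    tendsto_id.atTop_div_const (by positivity)
  have lim1 := (intervalIntegral_tendsto_integral hgi tendsto_neg_atTop_atBot tendsto_id).const_sub
    (∫ v : ℝ, D * (1 + v ^ 2)⁻¹)
  have lim2 := (tendsto_inv_atTop_zero (𝕜 := ℝ)).const_mul E
  have lim := (lim1.add lim2).comp hscale
  rw [sub_self, mul_zero, add_zero] at lim
  filter_upwards [lim.eventually_lt_const he, eventually_gt_atTop 0] with T hT hT0 p hp
  refine lt_of_le_of_lt ?_ hT
  have hV : 0 < T / (2 * Real.pi) := by positivity
  simp only [Function.comp_apply, id]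
  rw [borelIntegral_eq hδ, dist_eq_norm]
  simp only [laplace_eq_realLaplace, inv_inv]
  rw [← hc, hsplit p.1 hp.1 p.2 hp.2, ← sub_sub, ← hHint p.1 hp.1 p.2 hp.2]
  refine (norm_sub_le _ _).trans (add_le_add ?_ (hbdry p.1 hp.1 p.2 hp.2 _ hV))
  rw [intervalIntegral.integral_of_le (by linarith), intervalIntegral.integral_of_le (by linarith)]
  exact norm_integral_sub_setIntegral_le measurableSet_Ioc (hHi p.1 hp.1 p.2 hp.2) hgi
    (Eventually.of_forall (hHb p.1 hp.1 p.2 hp.2))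

/-! ### Consequences of Gevrey estimates -/

lemma UniformGevreyAsymptotics.congr_coeff {U : Set ℂ} {d : ℝ} {f : ℂ → ℂ → ℂ} {c c' : ℕ → ℂ → ℂ}
    (h : UniformGevreyAsymptotics U d f c) (hc : ∀ k, EqOn (c k) (c' k) U) :
    UniformGevreyAsymptotics U d f c' := by
  obtain ⟨h1, δ, hδ, hδd, C, M, hC, hM, hb⟩ := h
  refine ⟨fun k => (h1 k).congr (hc k).symm, δ, hδ, hδd, C, M, hC, hM, fun n z hz h hh => ?_⟩
  simpa only [hc _ hz] using hb n z hz h hh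

/-- **Watson's lemma** for uniform asymptotics, at possibly different points. -/
lemma UniformGevreyAsymptotics.eqOn {U U' : Set ℂ} {d : ℝ} {f g : ℂ → ℂ → ℂ} {c c' : ℕ → ℂ → ℂ}
    (hf : UniformGevreyAsymptotics U d f c) (hg : UniformGevreyAsymptotics U' d g c')
    {z z' : ℂ} (hz : z ∈ U) (hz' : z' ∈ U') (hfd : DifferentiableOn ℂ (f z) (borelDisc d))
    (hgd : DifferentiableOn ℂ (g z') (borelDisc d)) (hc : ∀ k, c k z = c' k z') :
    EqOn (f z) (g z') (borelDisc d) := by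
  obtain ⟨-, δ, hδ, hδd, C, M, hC, hM, hb⟩ := hf
  obtain ⟨-, δ', hδ', hδd', C', M', hC', hM', hb'⟩ := hg
  have hm : 0 < min δ δ' := lt_min hδ hδ'
  refine eqOn_borelDisc_of_gevrey (a := fun k => c k z) hfd hgd hm
    ((min_le_left _ _).trans hδd) (C := max C C') (M := max M M') (lt_max_of_lt_left hC)
    (lt_max_of_lt_left hM) (fun n h hh => ?_) (fun n h hh => ?_)
  · refine (hb n z hz h (borelDisc_mono hm (min_le_left _ _) hh)).trans ?_
    gcongr <;> exact le_max_left _ _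
  · simp only [hc]
    refine (hb' n z' hz' h (borelDisc_mono hm (min_le_right _ _) hh)).trans ?_
    gcongr <;> exact le_max_right _ _

/-- Coefficients of the asymptotic series of a periodic function are periodic. -/
lemma UniformGevreyAsymptotics.coeff_periodic {U : Set ℂ} {d : ℝ} {f : ℂ → ℂ → ℂ}
    {c : ℕ → ℂ → ℂ} (h : UniformGevreyAsymptotics U d f c) (hd : 0 < d) {ω : ℂ}
    (hω : PeriodicInZ U (borelDisc d) ω f) (k : ℕ) {z : ℂ} (hz : z ∈ U) (hzω : z + ω ∈ U) :
    c k (z + ω) = c k z := by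
  have h1 : seriesAt c (z + ω) = seriesAt c z :=
    (h.hasExpansion hzω).unique ((h.hasExpansion hz).congr (by
      filter_upwards [Ioo_mem_nhdsGT hd] with x hx
      exact (hω z hz hzω x (ofReal_mem_borelDisc hx.1 hx.2)).symm))
  simpa [seriesAt] using congrArg (PowerSeries.coeff k) h1

lemma UniformGevreySeries.uniformlyConvergentSeries {U : Set ℂ} {c : ℕ → ℂ → ℂ}
    (h : UniformGevreySeries U c) : UniformlyConvergentSeries U (formalBorel c) := by
  obtain ⟨h1, C, M, hC, hM, hb⟩ := h
  -- The index shift in the Borel transform leaves a factor `k + 1 ≤ 2 ^ k`; the radius `1 / (4 M)`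
  -- still leaves the ratio `1 / 2`.
  refine ⟨fun k => (h1 (k + 1)).div_const _, (4 * M)⁻¹, by positivity, ?_⟩
  refine tendstoUniformlyOn_tsum_nat
    ((summable_geometric_of_lt_one (by norm_num : (0 : ℝ) ≤ 1 / 2) (by norm_num)).mul_left (C * M))
    fun k p hp => ?_
  have hp2 : ‖p.2‖ ≤ (4 * M)⁻¹ := by simpa using (Metric.mem_ball.1 hp.2).le
  have hk : ((k : ℝ) + 1) ≤ 2 ^ k := by exact_mod_cast Nat.lt_two_pow_self
  have hf : (0 : ℝ) < k.factorial := by exact_mod_cast k.factorial_pos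
  rw [formalBorel, norm_mul, norm_div, norm_pow, Complex.norm_natCast]
  calc ‖c (k + 1) p.1‖ / k.factorial * ‖p.2‖ ^ k
      ≤ (C * M ^ (k + 1) * ((k + 1).factorial : ℝ)) / k.factorial * ((4 * M)⁻¹) ^ k := by
        gcongr
        exact hb (k + 1) p.1 hp.1
    _ = C * M * ((k + 1) * (1 / 4) ^ k) := by
        rw [Nat.factorial_succ, mul_inv, mul_pow, inv_pow, inv_pow, one_div, inv_pow]
        push_cast
        field_simp
        ring
    _ ≤ C * M * (2 ^ k * (1 / 4) ^ k) := by gcongr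
    _ = C * M * (1 / 2) ^ k := by rw [← mul_pow]; norm_num

/-! ### The Borel transform of the formal solution -/

/-- The points `(z, ξ)` such that the characteristic through them stays in the domain of the
coefficients. -/
def riccatiDomain (r ε : ℝ) : Set (ℂ × ℂ) :=
  {p | p.1 ∈ tube r ∧ p.1 + p.2 ∈ tube r ∧ p.2 ∈ tube ε}

/-- On the segments concerned, the first coordinate and the sum of the coordinates stay on the
segment from `z` to `z + ξ`, and the second coordinate on that from `0` to `ξ`. Tubes are convex. -/
lemma isBorelDomain_riccatiDomain {r ε : ℝ} (hε : 0 < ε) :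
    IsBorelDomain (riccatiDomain r ε) := by
  refine ⟨?_, fun {z ξ} h t h0 h1 => ?_, fun {z ξ} h t h0 h1 => ?_⟩
  · exact ((isOpen_tube r).preimage continuous_fst).inter
      (((isOpen_tube r).preimage (continuous_fst.add continuous_snd)).inter
        ((isOpen_tube ε).preimage continuous_snd))
  all_goals
    obtain ⟨m1, m2, m3⟩ := h
    have t3 := convex_tube ε (zero_mem_tube hε) m3 (sub_nonneg.2 h1) h0 (by ring)
    rw [smul_zero, zero_add, Complex.real_smul] at t3
  · have t2 := convex_tube r m1 m2 (sub_nonneg.2 h1) h0 (by ring)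
    refine ⟨m1, ?_, t3⟩
    convert t2 using 1
    simp only [Complex.real_smul]
    push_cast
    ring
  · have t1 := convex_tube r m1 m2 h0 (sub_nonneg.2 h1) (by ring)
    refine ⟨?_, ?_, t3⟩
    · convert t1 using 1
      simp only [Complex.real_smul]
      push_cast
      ring
    · simpa using m2

/-- This is why the halfstrip has to shrink: the initial value is taken at `z + ξ`, which must
remain in the larger one. -/
lemma tube_prod_tube_subset {r r₀ ε : ℝ} (hε : 0 < ε) (h : ε ≤ r - r₀) :
    tube r₀ ×ˢ tube ε ⊆ riccatiDomain r ε := fun p hp =>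
  ⟨tube_mono (by linarith) hp.1, tube_mono (by linarith) (add_mem_tube hp.1 hp.2), hp.2⟩

lemma exists_isBorelData {r ε : ℝ} (hε : 0 < ε) {a : Fin 3 → ℕ → ℂ → ℂ} {α : Fin 3 → ℂ → ℂ → ℂ}
    (ha : ∀ i, UniformGevreySeries (tube r) (a i))
    (hα : ∀ i, IsBorelContinuation (tube r) ε (a i) (α i)) :
    ∃ K L : ℝ, IsBorelData (riccatiDomain r ε) (fun i => a i 0) α K L := by
  choose ha0 C M hC hM hb using ha
  choose K L hK hL hαb using fun i => (hα i).2.1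
  obtain ⟨i1, h1⟩ := Finite.exists_max C
  obtain ⟨i2, h2⟩ := Finite.exists_max K
  obtain ⟨i3, h3⟩ := Finite.exists_max L
  have hbound : ∀ i, ∀ z ∈ tube r, ‖a i 0 z‖ ≤ max (C i1) (K i2) := fun i z hz => by
    have := hb i 0 z hz
    simp only [pow_zero, mul_one, Nat.factorial_zero, Nat.cast_one] at this
    exact this.trans ((h1 i).trans (le_max_left _ _))
  exact ⟨max (C i1) (K i2), L i3,
    { domain := isBorelDomain_riccatiDomain hε
      K_pos := lt_max_of_lt_left (hC i1)
      L_nonneg := (hL i3).le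
      diff_coeff := fun i => (ha0 i 0).comp (by fun_prop) fun p hp => hp.1
      diff_shift := (ha0 0 0).comp (f := fun p : ℂ × ℂ => p.1 + p.2) (by fun_prop)
        fun p hp => hp.2.1
      norm_coeff := fun i z ξ h => hbound i z h.1
      norm_shift := fun z ξ h => hbound 0 _ h.2.1
      diff := fun i => DifferentiableOn.mono (hα i).1 fun p hp => ⟨hp.1, hp.2.2⟩
      bound := fun i z ξ h => by
        have := hαb i z h.1 ξ h.2.2
        simp only [pow_zero, Nat.factorial_zero, Nat.cast_one, div_one, one_mul]
        refine this.trans (mul_le_mul ((h2 i).trans (le_max_right _ _))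
          (Real.exp_le_exp.2 (mul_le_mul_of_nonneg_right (h3 i) (norm_nonneg _)))
          (Real.exp_pos _).le (lt_max_of_lt_left (hC i1)).le) }⟩

/-- The series of successive approximations is the Borel transform of the formal solution, and its
Laplace transform solves the Riccati equation. -/
theorem approxSum_spec {r r₀ ε δ d : ℝ} (hε : 0 < ε) (hεr : ε ≤ r - r₀) (hδ : 0 < δ)
    {A : Fin 3 → ℂ → ℂ → ℂ} {a : Fin 3 → ℕ → ℂ → ℂ} {α : Fin 3 → ℂ → ℂ → ℂ} {c : ℕ → ℂ → ℂ}
    (hAa : ∀ i, UniformGevreyAsymptotics (tube r) d (A i) (a i))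
    (hα : ∀ i, IsBorelContinuation (tube r) ε (a i) (α i))
    (hA : ∀ i, ∀ z ∈ tube r, ∀ h ∈ borelDisc δ, A i z h = a i 0 z + laplace (α i) z h)
    (hc : IsFormalSolution a (tube r) c) :
    (∃ K L : ℝ, 0 < K ∧ 0 < L ∧
      (∀ z ∈ tube r₀, ∀ ξ ∈ tube ε,
        ‖approxSum (fun i => a i 0) α z ξ‖ ≤ K * Real.exp (L * ‖ξ‖)) ∧
      ∀ d₁, 0 < d₁ → d₁ ≤ δ → L + 1 ≤ 1 / d₁ →
        SolvesRiccati A (tube r₀) (borelDisc d₁) (laplace (approxSum (fun i => a i 0) α)) ∧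
        UniformGevreyAsymptotics (tube r₀) d₁ (laplace (approxSum (fun i => a i 0) α)) c) ∧
    IsBorelContinuation (tube r₀) ε c (approxSum (fun i => a i 0) α) ∧
    ∀ z ∈ tube r₀, ∀ ξ ∈ tube ε, HasSum (fun n => succApprox (fun i => a i 0) α n z ξ)
      (approxSum (fun i => a i 0) α z ξ) := by
  have hW := tube_prod_tube_subset hε hεr
  have hr₀ : tube r₀ ⊆ tube r := tube_mono (by linarith)
  obtain ⟨K, L₀, hdata⟩ := exists_isBorelData hε (fun i => (hAa i).uniformGevreySeries) hα
  obtain ⟨L, hL₀, hL, hbd⟩ := hdata.norm_approxSum_le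
  set Φ := approxSum (fun i => a i 0) α
  have hK := hdata.K_pos
  have hΦ : HolomorphicOnProd Φ (tube r₀) (tube ε) := hdata.differentiableOn_approxSum.mono hW
  have hb : ∀ z ∈ tube r₀, ∀ ξ ∈ tube ε, ‖Φ z ξ‖ ≤ K * Real.exp (L * ‖ξ‖) := fun z hz ξ hξ => by
    simpa using hbd z ξ (hW ⟨hz, hξ⟩)
  have hsolve : ∀ d₁, 0 < d₁ → d₁ ≤ δ → L + 1 ≤ 1 / d₁ →
      SolvesRiccati A (tube r₀) (borelDisc d₁) (laplace Φ) := fun d₁ h1 h2 h3 =>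
    hdata.solvesRiccati (isOpen_tube r₀) hε hW hL₀ hbd h1 h3
      fun i z hz h hh => hA i z (hr₀ hz) h (borelDisc_mono h1 h2 hh)
  have hasym : ∀ d₁, 0 < d₁ → L + 1 ≤ 1 / d₁ →
      UniformGevreyAsymptotics (tube r₀) d₁ (laplace Φ) (laplaceCoeff Φ) := by
    intro d₁ h1 h3
    obtain ⟨C, M, hC, hM, hg⟩ := uniformGevreyAsymptotics_laplace hε hΦ hK hL.le hb h3
    exact ⟨holomorphicCoeffs_of_gevrey (isOpen_tube r₀)
      (holomorphicOnProd_laplace (isOpen_tube r₀) hε hΦ hb h1 h3) h1 le_rfl hg,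
      d₁, h1, le_rfl, C, M, hC, hM, hg⟩
  -- The coefficients do not depend on the Borel disc, so one admissible `d₁` suffices. The
  -- asymptotic series of the exact solution is a formal solution, hence equal to `c`.
  have hcoeff : ∀ k, EqOn (laplaceCoeff Φ k) (c k) (tube r₀) := by
    obtain ⟨d₁, hd₁⟩ : ∃ d₁, d₁ = min δ (1 / (L + 1)) := ⟨_, rfl⟩
    have h1 : 0 < d₁ := by rw [hd₁]; exact lt_min hδ (by positivity)
    have h2 : d₁ ≤ δ := by rw [hd₁]; exact min_le_left _ _
    have h3 : L + 1 ≤ 1 / d₁ := by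
      rw [le_div_comm₀ (by positivity) h1, hd₁]; exact min_le_right _ _
    have hform := (hsolve d₁ h1 h2 h3).isFormalSolution (isOpen_tube r₀) h1
      (holomorphicOnProd_laplace (isOpen_tube r₀) hε hΦ hb h1 h3)
      (fun i => (hAa i).mono hr₀ h1) (hasym d₁ h1 h3)
    exact fun k => (hc.mono hr₀).unique hform (isOpen_tube r₀) k
  refine ⟨⟨K, L, hK, hL, hb, fun d₁ h1 h2 h3 => ⟨hsolve d₁ h1 h2 h3,
    (hasym d₁ h1 h3).congr_coeff hcoeff⟩⟩, ⟨hΦ, ⟨K, L, hK, hL, hb⟩, ε, hε,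
    fun z hz ξ hξ hn => ?_⟩, fun z hz ξ hξ => hdata.hasSum_approxSum (hW ⟨hz, hξ⟩)⟩
  have := hasSum_formalBorel_laplaceCoeff (hΦ.right hz) hn
  simpa only [formalBorel, hcoeff _ hz] using this

open Classical in
/-- The analytic function that is defined by all Borel continuations of a formal series. -/
noncomputable def borelSum (U : Set ℂ) (c : ℕ → ℂ → ℂ) (z ξ : ℂ) : ℂ :=
  if h : ∃ ψ : ℂ → ℂ → ℂ, ∃ ε : ℝ, 0 < ε ∧ IsBorelContinuation U ε c ψ ∧ ξ ∈ tube ε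
  then h.choose z ξ else 0

lemma IsBorelContinuation.borelSum_eq {U : Set ℂ} {ε : ℝ} {c : ℕ → ℂ → ℂ} {ψ : ℂ → ℂ → ℂ}
    (hψ : IsBorelContinuation U ε c ψ) (hε : 0 < ε) {z ξ : ℂ} (hz : z ∈ U) (hξ : ξ ∈ tube ε) :
    borelSum U c z ξ = ψ z ξ := by
  have h : ∃ ψ : ℂ → ℂ → ℂ, ∃ ε : ℝ, 0 < ε ∧ IsBorelContinuation U ε c ψ ∧ ξ ∈ tube ε :=
    ⟨ψ, ε, hε, hψ, hξ⟩
  obtain ⟨ε', hε', h1, h2⟩ := h.choose_spec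
  rw [borelSum, dif_pos h]
  exact h1.eq_of_mem hε' hε hψ hz (fun _ => rfl) h2 hξ

lemma laplace_congr {φ ψ : ℂ → ℂ → ℂ} {z : ℂ} (h : ∀ x : ℝ, 0 ≤ x → φ z x = ψ z x) (w : ℂ) :
    laplace φ z w = laplace ψ z w :=
  setIntegral_congr_fun measurableSet_Ioi fun x hx => by simp only [h x (le_of_lt hx)]

theorem mainTheorem3 (r d : ℝ) (hr : 0 < r) (hd : 0 < d)
    (A : Fin 3 → ℂ → ℂ → ℂ) (a : Fin 3 → ℕ → ℂ → ℂ)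
    (hA : ∀ i, HolomorphicOnProd (A i) (tube r) (borelDisc d))
    (hAa : ∀ i, UniformGevreyAsymptotics (tube r) d (A i) (a i)) :
    ∃ c : ℕ → ℂ → ℂ,
      -- the formal solution, its uniqueness and its first two terms
      IsFormalSolution a (tube r) c ∧
      (∀ c', IsFormalSolution a (tube r) c' → ∀ k, EqOn (c' k) (c k) (tube r)) ∧
      (∀ z ∈ tube r, c 0 z = 0) ∧
      (∀ z ∈ tube r, c 1 z = -a 0 0 z) ∧
      -- the exact solution on each smaller halfstrip
      ∀ r₀ : ℝ, 0 < r₀ → r₀ < r →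
        ∃ d₀ : ℝ, 0 < d₀ ∧ d₀ ≤ d ∧ ∃ F φ : ℂ → ℂ → ℂ,
          HolomorphicOnProd F (tube r₀) (borelDisc d₀) ∧
          SolvesRiccati A (tube r₀) (borelDisc d₀) F ∧
          UniformGevreyAsymptotics (tube r₀) d₀ F c ∧
          (∀ G : ℂ → ℂ → ℂ, HolomorphicOnProd G (tube r₀) (borelDisc d₀) →
            SolvesRiccati A (tube r₀) (borelDisc d₀) G →
            UniformGevreyAsymptotics (tube r₀) d₀ G c →
            ∀ z ∈ tube r₀, ∀ h ∈ borelDisc d₀, G z h = F z h) ∧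
          -- the formal Borel transform converges uniformly
          UniformlyConvergentSeries (tube r₀) (formalBorel c) ∧
          UniformGevreySeries (tube r₀) c ∧
          -- `φ` is the analytic Borel transform, holomorphic with exponential growth on tubes
          IsBorelTransform (tube r₀) d₀ F φ ∧
          (∃ ε : ℝ, 0 < ε ∧ ε < r - r₀ ∧ ∃ α : Fin 3 → ℂ → ℂ → ℂ,
            ∀ i, IsBorelContinuation (tube r) ε (a i) (α i)) ∧
          (∀ ε : ℝ, 0 < ε → ε < r - r₀ → ∀ α : Fin 3 → ℂ → ℂ → ℂ,
            (∀ i, IsBorelContinuation (tube r) ε (a i) (α i)) →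
              IsBorelContinuation (tube r₀) ε c φ ∧
              ∀ z ∈ tube r₀, ∀ ξ ∈ tube ε,
                HasSum (fun n => succApprox (fun i => a i 0) α n z ξ) (φ z ξ)) ∧
          -- the solution is the Laplace transform of `φ`
          LaplaceUniformlyConvergent (tube r₀) (borelDisc d₀) φ ∧
          (∀ z ∈ tube r₀, ∀ h ∈ borelDisc d₀, F z h = laplace φ z h) ∧
          -- the solution is the Borel resummation of the formal solution
          IsUniformBorelResummation (tube r₀) (borelDisc d₀) c F ∧
          -- periodicity
          (∀ ω : ℂ, (∀ i, PeriodicInZ (tube r) (borelDisc d) ω (A i)) →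
            PeriodicInZ (tube r₀) (borelDisc d₀) ω F) := by
  have hc : IsFormalSolution a (tube r) (formalSolution a) :=
    isFormalSolution_formalSolution (isOpen_tube r) fun i => (hAa i).1
  set c := formalSolution a
  refine ⟨c, hc, fun c' hc' k => hc.unique hc' (isOpen_tube r) k, fun z hz => hc.apply_zero hz,
    fun z hz => hc.apply_one (isOpen_tube r) hz, fun r₀ hr₀ hr₀r => ?_⟩
  have hsub : tube r₀ ⊆ tube r := tube_mono hr₀r.le
  choose εs hεs δs hδs hδsd αs hαs hAαs using fun i =>
    exists_isBorelContinuation (isOpen_tube r) (hA i) (hAa i)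
  obtain ⟨i, hi⟩ := Finite.exists_min εs
  obtain ⟨j, hj⟩ := Finite.exists_min δs
  -- A thickness common to the three continuations; halving `r - r₀` makes the inequality strict.
  obtain ⟨ε₀, hε₀⟩ : ∃ ε₀, ε₀ = min (εs i) ((r - r₀) / 2) := ⟨_, rfl⟩
  have hε₀pos : 0 < ε₀ := by rw [hε₀]; exact lt_min (hεs i) (by linarith)
  have hε₀r : ε₀ < r - r₀ := by rw [hε₀]; exact (min_le_right _ _).trans_lt (by linarith)
  have hα₀ : ∀ i, IsBorelContinuation (tube r) ε₀ (a i) (αs i) := fun k =>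
    (hαs k).mono le_rfl (by rw [hε₀]; exact (min_le_left _ _).trans (hi k))
  have hA₀ : ∀ i, ∀ z ∈ tube r, ∀ h ∈ borelDisc (δs j),
      A i z h = a i 0 z + laplace (αs i) z h := fun k z hz h hh =>
    hAαs k z hz h (borelDisc_mono (hδs j) (hj k) hh)
  obtain ⟨⟨K, L, hK, hL, hb, hsol⟩, hcont, -⟩ :=
    approxSum_spec hε₀pos hε₀r.le (hδs j) hAa hα₀ hA₀ hc
  set Φ := approxSum (fun i => a i 0) αs
  have hΦ := hcont.1
  -- Small enough for the Laplace representations of all `A i`, and for `Re (1 / ħ)` to exceed the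
  -- growth rate of `Φ` by `1`.
  obtain ⟨d₀, hd₀⟩ : ∃ d₀, d₀ = min (δs j) (1 / (L + 1)) := ⟨_, rfl⟩
  have h1 : 0 < d₀ := by rw [hd₀]; exact lt_min (hδs j) (by positivity)
  have h2 : d₀ ≤ δs j := by rw [hd₀]; exact min_le_left _ _
  have h3 : L + 1 ≤ 1 / d₀ := by
    rw [le_div_comm₀ (by positivity) h1, hd₀]; exact min_le_right _ _
  obtain ⟨hF, hFc⟩ := hsol d₀ h1 h2 h3
  have hFhol := holomorphicOnProd_laplace (isOpen_tube r₀) hε₀pos hΦ hb h1 h3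
  -- A single function has to serve for every thickness and every choice of continuations, hence
  -- `borelSum` instead of `Φ`.
  have hφeq : ∀ z ∈ tube r₀, ∀ ξ ∈ tube ε₀, borelSum (tube r₀) c z ξ = Φ z ξ :=
    fun z hz ξ hξ => hcont.borelSum_eq hε₀pos hz hξ
  have hFφ : ∀ z ∈ tube r₀, ∀ h, laplace Φ z h = laplace (borelSum (tube r₀) c) z h :=
    fun z hz h => laplace_congr (fun x hx => (hφeq z hz x (ofReal_mem_tube hε₀pos hx)).symm) h
  have hφcont : IsBorelContinuation (tube r₀) ε₀ c (borelSum (tube r₀) c) := hcont.congr hφeq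
  have hφlap : LaplaceUniformlyConvergent (tube r₀) (borelDisc d₀) (borelSum (tube r₀) c) :=
    laplaceUniformlyConvergent_of_expBound hε₀pos hφcont.1
      (fun z hz ξ hξ => by rw [hφeq z hz ξ hξ]; exact hb z hz ξ hξ) h3
  refine ⟨d₀, h1, h2.trans (hδsd j), laplace Φ, borelSum (tube r₀) c, hFhol, hF, hFc,
    fun G hG _ hGc z hz => hGc.eqOn hFc hz hz (hG.right hz) (hFhol.right hz) fun _ => rfl,
    hFc.uniformGevreySeries.uniformlyConvergentSeries, hFc.uniformGevreySeries, ?_,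
    ⟨ε₀, hε₀pos, hε₀r, αs, hα₀⟩, ?_, hφlap, fun z hz h _ => hFφ z hz h,
    ⟨hFc.uniformGevreySeries, ε₀, hε₀pos, _, hφcont, hφlap, fun z hz h _ => ?_⟩, ?_⟩
  · intro δ hδ hδd S hS hSpos
    refine (isBorelTransform_laplace (isOpen_tube r₀) hε₀pos hΦ hK hL.le hb h1 h3 δ hδ hδd S hS
      hSpos).congr_right fun p hp => ?_
    exact (hφeq p.1 hp.1 _ (ofReal_mem_tube hε₀pos (le_of_lt (hSpos hp.2)))).symm
  · intro ε hε hεr α hα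
    -- Continuations on different tubes agree on the positive axis, so the Laplace representation of
    -- the coefficients holds for the new `α` too.
    have hAα : ∀ i, ∀ z ∈ tube r, ∀ h ∈ borelDisc (δs j),
        A i z h = a i 0 z + laplace (α i) z h := by
      intro i z hz h hh
      rw [hA₀ i z hz h hh, laplace_congr fun x hx => (hα₀ i).eq_of_mem hε₀pos hε (hα i) hz
        (fun _ => rfl) (ofReal_mem_tube hε₀pos hx) (ofReal_mem_tube hε hx)]
    obtain ⟨-, hcont', hsum⟩ := approxSum_spec hε hεr.le (hδs j) hAa hα hAα hc
    have heq : ∀ z ∈ tube r₀, ∀ ξ ∈ tube ε, borelSum (tube r₀) c z ξ =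
        approxSum (fun i => a i 0) α z ξ := fun z hz ξ hξ => hcont'.borelSum_eq hε hz hξ
    exact ⟨hcont'.congr heq, fun z hz ξ hξ => by rw [heq z hz ξ hξ]; exact hsum z hz ξ hξ⟩
  · rw [hc.apply_zero (hsub hz), zero_add]
    exact hFφ z hz h
  · intro ω hω z hz hzω
    -- Watson's lemma compares `F` at `z + ω` and at `z`: the formal coefficients at the two points
    -- coincide.
    exact hFc.eqOn hFc hzω hz (hFhol.right hzω) (hFhol.right hz) fun k =>
      hc.comp_add (isOpen_tube r) (fun i k z hz hzω => (hAa i).coeff_periodic hd (hω i) k hz hzω)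
        k (hsub hz) (hsub hzω)
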